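/- **Setting.** Let $\Omega\subset\mathbb R/\mathbb Z\times\mathbb R$ be a bounded doubly connected domain with non-contractible boundary components $\partial_\bot\Omega$ (bottom) and $\partial_\top\Omega$ (top). Functions on the double cover of $\Omega$ (the one on which a full turn around the cylinder exchanges the sheets) are called antiperiodic if their values on the two sheets are opposite. For $\eta\in\mathbb C$ and $z_1\in\Omega$ let $f_\Omega^{[\eta]}(z_1,\cdot)$ be the antiperiodic holomorphic function on $\Omega\smallsetminus\{z_1\}$ such that * $f_\Omega^{[\eta]}(z_1,z_2)=\frac1{\pi i}\cdot\frac{\overline\eta}{z_2-z_1}+O(1)$ as $z_2\to z_1$; * $\operatorname{Re} f_\Omega^{[\eta]}(z_1,\cdot)$ tends to $0$ at $\partial_\bot\Omega$; * near $\partial_\top\Omega$ there is an (antiperiodic) primitive of $f_\Omega^{[\eta]}(z_1,\cdot)$ whose imaginary part tends to $0$ at $\partial_\top\Omega$. Put $f_\Omega^{[\pm+]}=f_\Omega^{[1]}\pm i f_\Omega^{[i]}$ and $f_\Omega^{[\pm-]}=\overline{f_\Omega^{[\mp+]}}$. For $\ell>0$ let $\phi$ be a conformal isomorphism of $T^+=\mathbb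 R/\ell\mathbb Z\times(0,\pi)$ onto $\Omega$ that maps bottom to bottom and top to top, and define, for $s_1,s_2\in\{\pm\}$ and distinct $z_1,z_2\in T^+$, $$f^{[s_1,s_2]}(z_1,z_2)=f_\Omega^{[s_1,s_2]}(\phi(z_1),\phi(z_2))\,(\phi^{[s_1]}(z_1))^{1/2}(\phi^{[s_2]}(z_2))^{1/2},$$ where $\phi^{[+]}=\phi'$, $\phi^{[-]}=\overline{\phi'}$, the square root comes from a single-valued branch of $\log\phi'$ on $T^+$, and the square root of $\overline{\phi'}$ is the conjugate one. Let $$\mathcal A_n(z_1,\dots,z_n)=\frac1{4^n}\sum_{s_1,\dots,s_n\in\{\pm\}}\det\big[\mathbf 1_{j\ne k}f^{[s_j,s_k]}(z_j,z_k)\big]_{j,k=1}^n\prod_{k=1}^n dz_k^{[s_k]},\qquad dz^{[+]}=dz,\ dz^{[-]}=d\overline z,$$ let $h_n(w_1,\dots,w_n)=\int_{z_1^0}^{w_1}\cdots\int_{z_n^0}^{w_n}\mathcal A_n$, where $z_k^0$ lies on the bottom boundary of $T^+$ and the integrals are taken along disjoint paths, and let $M_n$ be the constant value of $h_n$ when all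 $w_k$ lie on the top boundary of $T^+$. Finally let $$F_2^{[s_1,s_2]}(z_1,z_2)=f^{[s_1,s_2]}(z_1,z_2)f^{[s_2,s_1]}(z_2,z_1),$$ $$F_3^{[s_1,s_2,s_3]}(z_1,z_2,z_3)=f^{[s_1,s_2]}(z_1,z_2)f^{[s_2,s_3]}(z_2,z_3)f^{[s_3,s_1]}(z_3,z_1).$$ **Proposition.** Fix $\ell>0$. The values $M_2$ and $M_3$ completely determine the differential forms $\mathcal A_n$ for all $n\ge2$; in particular they completely determine $M_n$ for all $n\ge4$. That is, let $(\Omega,\phi)$ and $(\Omega',\phi')$ be two domains as above, uniformized by the same cylinder $T^+$, with the same values of $M_2$ and of $M_3$. Then their forms $\mathcal A_n$ coincide at all pairwise distinct $z_1,\dots,z_n\in T^+$ for all $n\ge2$, and their moments $M_n$ coincide for all $n\ge4$. Moreover, $M_2$ and $M_3$ determine in the same sense the functions $F_2^{[s_1,s_2]}$ and $F_3^{[s_1,s_2,s_3]}$ at distinct points. For distinct $z_1,z_2,z_3\in T^+$ the numbers $F_3^{[s_1,s_2,s_3]}(z_1,z_2,z_3)$ and $F_3^{[s_3,s_2,s_1]}(z_3,z_2,z_1)$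 are the two roots (with multiplicity) of the quadratic equation $$X^2-\frac{8i}{\pi^3}\,s_1s_2s_3\,M_3\,X+F_2^{[s_1,s_2]}(z_1,z_2)F_2^{[s_2,s_3]}(z_2,z_3)F_2^{[s_3,s_1]}(z_3,z_1)=0,$$ and the two roots have opposite singularities: for $s\in\{\pm\}$ and fixed $z_1\ne z_3$, as $z_2\to z_1$, $$F_3^{[+,+,s]}(z_1,z_2,z_3)=\frac2{\pi i}\cdot\frac{F_2^{[+,s]}(z_1,z_3)}{z_2-z_1}+O(1),\qquad F_3^{[s,+,+]}(z_3,z_2,z_1)=-\frac2{\pi i}\cdot\frac{F_2^{[+,s]}(z_1,z_3)}{z_2-z_1}+O(1).$$ -/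

import Mathlib

open Filter Topology Asymptotics MeasureTheory
open scoped ComplexConjugate

noncomputable section

namespace DimerCylinder

/-! ### Cylindrical domains -/

/-- The infinite cylinder `ℝ/ℤ × ℝ`. -/
abbrev Cyl : Type := AddCircle (1 : ℝ) × ℝ

/-- The covering map `ℂ → ℂ/ℤ = ℝ/ℤ × ℝ`. -/
def toCyl (z : ℂ) : Cyl := ((z.re : AddCircle (1 : ℝ)), z.im)

/-- A bounded doubly connected domain `Ω ⊆ ℝ/ℤ × ℝ` with non-contractible boundary components:
the complement of the domain has exactly two connected components, `lower` containing the bottom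
end of the cylinder and `upper` containing the top end. -/
structure CylindricalDomain where
  carrier : Set Cyl
  lower : Set Cyl
  upper : Set Cyl
  isOpen_carrier : IsOpen carrier
  isConnected_carrier : IsConnected carrier
  isClosed_lower : IsClosed lower
  isClosed_upper : IsClosed upper
  isConnected_lower : IsConnected lower
  isConnected_upper : IsConnected upper
  disjoint_lower_upper : Disjoint lower upper
  compl_carrier : carrierᶜ = lower ∪ upper
  lower_end : ∃ c : ℝ, ∀ p : Cyl, p.2 ≤ c → p ∈ lower
  upper_end : ∃ c : ℝ, ∀ p : Cyl, c ≤ p.2 → p ∈ upper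

namespace CylindricalDomain

variable (D : CylindricalDomain)

/-- The bottom boundary component. -/
def bdryBot : Set Cyl := frontier D.lower

/-- The top boundary component. -/
def bdryTop : Set Cyl := frontier D.upper

/-- The preimage of the domain under `ℂ → ℂ/ℤ`. Functions on the double cover of the domain are
functions on this set with period `2`; antiperiodic ones satisfy `f (z + 1) = - f z`. -/
def lift : Set ℂ := toCyl ⁻¹' D.carrier

/-- The lift of the domain with the point `z₁` (that is, the whole fibre `z₁ + ℤ`) removed. -/
def puncturedLift (z₁ : ℂ) : Set ℂ := {z ∈ D.lift | ∀ k : ℤ, z ≠ z₁ + k}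

end CylindricalDomain

/-! ### The boundary value problem -/

/-- `f` is a solution `f_Ω^{[η]}(z₁, ·)` of the boundary value problem: it is holomorphic away from
`z₁` and antiperiodic, has the singularity `(π i)⁻¹ η̄ / (z - z₁) + O(1)` at `z₁`, its real part
tends to `0` at the bottom boundary, and, near the top boundary, it has a primitive whose imaginary
part tends to `0` at the top boundary. -/
structure IsSolution (D : CylindricalDomain) (η z₁ : ℂ) (f : ℂ → ℂ) : Prop where
  holomorphic : DifferentiableOn ℂ f (D.puncturedLift z₁)
  antiperiodic : ∀ z ∈ D.puncturedLift z₁, f (z + 1) = -f z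
  singularity :
    (fun z : ℂ => f z - 1 / (Real.pi * Complex.I) * (conj η / (z - z₁)))
      =O[𝓝[≠] z₁] (fun _ : ℂ => (1 : ℝ))
  bot : ∀ ζ : ℂ, toCyl ζ ∈ D.bdryBot → Tendsto (fun z => (f z).re) (𝓝[D.lift] ζ) (𝓝 0)
  top : ∃ V : Set Cyl, IsOpen V ∧ D.bdryTop ⊆ V ∧ ∃ g : ℂ → ℂ,
    (∀ z ∈ D.lift, toCyl z ∈ V → HasDerivAt g (f z) z ∧ g (z + 1) = -g z) ∧
    ∀ ζ : ℂ, toCyl ζ ∈ D.bdryTop → Tendsto (fun z => (g z).im) (𝓝[D.lift] ζ) (𝓝 0)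

/-- `f η z₁ z₂ = f_Ω^{[η]}(z₁, z₂)` is the family of solutions of the boundary value problem, for
all parameters `η` and all positions `z₁` of the singularity. -/
def IsCouplingFamily (D : CylindricalDomain) (f : ℂ → ℂ → ℂ → ℂ) : Prop :=
  ∀ η : ℂ, ∀ z₁ ∈ D.lift, IsSolution D η z₁ (f η z₁)

/-- For a sign `s`, the number `w^{[s]}`: `w^{[+]} = w` and `w^{[-]} = w̄`. -/
def signed (s : ℤˣ) (w : ℂ) : ℂ := if s = 1 then w else conj w

/-- The functions `f_Ω^{[s₁, s₂]}`: `f_Ω^{[±,+]} = f_Ω^{[1]} ± i f_Ω^{[i]}` and `f_Ω^{[±,-]}` is the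
complex conjugate of `f_Ω^{[∓,+]}`. -/
def couplingPM (f : ℂ → ℂ → ℂ → ℂ) (s₁ s₂ : ℤˣ) (z₁ z₂ : ℂ) : ℂ :=
  if s₂ = 1 then f 1 z₁ z₂ + ((s₁ : ℤ) : ℂ) * Complex.I * f Complex.I z₁ z₂
  else conj (f 1 z₁ z₂ - ((s₁ : ℤ) : ℂ) * Complex.I * f Complex.I z₁ z₂)

/-! ### Transfer to the straight cylinder -/

/-- The strip `ℝ × (0, π)`, the universal cover of the straight cylinder
`T⁺ = ℝ/ℓℤ × (0, π)`. -/
def strip : Set ℂ := {z | 0 < z.im ∧ z.im < Real.pi}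

/-- A conformal isomorphism from the straight cylinder `T⁺ = ℝ/ℓℤ × (0, π)` onto the domain,
matching bottom with bottom and top with top (given by its lift `toFun` to the strip), together
with a single-valued branch `logDeriv` on `T⁺` of the logarithm of its derivative. The branch
serves to define `(φ')^{1/2} = exp (logDeriv / 2)`. -/
structure Uniformization (ℓ : ℝ) (D : CylindricalDomain) where
  toFun : ℂ → ℂ
  holomorphic : DifferentiableOn ℂ toFun strip
  map_add_period : ∀ z ∈ strip, toFun (z + ℓ) = toFun z + 1
  injective : ∀ z ∈ strip, ∀ w ∈ strip, toCyl (toFun z) = toCyl (toFun w) →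
    ∃ m : ℤ, z = w + m * ℓ
  image_eq : (fun z => toCyl (toFun z)) '' strip = D.carrier
  tendsto_bot : Tendsto (fun z => toCyl (toFun z)) (comap Complex.im (𝓝[>] 0)) (𝓝ˢ D.bdryBot)
  tendsto_top :
    Tendsto (fun z => toCyl (toFun z)) (comap Complex.im (𝓝[<] Real.pi)) (𝓝ˢ D.bdryTop)
  logDeriv : ℂ → ℂ
  logDeriv_holomorphic : DifferentiableOn ℂ logDeriv strip
  logDeriv_periodic : ∀ z ∈ strip, logDeriv (z + ℓ) = logDeriv z
  exp_logDeriv : ∀ z ∈ strip, Complex.exp (logDeriv z) = deriv toFun z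

/-- The functions `f^{[s₁, s₂]}` on `T⁺ × T⁺` (lifted to the strip):
`f_Ω^{[s₁, s₂]}(φ(z₁), φ(z₂)) (φ^{[s₁]}(z₁))^{1/2} (φ^{[s₂]}(z₂))^{1/2}`, where
`φ^{[+]} = φ'` and `φ^{[-]}` is its complex conjugate. -/
def cylPM {ℓ : ℝ} {D : CylindricalDomain} (Φ : Uniformization ℓ D) (f : ℂ → ℂ → ℂ → ℂ)
    (s₁ s₂ : ℤˣ) (z₁ z₂ : ℂ) : ℂ :=
  couplingPM f s₁ s₂ (Φ.toFun z₁) (Φ.toFun z₂) *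
    signed s₁ (Complex.exp (Φ.logDeriv z₁ / 2)) * signed s₂ (Complex.exp (Φ.logDeriv z₂ / 2))

/-! ### The functions `F₂`, `F₃`, the forms `𝒜ₙ`, their primitives `hₙ` and the moments `Mₙ`

Here `K s₁ s₂ z₁ z₂` stands for `f^{[s₁, s₂]}(z₁, z₂)`. -/

/-- `F₂^{[s₁, s₂]}(z₁, z₂)`. -/
def F₂ (K : ℤˣ → ℤˣ → ℂ → ℂ → ℂ) (s₁ s₂ : ℤˣ) (z₁ z₂ : ℂ) : ℂ :=
  K s₁ s₂ z₁ z₂ * K s₂ s₁ z₂ z₁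

/-- `F₃^{[s₁, s₂, s₃]}(z₁, z₂, z₃)`. -/
def F₃ (K : ℤˣ → ℤˣ → ℂ → ℂ → ℂ) (s₁ s₂ s₃ : ℤˣ) (z₁ z₂ z₃ : ℂ) : ℂ :=
  K s₁ s₂ z₁ z₂ * K s₂ s₃ z₂ z₃ * K s₃ s₁ z₃ z₁

/-- The value of the differential form
`𝒜ₙ = 4⁻ⁿ ∑ₛ det [1_{j ≠ k} f^{[sⱼ, sₖ]}(zⱼ, zₖ)] ∏ₖ dzₖ^{[sₖ]}` at the point `(z₁, …, zₙ)` on the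
tangent vectors `v₁, …, vₙ` (one for each of the variables). -/
def formA (K : ℤˣ → ℤˣ → ℂ → ℂ → ℂ) (n : ℕ) (z v : Fin n → ℂ) : ℂ :=
  1 / 4 ^ n * ∑ s : Fin n → ℤˣ,
    (Matrix.of fun j k : Fin n => if j = k then 0 else K (s j) (s k) (z j) (z k)).det *
      ∏ k, signed (s k) (v k)

/-- The points `z₁, …, zₙ` of the strip represent pairwise distinct points of `T⁺`. -/
def IsConfiguration (ℓ : ℝ) {n : ℕ} (z : Fin n → ℂ) : Prop :=
  (∀ k, z k ∈ strip) ∧ ∀ j k, j ≠ k → ∀ m : ℤ, z j ≠ z k + m * ℓ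

/-- Pairwise disjoint continuously differentiable paths `γ₁, …, γₙ` in the closure of `T⁺` (lifted
to the strip), where `γₖ` starts on the bottom boundary, runs inside `T⁺` and ends at `wₖ`. -/
structure IsPathFamily (ℓ : ℝ) {n : ℕ} (w : Fin n → ℂ) (γ : Fin n → ℝ → ℂ) : Prop where
  contDiff : ∀ k, ContDiff ℝ 1 (γ k)
  start : ∀ k, (γ k 0).im = 0
  finish : ∀ k, γ k 1 = w k
  mem_strip : ∀ k, ∀ t ∈ Set.Ioo (0 : ℝ) 1, γ k t ∈ strip
  disjoint : ∀ j k, j ≠ k → ∀ t ∈ Set.Icc (0 : ℝ) 1, ∀ u ∈ Set.Icc (0 : ℝ) 1, ∀ m : ℤ,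
    γ j t ≠ γ k u + m * ℓ

/-- `h` is the value `hₙ(w₁, …, wₙ)`: the multiple integral of `𝒜ₙ` converges and equals `h` along
all families of disjoint paths from the bottom boundary to `w₁, …, wₙ`. -/
def HasHeight (ℓ : ℝ) (K : ℤˣ → ℤˣ → ℂ → ℂ → ℂ) (n : ℕ) (w : Fin n → ℂ) (h : ℝ) : Prop :=
  ∀ γ : Fin n → ℝ → ℂ, IsPathFamily ℓ w γ →
    IntegrableOn (fun t : Fin n → ℝ => formA K n (fun k => γ k (t k)) (fun k => deriv (γ k) (t k)))
      (Set.univ.pi fun _ => Set.Ioo (0 : ℝ) 1) ∧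
    ∫ t in Set.univ.pi fun _ : Fin n => Set.Ioo (0 : ℝ) 1,
      formA K n (fun k => γ k (t k)) (fun k => deriv (γ k) (t k)) = (h : ℂ)

/-- `M` is the moment `Mₙ`, the constant value of `hₙ` on the top boundary of `T⁺` in all
variables. -/
def HasMoment (ℓ : ℝ) (K : ℤˣ → ℤˣ → ℂ → ℂ → ℂ) (n : ℕ) (M : ℝ) : Prop :=
  ∀ w : Fin n → ℂ, (∀ k, (w k).im = Real.pi) → HasHeight ℓ K n w M

end DimerCylinder

end

noncomputable section

namespace DimerCylinder

/-! ### Removable singularities -/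

/-! The boundary value problem can be solved explicitly on the straight cylinder. Put `L = log φ'`.
Fourier series give a holomorphic `W` that is real on the bottom line and such that `V = W - L` has
constant imaginary part `-α` on the top line (`exists_isGauge`). For a solution `f` with pole at
`φ(z₁)`, the function `(f ∘ φ) · exp W` is imaginary at the bottom. At the top it equals `(f ∘ φ) φ'
· exp V`, where the differential `(f ∘ φ) φ' dz` is real, so its argument is constant modulo `π`.
The two reflections compose to the translation by `2πi`, with unimodular multiplier `c = -exp
(-2iα)`. Let `S` be the Szegő kernel of `ℂ / (ℓℤ + 2πiℤ)` with multipliers `-1` and `c`. Then `(f ∘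
φ) · exp W` is a combination of `S (z - z₁)` and `S (z - z̄₁)`: the difference has no poles, and the
maximum principle with antiperiodicity makes it vanish (`eq_zero_of_reflections`,
`Uniformization.solution_eq`). The combinations `f^{[±,+]}` separate the two poles, so all four
`f^{[s₁,s₂]}` are values of the single function `S`, up to a sign, a constant and a gauge factor
(`exists_hasKernelForm`). Gauge factors cancel in cyclic products, so `F₂`, `F₃` and the forms `𝒜ₙ`
depend on the domain only through `S`.

It remains to recover `S` from two numbers. By Liouville's theorem `S z * S (-z)` is known up to an
additive constant, which `M₂` fixes, and `S a * S b * S (-(a + b)) + S (-a) * S (-b) * S (a + b)` is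
a constant `Q`, which equals `M₃`. The limit `b → 0` of the cubic identity is a differential
equation determining the logarithmic derivative of `S` up to an additive constant. Hence two kernels
with the same invariants differ by a factor `C * exp (k * z)`. The period `ℓ` forces `kℓ ∈ 2πiℤ`,
unimodularity of the multipliers forces `k` to be real, so `k = 0`, and the residue gives `C = 1`
(`IsSzego.eq_of_invariants_eq`).

In the quadratic equation, the product of the roots regroups into values of `F₂`, and their sum is a
multiple of `Q`. -/

/-- `h` is holomorphic and bounded in a punctured neighbourhood of `p`. -/
def RemovableAt (h : ℂ → ℂ) (p : ℂ) : Prop :=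
  (∀ᶠ z in 𝓝[≠] p, DifferentiableAt ℂ h z) ∧ h =O[𝓝[≠] p] (fun _ : ℂ => (1 : ℝ))

/-- The function `h` with all its removable singularities removed. -/
def removed (h : ℂ → ℂ) (z : ℂ) : ℂ := limUnder (𝓝[≠] z) h

lemma removed_eq_of_tendsto {h : ℂ → ℂ} {z a : ℂ} (hz : Tendsto h (𝓝[≠] z) (𝓝 a)) :
    removed h z = a := hz.limUnder_eq

lemma removed_eq {h : ℂ → ℂ} {z : ℂ} (hz : ContinuousAt h z) : removed h z = h z :=
  removed_eq_of_tendsto (hz.tendsto.mono_left nhdsWithin_le_nhds)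

lemma RemovableAt.differentiableAt_removed {h : ℂ → ℂ} {p : ℂ} (hp : RemovableAt h p) :
    DifferentiableAt ℂ (removed h) p := by
  obtain ⟨hd, hb⟩ := hp
  obtain ⟨C, hC⟩ := hb.bound
  have hev : {z | z ≠ p → DifferentiableAt ℂ h z ∧ ‖h z‖ ≤ C} ∈ 𝓝 p := by
    have := hd.and hC
    rw [eventually_nhdsWithin_iff] at this
    filter_upwards [this] with z hz hzp
    have := hz hzp
    simpa using this
  have key : DifferentiableOn ℂ (Function.update h p (limUnder (𝓝[≠] p) h))
      {z | z ≠ p → DifferentiableAt ℂ h z ∧ ‖h z‖ ≤ C} := by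
    apply Complex.differentiableOn_update_limUnder_of_bddAbove hev
    · exact fun z hz => (hz.1 hz.2).1.differentiableWithinAt
    · refine ⟨C, ?_⟩
      rintro _ ⟨z, hz, rfl⟩
      exact (hz.1 hz.2).2
  refine (key.differentiableAt hev).congr_of_eventuallyEq ?_
  filter_upwards [hev] with z hz
  by_cases hzp : z = p
  · subst hzp; simp [removed]
  · rw [Function.update_of_ne hzp]
    exact removed_eq (hz hzp).1.continuousAt

lemma RemovableAt.eventually_differentiableAt_removed {h : ℂ → ℂ} {p : ℂ} (hp : RemovableAt h p) :
    ∀ᶠ z in 𝓝 p, DifferentiableAt ℂ (removed h) z := by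
  have h2 := hp.1
  rw [eventually_nhdsWithin_iff, ← eventually_eventually_nhds] at h2
  filter_upwards [h2] with z hz
  by_cases hzp : z = p
  · exact hzp ▸ hp.differentiableAt_removed
  · refine (hz.self_of_nhds hzp).congr_of_eventuallyEq ?_
    filter_upwards [hz, isOpen_ne.mem_nhds hzp] with w hw hw2
    exact removed_eq (hw hw2).continuousAt

lemma RemovableAt.of_differentiableAt {h : ℂ → ℂ} {p : ℂ}
    (hd : ∀ᶠ z in 𝓝 p, DifferentiableAt ℂ h z) : RemovableAt h p :=
  ⟨hd.filter_mono nhdsWithin_le_nhds,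
    (hd.self_of_nhds.continuousAt.isBigO_one ℝ).mono nhdsWithin_le_nhds⟩

lemma RemovableAt.congr {h k : ℂ → ℂ} {p : ℂ} (hp : RemovableAt h p) (hk : h =ᶠ[𝓝[≠] p] k) :
    RemovableAt k p := by
  refine ⟨?_, hp.2.congr' hk EventuallyEq.rfl⟩
  have h2 := hk
  rw [EventuallyEq, eventually_nhdsWithin_iff, ← eventually_eventually_nhds] at h2
  filter_upwards [hp.1, nhdsWithin_le_nhds h2, self_mem_nhdsWithin] with z hz hz2 hz3
  refine hz.congr_of_eventuallyEq ?_
  filter_upwards [hz2, isOpen_ne.mem_nhds hz3] with w hw hw2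
  exact (hw hw2).symm

lemma RemovableAt.add {h k : ℂ → ℂ} {p : ℂ} (hp : RemovableAt h p) (kp : RemovableAt k p) :
    RemovableAt (fun z => h z + k z) p :=
  ⟨by filter_upwards [hp.1, kp.1] with z h1 h2 using h1.add h2, hp.2.add kp.2⟩

lemma RemovableAt.sub {h k : ℂ → ℂ} {p : ℂ} (hp : RemovableAt h p) (kp : RemovableAt k p) :
    RemovableAt (fun z => h z - k z) p :=
  ⟨by filter_upwards [hp.1, kp.1] with z h1 h2 using h1.sub h2, hp.2.sub kp.2⟩

lemma RemovableAt.mul {h k : ℂ → ℂ} {p : ℂ} (hp : RemovableAt h p) (kp : RemovableAt k p) :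
    RemovableAt (fun z => h z * k z) p :=
  ⟨by filter_upwards [hp.1, kp.1] with z h1 h2 using h1.mul h2, by simpa using hp.2.mul kp.2⟩

lemma tendsto_affine_punctured {a : ℂ} (ha : a ≠ 0) (b p : ℂ) :
    Tendsto (fun z => a * z + b) (𝓝[≠] p) (𝓝[≠] (a * p + b)) := by
  refine tendsto_nhdsWithin_iff.2 ⟨?_, ?_⟩
  · exact (Continuous.tendsto (by fun_prop) p).mono_left nhdsWithin_le_nhds
  · filter_upwards [self_mem_nhdsWithin] with z hz h
    exact hz (mul_left_cancel₀ ha (add_right_cancel h))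

lemma RemovableAt.comp_affine {h : ℂ → ℂ} {a : ℂ} (ha : a ≠ 0) {b p : ℂ}
    (hp : RemovableAt h (a * p + b)) : RemovableAt (fun z => h (a * z + b)) p := by
  have ht := tendsto_affine_punctured ha b p
  refine ⟨?_, hp.2.comp_tendsto ht⟩
  filter_upwards [ht.eventually hp.1] with z hz
  exact DifferentiableAt.comp z hz (by fun_prop)

/-- A differentiable function vanishing at `p`, divided by `z - p`. -/
lemma RemovableAt.div_sub {h : ℂ → ℂ} {p : ℂ} (hd : ∀ᶠ z in 𝓝 p, DifferentiableAt ℂ h z)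
    (h0 : h p = 0) : RemovableAt (fun z => h z / (z - p)) p := by
  refine ⟨?_, ?_⟩
  · filter_upwards [nhdsWithin_le_nhds hd, self_mem_nhdsWithin] with z hz hzp
    exact hz.div (by fun_prop) (sub_ne_zero.2 hzp)
  · have := hd.self_of_nhds.isBigO_sub
    simp only [h0, sub_zero] at this
    refine IsBigO.trans (((this.mono nhdsWithin_le_nhds).mul
      (isBigO_refl (fun z => (z - p)⁻¹) _)).congr_left fun z => (div_eq_mul_inv _ _).symm) ?_
    refine IsBigO.of_bound 1 ?_
    filter_upwards [self_mem_nhdsWithin] with z hz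
    rw [mul_inv_cancel₀ (sub_ne_zero.2 hz)]
    simp

/-- Translation carries one punctured neighbourhood filter onto the other, so both sides are limits
of the same filter map; no convergence is needed. -/
lemma removed_add_of_periodic {h : ℂ → ℂ} {t : ℂ} (ht : ∀ z, h (z + t) = h z) (z : ℂ) :
    removed h (z + t) = removed h z := by
  have : 𝓝[≠] (z + t) = map (fun w => w + t) (𝓝[≠] z) := by
    refine le_antisymm ?_ (by
      have := tendsto_affine_punctured one_ne_zero t z
      simp only [one_mul] at this
      exact this)
    simp
  rw [removed, removed, limUnder, limUnder, this, map_map]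
  simp only [Function.comp_def, ht]

/-! ### The lattice `ℓℤ + 2πiℤ` -/

/-- The lattice `ℓℤ + 2πiℤ`. -/
def lattice (ℓ : ℝ) : AddSubgroup ℂ where
  carrier := {z | ∃ m n : ℤ, z = m * ℓ + n * (2 * Real.pi * Complex.I)}
  zero_mem' := ⟨0, 0, by simp⟩
  add_mem' := by
    rintro _ _ ⟨m, n, rfl⟩ ⟨m', n', rfl⟩
    exact ⟨m + m', n + n', by push_cast; ring⟩
  neg_mem' := by
    rintro _ ⟨m, n, rfl⟩
    exact ⟨-m, -n, by push_cast; ring⟩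

lemma mem_lattice {ℓ : ℝ} {z : ℂ} :
    z ∈ lattice ℓ ↔ ∃ m n : ℤ, z = m * ℓ + n * (2 * Real.pi * Complex.I) := Iff.rfl

lemma period_mem_lattice (ℓ : ℝ) : (ℓ : ℂ) ∈ lattice ℓ := ⟨1, 0, by simp⟩

lemma two_pi_I_mem_lattice (ℓ : ℝ) : (2 * Real.pi * Complex.I : ℂ) ∈ lattice ℓ := ⟨0, 1, by simp⟩

lemma conj_mem_lattice {ℓ : ℝ} {z : ℂ} : conj z ∈ lattice ℓ ↔ z ∈ lattice ℓ := by
  have key : ∀ w : ℂ, w ∈ lattice ℓ → conj w ∈ lattice ℓ := by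
    rintro _ ⟨m, n, rfl⟩
    exact ⟨m, -n, by simp [map_ofNat]⟩
  exact ⟨fun h => by simpa using key _ h, key z⟩

lemma isClosed_lattice {ℓ : ℝ} (hℓ : 0 < ℓ) : IsClosed (lattice ℓ : Set ℂ) := by
  have hc : IsClosed (Set.range ((↑) : ℤ → ℝ)) := Int.isClosedEmbedding_coe_real.isClosed_range
  have h1 : IsClosed {z : ℂ | z.re / ℓ ∈ Set.range ((↑) : ℤ → ℝ)} :=
    hc.preimage (f := fun z : ℂ => z.re / ℓ) (by fun_prop)
  have h2 : IsClosed {z : ℂ | z.im / (2 * Real.pi) ∈ Set.range ((↑) : ℤ → ℝ)} :=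
    hc.preimage (f := fun z : ℂ => z.im / (2 * Real.pi)) (by fun_prop)
  convert h1.inter h2 using 1
  ext z
  simp only [SetLike.mem_coe, mem_lattice, Set.mem_inter_iff, Set.mem_ofPred_eq, Set.mem_range]
  constructor
  · rintro ⟨m, n, rfl⟩
    refine ⟨⟨m, ?_⟩, ⟨n, ?_⟩⟩
    · simp; field_simp
    · simp
  · rintro ⟨⟨m, hm⟩, ⟨n, hn⟩⟩
    refine ⟨m, n, ?_⟩
    rw [eq_div_iff (by positivity)] at hm hn
    apply Complex.ext <;> simp [← hm, ← hn]

lemma eventually_notMem_lattice_zero {ℓ : ℝ} (hℓ : 0 < ℓ) :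
    ∀ᶠ z in 𝓝[≠] (0 : ℂ), z ∉ lattice ℓ := by
  have hr : 0 < min ℓ (2 * Real.pi) := by positivity
  filter_upwards [nhdsWithin_le_nhds (Metric.ball_mem_nhds (0 : ℂ) hr), self_mem_nhdsWithin]
    with z hz hz0 hzl
  obtain ⟨m, n, rfl⟩ := hzl
  apply hz0
  rw [mem_ball_zero_iff] at hz
  have h1 := (Complex.abs_re_le_norm _).trans_lt (hz.trans_le (min_le_left _ _))
  have h2 := (Complex.abs_im_le_norm _).trans_lt (hz.trans_le (min_le_right _ _))
  simp only [Complex.add_re, Complex.mul_re, Complex.intCast_re, Complex.ofReal_re,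
    Complex.intCast_im, Complex.ofReal_im, Complex.I_re, Complex.I_im, Complex.add_im,
    Complex.mul_im] at h1 h2
  norm_num [abs_mul, abs_of_pos hℓ, abs_of_pos Real.pi_pos] at h1 h2
  have hm : |(m : ℝ)| < 1 := by nlinarith
  have hn : |(n : ℝ)| < 1 := by nlinarith [Real.pi_pos]
  have hm' : m = 0 := Int.abs_lt_one_iff.1 (by exact_mod_cast hm)
  have hn' : n = 0 := Int.abs_lt_one_iff.1 (by exact_mod_cast hn)
  simp [hm', hn']

lemma eventually_notMem_lattice {ℓ : ℝ} (hℓ : 0 < ℓ) (p : ℂ) : ∀ᶠ z in 𝓝[≠] p, z ∉ lattice ℓ := by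
  by_cases hp : p ∈ lattice ℓ
  · have ht : Tendsto (fun z => z - p) (𝓝[≠] p) (𝓝[≠] 0) := by
      simpa [sub_eq_add_neg] using tendsto_affine_punctured one_ne_zero (-p) p
    filter_upwards [ht.eventually (eventually_notMem_lattice_zero hℓ)] with z hz hzl
    exact hz (sub_mem hzl hp)
  · exact nhdsWithin_le_nhds ((isClosed_lattice hℓ).isOpen_compl.mem_nhds hp)

lemma countable_lattice (ℓ : ℝ) : (lattice ℓ : Set ℂ).Countable := by
  have : (lattice ℓ : Set ℂ) =
      Set.range fun p : ℤ × ℤ => (p.1 * ℓ + p.2 * (2 * Real.pi * Complex.I) : ℂ) := by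
    ext z
    simp [mem_lattice, eq_comm]
  rw [this]
  exact Set.countable_range _

lemma apply_add_of_mem_lattice {ℓ : ℝ} {h : ℂ → ℂ} (h1 : ∀ z, h (z + ℓ) = h z)
    (h2 : ∀ z, h (z + 2 * Real.pi * Complex.I) = h z) {t : ℂ} (ht : t ∈ lattice ℓ) (z : ℂ) :
    h (z + t) = h z := by
  obtain ⟨m, n, rfl⟩ := ht
  have p1 : Function.Periodic h (ℓ : ℂ) := h1
  have p2 : Function.Periodic h (2 * Real.pi * Complex.I : ℂ) := h2
  rw [← add_assoc, p2.int_mul n, p1.int_mul m]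

lemma exists_add_lattice_mem_box {ℓ : ℝ} (hℓ : 0 < ℓ) (z : ℂ) :
    ∃ t ∈ lattice ℓ, z + t ∈ Set.Icc 0 ℓ ×ℂ Set.Icc 0 (2 * Real.pi) := by
  have h2 : 0 < 2 * Real.pi := by positivity
  refine ⟨_, ⟨-⌊z.re / ℓ⌋, -⌊z.im / (2 * Real.pi)⌋, rfl⟩, ?_⟩
  have a1 := Int.floor_le (z.re / ℓ)
  have a2 := Int.lt_floor_add_one (z.re / ℓ)
  have b1 := Int.floor_le (z.im / (2 * Real.pi))
  have b2 := Int.lt_floor_add_one (z.im / (2 * Real.pi))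
  rw [le_div_iff₀ hℓ] at a1
  rw [div_lt_iff₀ hℓ] at a2
  rw [le_div_iff₀ h2] at b1
  rw [div_lt_iff₀ h2] at b2
  rw [Complex.mem_reProdIm]
  simp
  refine ⟨⟨?_, ?_⟩, ?_, ?_⟩ <;> linarith

/-- Liouville's theorem for doubly periodic functions. -/
lemma exists_removed_eq_const {ℓ : ℝ} (hℓ : 0 < ℓ) {h : ℂ → ℂ} (hr : ∀ p, RemovableAt h p)
    (h1 : ∀ z, h (z + ℓ) = h z) (h2 : ∀ z, h (z + 2 * Real.pi * Complex.I) = h z) :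
    ∃ C, ∀ z, removed h z = C := by
  have hd : Differentiable ℂ (removed h) := fun p => (hr p).differentiableAt_removed
  refine hd.exists_const_forall_eq_of_bounded ?_
  have hcomp : IsCompact (Set.Icc 0 ℓ ×ℂ Set.Icc 0 (2 * Real.pi)) :=
    isCompact_Icc.reProdIm isCompact_Icc
  refine (hcomp.image hd.continuous).isBounded.subset ?_
  rintro _ ⟨z, rfl⟩
  obtain ⟨t, ht, hz⟩ := exists_add_lattice_mem_box hℓ z
  exact ⟨z + t, hz, apply_add_of_mem_lattice (removed_add_of_periodic h1)
    (fun z => removed_add_of_periodic (t := 2 * Real.pi * Complex.I) (fun z => h2 z) z) ht z⟩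

/-- For elliptic functions it suffices to check one singular point in each lattice class. -/
lemma RemovableAt.of_sub_mem_lattice {ℓ : ℝ} {h : ℂ → ℂ} (h1 : ∀ z, h (z + ℓ) = h z)
    (h2 : ∀ z, h (z + 2 * Real.pi * Complex.I) = h z) {p q : ℂ} (hq : RemovableAt h q)
    (hpq : q - p ∈ lattice ℓ) : RemovableAt h p := by
  have := RemovableAt.comp_affine (h := h) one_ne_zero (b := q - p) (p := p) (by simpa using hq)
  refine this.congr (Eventually.of_forall fun z => ?_)
  simpa using apply_add_of_mem_lattice h1 h2 hpq z

/-! ### Szegő kernels of the torus `ℂ / (ℓℤ + 2πiℤ)` -/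

/-- `S (v - u)` is the Szegő kernel of the flat line bundle on `ℂ / (ℓℤ + 2πiℤ)` with
multipliers `-1` and `c`. -/
structure IsSzego (ℓ : ℝ) (c : ℂ) (S : ℂ → ℂ) : Prop where
  norm_multiplier : ‖c‖ = 1
  differentiableAt : ∀ z ∉ lattice ℓ, DifferentiableAt ℂ S z
  add_period : ∀ z, S (z + ℓ) = -S z
  add_two_pi_I : ∀ z, S (z + 2 * Real.pi * Complex.I) = c * S z
  singularity : (fun z => S z - 1 / z) =O[𝓝[≠] 0] (fun _ : ℂ => (1 : ℝ))
  conj_apply : ∀ z, conj (S z) = S (conj z)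

namespace IsSzego

variable {ℓ : ℝ} {c : ℂ} {S : ℂ → ℂ}

lemma removableAt_sub_inv (hS : IsSzego ℓ c S) (hℓ : 0 < ℓ) :
    RemovableAt (fun z => S z - 1 / z) 0 := by
  refine ⟨?_, hS.singularity⟩
  filter_upwards [eventually_notMem_lattice_zero hℓ, self_mem_nhdsWithin] with z hz hz0
  exact (hS.differentiableAt z hz).sub ((differentiableAt_const _).div differentiableAt_id hz0)

lemma exists_regular_part (hS : IsSzego ℓ c S) (hℓ : 0 < ℓ) : ∃ r : ℂ → ℂ,
    (∀ᶠ z in 𝓝 0, DifferentiableAt ℂ r z) ∧ ∀ᶠ z in 𝓝[≠] 0, S z = 1 / z + r z := by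
  have hr := hS.removableAt_sub_inv hℓ
  refine ⟨_, hr.eventually_differentiableAt_removed, ?_⟩
  filter_upwards [hr.1] with z hz
  rw [removed_eq hz.continuousAt]
  ring

lemma tendsto_mul_self (hS : IsSzego ℓ c S) (hℓ : 0 < ℓ) :
    Tendsto (fun z => z * S z) (𝓝[≠] 0) (𝓝 1) := by
  obtain ⟨r, hr, hSr⟩ := hS.exists_regular_part hℓ
  have h1 : Tendsto (fun z => 1 + z * r z) (𝓝[≠] 0) (𝓝 1) := by
    have : ContinuousAt (fun z => 1 + z * r z) 0 := by
      have := hr.self_of_nhds.continuousAt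
      fun_prop
    simpa using this.tendsto.mono_left nhdsWithin_le_nhds
  refine h1.congr' ?_
  filter_upwards [hSr, self_mem_nhdsWithin] with z hz hz0
  have : z ≠ 0 := hz0
  rw [hz]; field_simp

lemma eventually_ne_zero (hS : IsSzego ℓ c S) (hℓ : 0 < ℓ) : ∀ᶠ z in 𝓝[≠] 0, S z ≠ 0 := by
  filter_upwards [(hS.tendsto_mul_self hℓ).eventually_ne one_ne_zero] with z hz h
  simp [h] at hz

lemma tendsto_neg_punctured : Tendsto (fun z : ℂ => -z) (𝓝[≠] 0) (𝓝[≠] 0) := by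
  simpa using tendsto_affine_punctured (neg_ne_zero.2 one_ne_zero) 0 0

lemma differentiableAt_neg (hS : IsSzego ℓ c S) {z : ℂ} (hz : z ∉ lattice ℓ) :
    DifferentiableAt ℂ (fun z => S (-z)) z :=
  (hS.differentiableAt (-z) (by simpa using hz)).comp z (by fun_prop)

lemma neg_add_period (hS : IsSzego ℓ c S) (z : ℂ) : S (-(z + ℓ)) = -S (-z) := by
  rw [show -z = -(z + ℓ) + ℓ by ring, hS.add_period, neg_neg]

lemma mul_neg_add_two_pi_I (hS : IsSzego ℓ c S) (z : ℂ) :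
    c * S (-(z + 2 * Real.pi * Complex.I)) = S (-z) := by
  rw [← hS.add_two_pi_I]
  congr 1; ring

lemma mul_neg_add_period (hS : IsSzego ℓ c S) (z : ℂ) :
    S (z + ℓ) * S (-(z + ℓ)) = S z * S (-z) := by
  rw [hS.neg_add_period, hS.add_period]; ring

lemma prod_neg_add_two_pi_I (hS : IsSzego ℓ c S) (z : ℂ) :
    S (z + 2 * Real.pi * Complex.I) * S (-(z + 2 * Real.pi * Complex.I)) = S z * S (-z) := by
  rw [← hS.mul_neg_add_two_pi_I z, hS.add_two_pi_I]; ring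

/-- With `S z = 1 / z + r z`, the coefficient of `1 / z` in the product is `r (-z) - r z`, which
vanishes at `0`; only the double pole survives. -/
lemma removableAt_prod_neg (hS : IsSzego ℓ c S) (hℓ : 0 < ℓ) :
    RemovableAt (fun z => S z * S (-z) + 1 / z ^ 2) 0 := by
  obtain ⟨r, hr, hSr⟩ := hS.exists_regular_part hℓ
  have hneg : Tendsto (fun z : ℂ => -z) (𝓝 0) (𝓝 0) := by
    simpa using (continuous_neg.tendsto (0 : ℂ))
  have hr' : ∀ᶠ z in 𝓝 0, DifferentiableAt ℂ (fun z => r (-z)) z := by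
    filter_upwards [hneg.eventually hr] with z hz
    exact DifferentiableAt.comp z hz (by fun_prop)
  have e1 : RemovableAt (fun z => (r (-z) - r z) / (z - 0)) 0 := by
    apply RemovableAt.div_sub
    · filter_upwards [hr, hr'] with z h1 h2 using h2.sub h1
    · simp
  have e2 := (RemovableAt.of_differentiableAt hr).mul (RemovableAt.of_differentiableAt hr')
  refine (e1.add e2).congr ?_
  filter_upwards [hSr, tendsto_neg_punctured.eventually hSr, self_mem_nhdsWithin] with z h1 h2 h0
  have : z ≠ 0 := h0
  rw [h1, h2]; field_simp; ring

/-- The products `S z * S (-z)` of two Szegő kernels differ by a constant. -/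
lemma exists_prod_neg_sub_eq (hS : IsSzego ℓ c S) (hℓ : 0 < ℓ) {c' : ℂ} {S' : ℂ → ℂ}
    (hS' : IsSzego ℓ c' S') :
    ∃ δ, ∀ z ∉ lattice ℓ, S z * S (-z) - S' z * S' (-z) = δ := by
  set h : ℂ → ℂ := fun z => S z * S (-z) - S' z * S' (-z) with hh
  have h1 : ∀ z, h (z + ℓ) = h z := fun z => by
    simp only [hh, hS.mul_neg_add_period, hS'.mul_neg_add_period]
  have h2 : ∀ z, h (z + 2 * Real.pi * Complex.I) = h z := fun z => by
    simp only [hh, hS.prod_neg_add_two_pi_I, hS'.prod_neg_add_two_pi_I]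
  have hd : ∀ z ∉ lattice ℓ, DifferentiableAt ℂ h z := fun z hz =>
    ((hS.differentiableAt z hz).mul (hS.differentiableAt_neg hz)).sub
      ((hS'.differentiableAt z hz).mul (hS'.differentiableAt_neg hz))
  -- Both products have the same singular part `-1 / z ^ 2`, which cancels.
  have h0 : RemovableAt h 0 := by
    refine ((hS.removableAt_prod_neg hℓ).sub (hS'.removableAt_prod_neg hℓ)).congr
      (Eventually.of_forall fun z => ?_)
    simp only [hh]; ring
  have hr : ∀ p, RemovableAt h p := by
    intro p
    by_cases hp : p ∈ lattice ℓ
    · exact RemovableAt.of_sub_mem_lattice h1 h2 h0 (by simpa using hp)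
    · refine RemovableAt.of_differentiableAt ?_
      filter_upwards [(isClosed_lattice hℓ).isOpen_compl.mem_nhds hp] with z hz using hd z hz
  obtain ⟨δ, hδ⟩ := exists_removed_eq_const hℓ hr h1 h2
  exact ⟨δ, fun z hz => by rw [← hδ z, removed_eq (hd z hz).continuousAt]⟩

/-- The sum of the two cyclic products of three values of a Szegő kernel, for arguments
`a`, `b`, `-(a + b)` and `-a`, `-b`, `a + b`. -/
lemma exists_cyclic_sum_eq_aux (hS : IsSzego ℓ c S) (hℓ : 0 < ℓ) {a : ℂ} (ha : a ∉ lattice ℓ) :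
    ∃ Q, ∀ b ∉ lattice ℓ, a + b ∉ lattice ℓ →
      S a * S b * S (-(a + b)) + S (-a) * S (-b) * S (a + b) = Q := by
  set h : ℂ → ℂ := fun b => S a * S b * S (-(a + b)) + S (-a) * S (-b) * S (a + b) with hh
  have h1 : ∀ z, h (z + ℓ) = h z := fun z => by
    simp only [hh, ← add_assoc, hS.neg_add_period, hS.add_period]; ring
  -- Each summand contains `b` and `a + b` with opposite signs, so the multipliers `c` and `c⁻¹`
  -- cancel.
  have h2 : ∀ z, h (z + 2 * Real.pi * Complex.I) = h z := fun z => by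
    simp only [hh, ← add_assoc]
    rw [← hS.mul_neg_add_two_pi_I z, ← hS.mul_neg_add_two_pi_I (a + z), hS.add_two_pi_I,
      hS.add_two_pi_I]
    ring
  have hd1 : ∀ z, a + z ∉ lattice ℓ → DifferentiableAt ℂ (fun z => S (a + z)) z := fun z hz =>
    DifferentiableAt.comp z (hS.differentiableAt _ hz) (by fun_prop)
  have hd2 : ∀ z, a + z ∉ lattice ℓ → DifferentiableAt ℂ (fun z => S (-(a + z))) z := fun z hz =>
    DifferentiableAt.comp z (hS.differentiableAt (-(a + z)) (by rwa [neg_mem_iff])) (by fun_prop)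
  have hd : ∀ z ∉ lattice ℓ, a + z ∉ lattice ℓ → DifferentiableAt ℂ h z := fun z hz haz =>
    (((hS.differentiableAt z hz).const_mul _).mul (hd2 z haz)).add
      (((hS.differentiableAt_neg hz).const_mul _).mul (hd1 z haz))
  have hnear : ∀ z, a + z ∉ lattice ℓ → ∀ᶠ w in 𝓝 z, a + w ∉ lattice ℓ := fun z hz =>
    (continuous_const.add continuous_id).continuousAt.eventually
      ((isClosed_lattice hℓ).isOpen_compl.mem_nhds hz)
  -- The residues of the two summands at `b = 0` are `S a * S (-a)` and its negative.
  have h0 : RemovableAt h 0 := by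
    obtain ⟨r, hr, hSr⟩ := hS.exists_regular_part hℓ
    have hneg : Tendsto (fun z : ℂ => -z) (𝓝 0) (𝓝 0) := by
      simpa using (continuous_neg.tendsto (0 : ℂ))
    have hr' : ∀ᶠ z in 𝓝 0, DifferentiableAt ℂ (fun z => r (-z)) z := by
      filter_upwards [hneg.eventually hr] with z hz
      exact DifferentiableAt.comp z hz (by fun_prop)
    have ha0 := hnear 0 (by simpa using ha)
    have e1 : RemovableAt (fun z => (S a * S (-(a + z)) - S (-a) * S (a + z)) / (z - 0)) 0 := by
      apply RemovableAt.div_sub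
      · filter_upwards [ha0] with z hz
        exact ((hd2 z hz).const_mul _).sub ((hd1 z hz).const_mul _)
      · simp; ring
    have e2 : RemovableAt (fun z => S a * r z * S (-(a + z)) + S (-a) * r (-z) * S (a + z)) 0 := by
      apply RemovableAt.of_differentiableAt
      filter_upwards [ha0, hr, hr'] with z hz h3 h4
      exact ((h3.const_mul _).mul (hd2 z hz)).add ((h4.const_mul _).mul (hd1 z hz))
    refine (e1.add e2).congr ?_
    filter_upwards [hSr, tendsto_neg_punctured.eventually hSr, self_mem_nhdsWithin] with z h3 h4 h5
    have : z ≠ 0 := h5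
    simp only [hh]
    rw [h3, h4]; field_simp; ring
  -- The involution `b ↦ -a - b` preserves `h` and exchanges its two singular classes, so the pole
  -- at `-a` is handled by the one at `0`.
  have hsym : ∀ z, h (-1 * z + -a) = h z := fun z => by
    simp only [hh]
    rw [show a + (-1 * z + -a) = -z by ring, show -1 * z + -a = -(a + z) by ring, neg_neg, neg_neg]
    ring
  have hna : RemovableAt h (-a) := by
    have := RemovableAt.comp_affine (h := h) (neg_ne_zero.2 one_ne_zero) (b := -a) (p := -a)
      (by simpa using h0)
    exact this.congr (Eventually.of_forall hsym)
  have hr : ∀ p, RemovableAt h p := by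
    intro p
    by_cases hp : p ∈ lattice ℓ
    · exact RemovableAt.of_sub_mem_lattice h1 h2 h0 (by simpa using hp)
    by_cases hap : a + p ∈ lattice ℓ
    · refine RemovableAt.of_sub_mem_lattice h1 h2 hna ?_
      have := neg_mem hap
      rwa [neg_add', ] at this
    · refine RemovableAt.of_differentiableAt ?_
      filter_upwards [(isClosed_lattice hℓ).isOpen_compl.mem_nhds hp, hnear p hap] with z hz hz2
      exact hd z hz hz2
  obtain ⟨δ, hδ⟩ := exists_removed_eq_const hℓ hr h1 h2
  exact ⟨δ, fun z hz haz => by rw [← hδ z, removed_eq (hd z hz haz).continuousAt]⟩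

/-- The expression is symmetric in `a` and `b`. The constants of `a` and `a₀` are therefore linked
through a generic `d`, chosen so that `d`, `a + d` and `a₀ + d` avoid the lattice. -/
lemma exists_cyclic_sum_eq (hS : IsSzego ℓ c S) (hℓ : 0 < ℓ) :
    ∃ Q, ∀ a ∉ lattice ℓ, ∀ b ∉ lattice ℓ, a + b ∉ lattice ℓ →
      S a * S b * S (-(a + b)) + S (-a) * S (-b) * S (a + b) = Q := by
  have hex := fun (a : ℂ) (ha : a ∉ lattice ℓ) => hS.exists_cyclic_sum_eq_aux hℓ ha
  obtain ⟨a₀, ha₀⟩ := (eventually_notMem_lattice hℓ 0).exists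
  obtain ⟨Q₀, hQ₀⟩ := hex a₀ ha₀
  refine ⟨Q₀, fun a ha b hb hab => ?_⟩
  obtain ⟨Q, hQ⟩ := hex a ha
  have ht : ∀ t : ℂ, Tendsto (fun z => t + z) (𝓝[≠] 0) (𝓝[≠] t) := fun t => by
    simpa [add_comm] using tendsto_affine_punctured one_ne_zero t 0
  obtain ⟨d, hd, had, ha₀d⟩ := ((eventually_notMem_lattice hℓ 0).and
    (((ht a).eventually (eventually_notMem_lattice hℓ a)).and
      ((ht a₀).eventually (eventually_notMem_lattice hℓ a₀)))).exists
  obtain ⟨Q', hQ'⟩ := hex d hd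
  rw [hQ b hb hab, ← hQ d hd had, ← hQ₀ d hd ha₀d]
  have e1 := hQ' a ha (by rwa [add_comm])
  have e2 := hQ' a₀ ha₀ (by rwa [add_comm])
  rw [add_comm d] at e1 e2
  linear_combination e1 - e2

/-- The differential equation satisfied by a Szegő kernel. -/
lemma cyclic_sum_eq_deriv (hS : IsSzego ℓ c S) (hℓ : 0 < ℓ) {Q : ℂ}
    (hQ : ∀ a ∉ lattice ℓ, ∀ b ∉ lattice ℓ, a + b ∉ lattice ℓ →
      S a * S b * S (-(a + b)) + S (-a) * S (-b) * S (a + b) = Q) :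
    ∃ β, ∀ a ∉ lattice ℓ,
      Q = -S a * deriv S (-a) - S (-a) * deriv S a + 2 * β * (S a * S (-a)) := by
  obtain ⟨r, hr, hSr⟩ := hS.exists_regular_part hℓ
  refine ⟨r 0, fun a ha => ?_⟩
  have hrc : ContinuousAt r 0 := hr.self_of_nhds.continuousAt
  have hrc' : ContinuousAt (fun z => r (-z)) 0 :=
    ContinuousAt.comp (f := fun z : ℂ => -z) (by simpa using hrc) (by fun_prop)
  have hd1 : HasDerivAt (fun z => S (a + z)) (deriv S a) 0 := by
    have : HasDerivAt S (deriv S a) (a + 0) := by simpa using (hS.differentiableAt a ha).hasDerivAt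
    simpa using this.comp_const_add a 0
  have hd2 : HasDerivAt (fun z => S (-(a + z))) (-deriv S (-a)) 0 := by
    have : HasDerivAt S (deriv S (-a)) (-(a + 0)) := by
      simpa using (hS.differentiableAt (-a) (by simpa using ha)).hasDerivAt
    have h2 : HasDerivAt (fun z : ℂ => -(a + z)) (-1) 0 := ((hasDerivAt_id 0).const_add a).neg
    exact (HasDerivAt.comp (0 : ℂ) this h2).congr_deriv (by ring)
  -- This is the coefficient of `1 / b` in the cubic identity with `S b = 1 / b + r b`. It vanishes
  -- at `b = 0`, so the limit `b → 0` replaces the singular part by a derivative; the regular part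
  -- contributes `2 * r 0 * (S a * S (-a))`.
  have hφ := (hd2.const_mul (S a)).sub (hd1.const_mul (S (-a)))
  have ts := hφ.tendsto_slope_zero
  have tc : Tendsto (fun z => S a * r z * S (-(a + z)) + S (-a) * r (-z) * S (a + z)) (𝓝[≠] 0)
      (𝓝 (S a * r 0 * S (-(a + 0)) + S (-a) * r (-0) * S (a + 0))) :=
    (ContinuousAt.tendsto (f := fun z => S a * r z * S (-(a + z)) + S (-a) * r (-z) * S (a + z))
      (((hrc.const_mul _).mul hd2.continuousAt).add
        ((hrc'.const_mul _).mul hd1.continuousAt))).mono_left nhdsWithin_le_nhds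
  have hlim := ts.add tc
  have ht : Tendsto (fun z => a + z) (𝓝[≠] 0) (𝓝[≠] a) := by
    simpa [add_comm] using tendsto_affine_punctured one_ne_zero a 0
  have hconst : Tendsto (fun _ : ℂ => Q) (𝓝[≠] 0) (𝓝 Q) := tendsto_const_nhds
  have := tendsto_nhds_unique (hconst.congr' ?_) hlim
  · rw [this]; simp; ring
  filter_upwards [hSr, tendsto_neg_punctured.eventually hSr, self_mem_nhdsWithin,
    eventually_notMem_lattice_zero hℓ, ht.eventually (eventually_notMem_lattice hℓ a)]
    with z h3 h4 h5 h6 h7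
  have h5' : z ≠ 0 := h5
  rw [← hQ a ha z h6 h7, h3, h4]
  simp
  field_simp
  ring

/-- A Szegő kernel is determined by its quadratic and cubic invariants. -/
theorem eq_of_invariants_eq (hS : IsSzego ℓ c S) (hℓ : 0 < ℓ) {c' : ℂ} {S' : ℂ → ℂ}
    (hS' : IsSzego ℓ c' S') (hP : ∀ z ∉ lattice ℓ, S z * S (-z) = S' z * S' (-z)) {Q : ℂ}
    (hQ : ∀ a ∉ lattice ℓ, ∀ b ∉ lattice ℓ, a + b ∉ lattice ℓ →
      S a * S b * S (-(a + b)) + S (-a) * S (-b) * S (a + b) = Q)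
    (hQ' : ∀ a ∉ lattice ℓ, ∀ b ∉ lattice ℓ, a + b ∉ lattice ℓ →
      S' a * S' b * S' (-(a + b)) + S' (-a) * S' (-b) * S' (a + b) = Q) {z : ℂ}
    (hz : z ∉ lattice ℓ) : S z = S' z := by
  obtain ⟨β, hβ⟩ := hS.cyclic_sum_eq_deriv hℓ hQ
  obtain ⟨β', hβ'⟩ := hS'.cyclic_sum_eq_deriv hℓ hQ'
  -- Differentiating `S z * S (-z)` gives a second linear equation for `deriv S a` and `deriv S
  -- (-a)`, besides the one coming from `Q`.
  have hPd : ∀ a ∉ lattice ℓ, deriv S a * S (-a) - S a * deriv S (-a) =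
      deriv S' a * S' (-a) - S' a * deriv S' (-a) := by
    have key : ∀ {T : ℂ → ℂ} {d : ℂ} (_ : IsSzego ℓ d T), ∀ a ∉ lattice ℓ,
        HasDerivAt (fun z => T z * T (-z)) (deriv T a * T (-a) - T a * deriv T (-a)) a := by
      intro T d hT a ha
      have h1 := (hT.differentiableAt a ha).hasDerivAt
      have h2 := (hT.differentiableAt (-a) (by simpa using ha)).hasDerivAt
      have h3 := HasDerivAt.comp a h2 (hasDerivAt_neg a)
      refine (h1.mul h3).congr_deriv ?_
      simp; ring
    intro a ha
    refine (key hS a ha).unique ((key hS' a ha).congr_of_eventuallyEq ?_)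
    filter_upwards [(isClosed_lattice hℓ).isOpen_compl.mem_nhds ha] with z hz using hP z hz
  set k := β - β' with hk
  -- Solving the two linear equations expresses the logarithmic derivative through common data and
  -- `β`; hence the logarithmic derivatives of the two kernels differ by `k`.
  have hW : ∀ a ∉ lattice ℓ, S a ≠ 0 → S (-a) ≠ 0 →
      deriv S a * S' a - S a * deriv S' a = k * (S a * S' a) := by
    intro a ha h1 h2
    have e1 := hβ a ha
    have e2 := hβ' a ha
    have e3 := hPd a ha
    have e4 := hP a ha
    refine mul_left_cancel₀ (mul_ne_zero h1 h2) ?_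
    linear_combination (S a * S' a / 2) * (e1 - e2 + e3) +
      (-S a * deriv S' a + β' * S a * S' a) * e4
  obtain ⟨ρ, hρ, hball⟩ : ∃ ρ > 0, ∀ w, w ≠ 0 → ‖w‖ < ρ →
      w ∉ lattice ℓ ∧ S w ≠ 0 ∧ S (-w) ≠ 0 ∧ S' w ≠ 0 := by
    have := (eventually_notMem_lattice_zero hℓ).and ((hS.eventually_ne_zero hℓ).and
      ((tendsto_neg_punctured.eventually (hS.eventually_ne_zero hℓ)).and
        (hS'.eventually_ne_zero hℓ)))
    rw [eventually_nhdsWithin_iff, Metric.eventually_nhds_iff] at this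
    obtain ⟨ρ, hρ, h⟩ := this
    exact ⟨ρ, hρ, fun w hw hwρ => h (by simpa using hwρ) hw⟩
  -- A convex region close to the pole but not containing it: no kernel in play vanishes there, so
  -- the quotient can be integrated. The identity theorem then extends the relation to the connected
  -- complement of the lattice.
  set U : Set ℂ := Metric.ball 0 ρ ∩ {w | 0 < w.re} with hU
  have hUo : IsOpen U := Metric.isOpen_ball.inter (isOpen_lt continuous_const Complex.continuous_re)
  have hUc : Convex ℝ U := (convex_ball _ _).inter (convex_halfSpace_re_gt 0)
  have hUb : ∀ w ∈ U, w ∉ lattice ℓ ∧ S w ≠ 0 ∧ S (-w) ≠ 0 ∧ S' w ≠ 0 := fun w hw =>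
    hball w (by rintro rfl; simpa using hw.2) (by simpa using hw.1)
  have hw₀ : ((ρ / 2 : ℝ) : ℂ) ∈ U := by
    refine ⟨?_, by simpa using hρ⟩
    rw [mem_ball_zero_iff, Complex.norm_real, Real.norm_of_nonneg (by positivity)]
    linarith
  set w₀ : ℂ := ((ρ / 2 : ℝ) : ℂ)
  have hder : ∀ w ∈ U, HasDerivAt (fun w => S w / S' w * Complex.exp (-k * w)) 0 w := by
    intro w hw
    obtain ⟨hl, h1, h2, h3⟩ := hUb w hw
    have d1 := (hS.differentiableAt w hl).hasDerivAt
    have d2 := (hS'.differentiableAt w hl).hasDerivAt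
    have d3 : HasDerivAt (fun w => Complex.exp (-k * w)) (Complex.exp (-k * w) * (-k * 1)) w :=
      ((hasDerivAt_id w).const_mul (-k)).cexp
    refine ((d1.div d2 h3).mul d3).congr_deriv ?_
    have := hW w hl h1 h2
    simp only [Pi.div_apply]
    field_simp
    linear_combination Complex.exp (-(k * w)) * this
  set C := S w₀ / S' w₀ * Complex.exp (-k * w₀)
  have hconst : ∀ w ∈ U, S w / S' w * Complex.exp (-k * w) = C := fun w hw =>
    hUo.is_const_of_deriv_eq_zero hUc.isPreconnected
      (fun x hx => (hder x hx).differentiableAt.differentiableWithinAt)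
      (fun x hx => (hder x hx).deriv) hw hw₀
  clear_value C
  have hpre : IsPreconnected ((lattice ℓ : Set ℂ)ᶜ) :=
    ((countable_lattice ℓ).isPathConnected_compl_of_one_lt_rank
      (by rw [Complex.rank_real_complex]; norm_num)).isConnected.isPreconnected
  have hopen : IsOpen ((lattice ℓ : Set ℂ)ᶜ) := (isClosed_lattice hℓ).isOpen_compl
  have hglob : ∀ w ∉ lattice ℓ, S w = C * Complex.exp (k * w) * S' w := by
    have a1 : AnalyticOnNhd ℂ S (lattice ℓ : Set ℂ)ᶜ :=
      DifferentiableOn.analyticOnNhd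
        (fun w hw => (hS.differentiableAt w hw).differentiableWithinAt) hopen
    have a2 : AnalyticOnNhd ℂ (fun w => C * Complex.exp (k * w) * S' w) (lattice ℓ : Set ℂ)ᶜ :=
      DifferentiableOn.analyticOnNhd
        (fun w hw => (DifferentiableAt.mul (by fun_prop)
          (hS'.differentiableAt w hw)).differentiableWithinAt) hopen
    refine fun w hw => a1.eqOn_of_preconnected_of_eventuallyEq a2 hpre (hUb w₀ hw₀).1 ?_ hw
    filter_upwards [hUo.mem_nhds hw₀] with w hw
    rw [← hconst w hw, neg_mul, Complex.exp_neg]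
    have := (hUb w hw).2.2.2
    have := Complex.exp_ne_zero (k * w)
    field_simp
  have hne : ∀ t : ℂ, t ∈ lattice ℓ → w₀ + t ∉ lattice ℓ := fun t ht h =>
    (hUb w₀ hw₀).1 (by simpa using sub_mem h ht)
  have hk1 : Complex.exp (k * ℓ) = 1 := by
    have e1 := hglob _ (hne _ (period_mem_lattice ℓ))
    rw [hS.add_period, hS'.add_period, mul_add, Complex.exp_add] at e1
    have e2 := hglob _ (hUb w₀ hw₀).1
    refine mul_right_cancel₀ (hUb w₀ hw₀).2.1 ?_
    linear_combination e1 + Complex.exp (k * ℓ) * e2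
  have hk2 : ‖Complex.exp (k * (2 * Real.pi * Complex.I))‖ = 1 := by
    have e1 := hglob _ (hne _ (two_pi_I_mem_lattice ℓ))
    rw [hS.add_two_pi_I, hS'.add_two_pi_I, mul_add, Complex.exp_add] at e1
    have e2 := hglob _ (hUb w₀ hw₀).1
    have e3 : c = Complex.exp (k * (2 * Real.pi * Complex.I)) * c' := by
      refine mul_right_cancel₀ (hUb w₀ hw₀).2.1 ?_
      linear_combination e1 - Complex.exp (k * (2 * Real.pi * Complex.I)) * c' * e2
    have := congrArg norm e3
    rwa [norm_mul, hS.norm_multiplier, hS'.norm_multiplier, mul_one, eq_comm] at this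
  -- By `hk1`, `k` is an integer multiple of `2πi / ℓ`, hence imaginary; by `hk2` it is real.
  have hk0 : k = 0 := by
    obtain ⟨n, hn⟩ := Complex.exp_eq_one_iff.1 hk1
    have hℓ' : (ℓ : ℂ) ≠ 0 := by exact_mod_cast hℓ.ne'
    have hkn : k = ((n * (2 * Real.pi) / ℓ : ℝ) : ℂ) * Complex.I := by
      push_cast
      field_simp
      linear_combination hn
    rw [Complex.norm_exp, Real.exp_eq_one_iff, hkn] at hk2
    have hpi := Real.pi_pos
    have : (n : ℝ) * (2 * Real.pi) / ℓ * (2 * Real.pi) = 0 := by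
      simpa using hk2
    have hn0 : (n : ℝ) = 0 := by
      have h2 : (n : ℝ) * ((2 * Real.pi) / ℓ * (2 * Real.pi)) = 0 := by rw [← this]; ring
      exact (mul_eq_zero.1 h2).resolve_right (by positivity)
    rw [hkn, hn0]; simp
  have hC : C = 1 := by
    have t1 := hS.tendsto_mul_self hℓ
    have t2 := (hS'.tendsto_mul_self hℓ).const_mul C
    rw [mul_one] at t2
    refine tendsto_nhds_unique (t2.congr' ?_) t1
    filter_upwards [eventually_notMem_lattice_zero hℓ] with w hw
    rw [hglob w hw, hk0]; simp; ring
  rw [hglob z hz, hC, hk0]; simp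

end IsSzego

/-! ### Construction of Szegő kernels -/

lemma summable_exp_neg_mul_abs {κ : ℝ} (hκ : 0 < κ) :
    Summable fun n : ℤ => Real.exp (-(κ * |(n : ℝ)|)) := by
  have h : Summable fun n : ℕ => Real.exp (-(κ * (n : ℝ))) := by
    refine (Real.summable_exp_nat_mul_iff.2 (neg_lt_zero.2 hκ)).congr fun n => ?_
    congr 1; ring
  refine Summable.of_nat_of_neg ?_ ?_ <;> simpa using h

lemma abs_sinh_im_le_norm_sin (z : ℂ) : |Real.sinh z.im| ≤ ‖Complex.sin z‖ := by
  rw [Complex.sin, norm_div, norm_mul, Complex.norm_I, mul_one, Real.sinh_eq, abs_div]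
  have h1 : ‖Complex.exp (-z * Complex.I)‖ = Real.exp z.im := by simp [Complex.norm_exp]
  have h2 : ‖Complex.exp (z * Complex.I)‖ = Real.exp (-z.im) := by simp [Complex.norm_exp]
  rw [← h1, ← h2]
  simpa using div_le_div_of_nonneg_right (abs_norm_sub_norm_le _ _) (by norm_num : (0 : ℝ) ≤ 2)

/-- The summands of the Szegő kernel. -/
def szegoTerm (ℓ : ℝ) (c : ℂ) (n : ℤ) (u : ℂ) : ℂ :=
  (Real.pi / ℓ : ℝ) * c ^ n / Complex.sin ((Real.pi / ℓ : ℝ) * (u - n * (2 * Real.pi * Complex.I)))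

/-- The Szegő kernel with multipliers `-1` and `c`. -/
def szegoKernel (ℓ : ℝ) (c : ℂ) (u : ℂ) : ℂ := ∑' n : ℤ, szegoTerm ℓ c n u

section

variable {ℓ : ℝ} {c : ℂ}

/-- Reindexing of the series, valid without convergence, hence also at the poles. -/
lemma szegoKernel_add_int_mul (hc : ‖c‖ = 1) (m : ℤ) (u : ℂ) :
    szegoKernel ℓ c (u + m * (2 * Real.pi * Complex.I)) = c ^ m * szegoKernel ℓ c u := by
  have hc0 : c ≠ 0 := fun h => by simp [h] at hc
  rw [szegoKernel, szegoKernel, ← tsum_mul_left, ← (Equiv.addRight m).tsum_eq]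
  refine tsum_congr fun n => ?_
  simp only [szegoTerm, Equiv.coe_addRight, zpow_add₀ hc0]
  rw [show u + m * (2 * Real.pi * Complex.I) - ((n + m : ℤ) : ℂ) * (2 * Real.pi * Complex.I) =
    u - n * (2 * Real.pi * Complex.I) by push_cast; ring]
  ring

lemma szegoKernel_add_period (hℓ : 0 < ℓ) (u : ℂ) :
    szegoKernel ℓ c (u + ℓ) = -szegoKernel ℓ c u := by
  rw [szegoKernel, szegoKernel, ← tsum_neg]
  refine tsum_congr fun n => ?_
  have : (ℓ : ℂ) ≠ 0 := by exact_mod_cast hℓ.ne'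
  rw [szegoTerm, szegoTerm, show ((Real.pi / ℓ : ℝ) : ℂ) * (u + ℓ - n * (2 * Real.pi * Complex.I)) =
    (Real.pi / ℓ : ℝ) * (u - n * (2 * Real.pi * Complex.I)) + Real.pi by
      push_cast; field_simp; ring, Complex.sin_add_pi, div_neg]

/-- Here `‖c‖ = 1` enters as `conj c = c⁻¹`: the substitution `n ↦ -n` restores both the power of
`c` and the position of the pole. -/
lemma conj_szegoKernel (hc : ‖c‖ = 1) (u : ℂ) :
    conj (szegoKernel ℓ c u) = szegoKernel ℓ c (conj u) := by
  have hc0 : c ≠ 0 := fun h => by simp [h] at hc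
  have hcc : conj c = c⁻¹ := by
    rw [Complex.inv_def, Complex.normSq_eq_norm_sq, hc]; simp
  rw [szegoKernel, szegoKernel, Complex.conj_tsum, ← (Equiv.neg ℤ).tsum_eq]
  refine tsum_congr fun n => ?_
  simp only [szegoTerm, Equiv.neg_apply, map_div₀, map_mul, map_zpow₀, hcc, Complex.conj_ofReal,
    ← Complex.sin_conj, map_sub, map_intCast, Complex.conj_I, map_ofNat]
  rw [inv_zpow, zpow_neg, inv_inv]
  congr 3
  push_cast
  ring

/-- One has `|sin w| ≥ sinh |Im w|`, and the point `u - 2πin` has imaginary part at least `ε |n|` in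
absolute value. The factor `1 - exp (-2κ)` compares `sinh (κ |n|)` with half an exponential when
`|n| ≥ 1`. -/
lemma norm_szegoTerm_le (hℓ : 0 < ℓ) (hc : ‖c‖ = 1) {ε : ℝ} (hε : 0 < ε) {u : ℂ}
    (hu : |u.im| < 2 * Real.pi - ε) {n : ℤ} (hn : n ≠ 0) :
    Complex.sin ((Real.pi / ℓ : ℝ) * (u - n * (2 * Real.pi * Complex.I))) ≠ 0 ∧
    ‖szegoTerm ℓ c n u‖ ≤ Real.pi / ℓ * (2 / (1 - Real.exp (-(2 * (Real.pi / ℓ * ε)))) *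
      Real.exp (-(Real.pi / ℓ * ε * |(n : ℝ)|))) := by
  have hpi := Real.pi_pos
  set a := Real.pi / ℓ with ha
  have ha0 : 0 < a := by positivity
  set κ := a * ε with hκ
  have hκ0 : 0 < κ := by positivity
  have hn1 : (1 : ℝ) ≤ |(n : ℝ)| := by exact_mod_cast Int.one_le_abs hn
  have him : ((a : ℂ) * (u - n * (2 * Real.pi * Complex.I))).im =
      a * (u.im - n * (2 * Real.pi)) := by
    simp
  have h1 : κ * |(n : ℝ)| ≤ |a * (u.im - n * (2 * Real.pi))| := by
    rw [abs_mul, abs_of_pos ha0, hκ, mul_assoc]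
    refine mul_le_mul_of_nonneg_left ?_ ha0.le
    have := abs_sub_abs_le_abs_sub ((n : ℝ) * (2 * Real.pi)) u.im
    rw [abs_mul, abs_of_pos (by positivity : 0 < 2 * Real.pi), abs_sub_comm] at this
    nlinarith [abs_nonneg u.im]
  have h2 : Real.sinh (κ * |(n : ℝ)|) ≤
      ‖Complex.sin (a * (u - n * (2 * Real.pi * Complex.I)))‖ := by
    refine le_trans ?_ (abs_sinh_im_le_norm_sin _)
    rw [him, Real.abs_sinh]
    exact Real.sinh_le_sinh.2 h1
  have h3 : 0 < 1 - Real.exp (-(2 * κ)) := by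
    have : Real.exp (-(2 * κ)) < 1 := Real.exp_lt_one_iff.2 (by linarith)
    linarith
  have h4 : (1 - Real.exp (-(2 * κ))) / 2 * Real.exp (κ * |(n : ℝ)|) ≤
      Real.sinh (κ * |(n : ℝ)|) := by
    rw [Real.sinh_eq]
    have : Real.exp (-(κ * |(n : ℝ)|)) ≤ Real.exp (-(2 * κ)) * Real.exp (κ * |(n : ℝ)|) := by
      rw [← Real.exp_add]
      apply Real.exp_le_exp.2
      nlinarith
    linarith
  have h5 : 0 < (1 - Real.exp (-(2 * κ))) / 2 * Real.exp (κ * |(n : ℝ)|) := by positivity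
  have h6 := h5.trans_le (h4.trans h2)
  refine ⟨norm_pos_iff.1 h6, ?_⟩
  rw [szegoTerm, norm_div, norm_mul, norm_zpow, hc, one_zpow, mul_one, Complex.norm_real,
    Real.norm_of_nonneg ha0.le, div_eq_mul_inv]
  refine mul_le_mul_of_nonneg_left ?_ ha0.le
  refine (inv_anti₀ h5 (h4.trans h2)).trans_eq ?_
  rw [mul_inv, inv_div, Real.exp_neg (κ * _)]

lemma summable_szegoTerm_bound (hℓ : 0 < ℓ) {ε : ℝ} (hε : 0 < ε) :
    Summable fun n : ℤ => Real.pi / ℓ * (2 / (1 - Real.exp (-(2 * (Real.pi / ℓ * ε)))) *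
      Real.exp (-(Real.pi / ℓ * ε * |(n : ℝ)|))) :=
  ((summable_exp_neg_mul_abs (by positivity)).mul_left _).mul_left _

/-- The Szegő kernel without its summand that is singular at `0`. -/
def szegoRegular (ℓ : ℝ) (c : ℂ) (u : ℂ) : ℂ := ∑' n : ℤ, if n = 0 then 0 else szegoTerm ℓ c n u

lemma szegoKernel_eq (hℓ : 0 < ℓ) (hc : ‖c‖ = 1) {u : ℂ} (hu : |u.im| < 2 * Real.pi) :
    szegoKernel ℓ c u =
      (Real.pi / ℓ : ℝ) / Complex.sin ((Real.pi / ℓ : ℝ) * u) + szegoRegular ℓ c u := by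
  obtain ⟨ε, hε, hu⟩ : ∃ ε > 0, |u.im| < 2 * Real.pi - ε :=
    ⟨(2 * Real.pi - |u.im|) / 2, by linarith, by linarith⟩
  have hs : Summable fun n : ℤ => szegoTerm ℓ c n u := by
    refine Summable.of_norm_bounded_eventually (summable_szegoTerm_bound hℓ hε) ?_
    filter_upwards [(Set.finite_singleton (0 : ℤ)).compl_mem_cofinite] with n hn
    exact (norm_szegoTerm_le hℓ hc hε hu hn).2
  rw [szegoKernel, hs.tsum_eq_add_tsum_ite 0, szegoRegular]
  simp [szegoTerm]

lemma differentiableAt_szegoRegular (hℓ : 0 < ℓ) (hc : ‖c‖ = 1) {u : ℂ}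
    (hu : |u.im| < 2 * Real.pi) : DifferentiableAt ℂ (szegoRegular ℓ c) u := by
  obtain ⟨ε, hε, hu⟩ : ∃ ε > 0, |u.im| < 2 * Real.pi - ε :=
    ⟨(2 * Real.pi - |u.im|) / 2, by linarith, by linarith⟩
  have ho : IsOpen {w : ℂ | |w.im| < 2 * Real.pi - ε} :=
    isOpen_lt (by fun_prop) continuous_const
  refine (Complex.differentiableOn_tsum_of_summable_norm (summable_szegoTerm_bound hℓ hε)
    (fun n => ?_) ho fun n w hw => ?_).differentiableAt (ho.mem_nhds hu)
  · by_cases hn : n = 0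
    · simp [hn]
    · simp only [hn, if_false]
      intro w hw
      refine DifferentiableAt.differentiableWithinAt ?_
      exact DifferentiableAt.div (by fun_prop) (by fun_prop) (norm_szegoTerm_le hℓ hc hε hw hn).1
  · by_cases hn : n = 0
    · simp only [hn, if_true, norm_zero]
      have : Real.exp (-(2 * (Real.pi / ℓ * ε))) < 1 := by
        apply Real.exp_lt_one_iff.2
        have : 0 < Real.pi / ℓ * ε := by positivity
        linarith
      have : 0 < 1 - Real.exp (-(2 * (Real.pi / ℓ * ε))) := by linarith
      positivity
    · simp only [hn, if_false]
      exact (norm_szegoTerm_le hℓ hc hε hw hn).2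

lemma differentiableAt_szegoKernel (hℓ : 0 < ℓ) (hc : ‖c‖ = 1) {u : ℂ} (hu : u ∉ lattice ℓ) :
    DifferentiableAt ℂ (szegoKernel ℓ c) u := by
  have key : ∀ w : ℂ, w ∉ lattice ℓ → |w.im| < 2 * Real.pi →
      DifferentiableAt ℂ (szegoKernel ℓ c) w := by
    intro w hw hw2
    have hsin : Complex.sin ((Real.pi / ℓ : ℝ) * w) ≠ 0 := by
      rw [Ne, Complex.sin_eq_zero_iff]
      rintro ⟨k, hk⟩
      refine hw ⟨k, 0, ?_⟩
      have h1 : (ℓ : ℂ) ≠ 0 := by exact_mod_cast hℓ.ne'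
      have h2 : (Real.pi : ℂ) ≠ 0 := by exact_mod_cast Real.pi_ne_zero
      push_cast at hk
      field_simp at hk
      simp [hk, mul_comm]
    have hd : DifferentiableAt ℂ (fun w => (Real.pi / ℓ : ℝ) /
        Complex.sin ((Real.pi / ℓ : ℝ) * w) + szegoRegular ℓ c w) w :=
      DifferentiableAt.add (DifferentiableAt.div (by fun_prop) (by fun_prop) hsin)
        (differentiableAt_szegoRegular hℓ hc hw2)
    have ho : IsOpen {w : ℂ | |w.im| < 2 * Real.pi} := isOpen_lt (by fun_prop) continuous_const
    refine hd.congr_of_eventuallyEq ?_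
    filter_upwards [ho.mem_nhds hw2] with v hv using szegoKernel_eq hℓ hc hv
  -- Rounding moves `u` to imaginary part at most `π` in absolute value, where only the summand `n =
  -- 0` can be singular.
  set m := round (u.im / (2 * Real.pi)) with hm
  have h1 : u - m * (2 * Real.pi * Complex.I) ∉ lattice ℓ := fun h => hu <| by
    simpa using add_mem h
      (show (m * (2 * Real.pi * Complex.I) : ℂ) ∈ lattice ℓ from ⟨0, m, by simp⟩)
  have h2 : |(u - m * (2 * Real.pi * Complex.I)).im| < 2 * Real.pi := by
    have hpi := Real.pi_pos
    have h3 := abs_sub_round (u.im / (2 * Real.pi))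
    have h4 : (u - m * (2 * Real.pi * Complex.I)).im =
        (u.im / (2 * Real.pi) - m) * (2 * Real.pi) := by
      simp; field_simp
    rw [h4, abs_mul, abs_of_pos (by positivity : 0 < 2 * Real.pi)]
    nlinarith
  have h3 : szegoKernel ℓ c =
      fun w => c ^ m * szegoKernel ℓ c (w - m * (2 * Real.pi * Complex.I)) := by
    funext w
    rw [← szegoKernel_add_int_mul hc, sub_add_cancel]
  rw [h3]
  exact (DifferentiableAt.comp u (key _ h1 h2) (by fun_prop)).const_mul _

lemma isSzego_szegoKernel (hℓ : 0 < ℓ) (hc : ‖c‖ = 1) : IsSzego ℓ c (szegoKernel ℓ c) where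
  norm_multiplier := hc
  differentiableAt _ hz := differentiableAt_szegoKernel hℓ hc hz
  add_period := szegoKernel_add_period hℓ
  add_two_pi_I z := by simpa using szegoKernel_add_int_mul (ℓ := ℓ) hc 1 z
  conj_apply := conj_szegoKernel hc
  singularity := by
    set a : ℂ := ((Real.pi / ℓ : ℝ) : ℂ) with ha
    have ha0 : a ≠ 0 := by
      exact Complex.ofReal_ne_zero.2 (div_pos Real.pi_pos hℓ).ne'
    -- This is `sin (a z) / z` with the value `a` filled in at `0`, so that `a / sin (a z) - 1 / z =
    -- (a / h z - 1) / z`.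
    set h : ℂ → ℂ := dslope (fun z => Complex.sin (a * z)) 0 with hh
    have hhd : Differentiable ℂ h := by
      have : DifferentiableOn ℂ h Set.univ :=
        (Complex.differentiableOn_dslope univ_mem).2 (by fun_prop)
      exact differentiableOn_univ.1 this
    have hh0 : h 0 = a := by
      rw [hh, dslope_same]
      have : HasDerivAt (fun z : ℂ => Complex.sin (a * z)) (Complex.cos (a * 0) * (a * 1)) 0 :=
        ((hasDerivAt_id (0 : ℂ)).const_mul a).csin
      rw [this.deriv]; simp
    have hh1 : ∀ z ≠ 0, h z = Complex.sin (a * z) / z := fun z hz => by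
      rw [hh, dslope_of_ne _ hz, slope_def_field]; simp
    have hne : ∀ᶠ z in 𝓝 0, h z ≠ 0 :=
      hhd.continuous.continuousAt.eventually_ne (by rwa [hh0])
    have e1 : RemovableAt (fun z => (a / h z - 1) / (z - 0)) 0 := by
      apply RemovableAt.div_sub
      · filter_upwards [hne] with z hz
        exact ((differentiableAt_const _).div (hhd z) hz).sub (differentiableAt_const _)
      · rw [hh0, div_self ha0, sub_self]
    have ho : IsOpen {w : ℂ | |w.im| < 2 * Real.pi} := isOpen_lt (by fun_prop) continuous_const
    have h0 : (0 : ℂ) ∈ {w : ℂ | |w.im| < 2 * Real.pi} := by simp [Real.pi_pos]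
    have e2 : RemovableAt (szegoRegular ℓ c) 0 := by
      apply RemovableAt.of_differentiableAt
      filter_upwards [ho.mem_nhds h0] with z hz using differentiableAt_szegoRegular hℓ hc hz
    refine ((e1.add e2).congr ?_).2
    filter_upwards [self_mem_nhdsWithin, nhdsWithin_le_nhds (ho.mem_nhds h0),
      nhdsWithin_le_nhds hne] with z hz0 hz1 hz2
    have hz0' : z ≠ 0 := hz0
    rw [szegoKernel_eq hℓ hc hz1, ← ha]
    rw [hh1 z hz0'] at hz2 ⊢
    have hs : Complex.sin (a * z) ≠ 0 := fun h => hz2 (by simp [h])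
    field_simp
    ring

end

/-! ### Fourier series on horizontal strips -/

/-- The horizontal strip `a < Im z < b`. -/
def hstrip (a b : ℝ) : Set ℂ := {z | a < z.im ∧ z.im < b}

lemma isOpen_hstrip (a b : ℝ) : IsOpen (hstrip a b) :=
  (isOpen_lt continuous_const Complex.continuous_im).inter
    (isOpen_lt Complex.continuous_im continuous_const)

/-- The exponential `exp (2πinz/p)`. -/
def fexp (p : ℝ) (n : ℤ) (z : ℂ) : ℂ := Complex.exp (2 * Real.pi * Complex.I * n * z / p)

lemma norm_fexp (p : ℝ) (n : ℤ) (z : ℂ) :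
    ‖fexp p n z‖ = Real.exp (-(2 * Real.pi / p * n * z.im)) := by
  rw [fexp, Complex.norm_exp, Complex.div_ofReal_re]
  congr 1
  simp
  ring

lemma differentiable_fexp (p : ℝ) (n : ℤ) : Differentiable ℂ (fexp p n) := by
  unfold fexp; fun_prop

lemma fexp_add_period {p : ℝ} (hp : 0 < p) (n : ℤ) (z : ℂ) : fexp p n (z + p) = fexp p n z := by
  have : (p : ℂ) ≠ 0 := by exact_mod_cast hp.ne'
  rw [fexp, fexp, show 2 * Real.pi * Complex.I * n * (z + p) / p =
    2 * Real.pi * Complex.I * n * z / p + n * (2 * Real.pi * Complex.I) by field_simp,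
    Complex.exp_add, Complex.exp_int_mul_two_pi_mul_I, mul_one]

lemma fexp_add (p : ℝ) (n : ℤ) (z w : ℂ) : fexp p n (z + w) = fexp p n z * fexp p n w := by
  rw [fexp, fexp, fexp, ← Complex.exp_add]; congr 1; ring

lemma conj_fexp (p : ℝ) (n : ℤ) (z : ℂ) : conj (fexp p n z) = fexp p (-n) (conj z) := by
  rw [fexp, fexp, ← Complex.exp_conj]
  congr 1
  simp [map_ofNat]

lemma fexp_neg_mul (p : ℝ) (n : ℤ) (z : ℂ) : fexp p (-n) z * fexp p n z = 1 := by
  rw [fexp, fexp, ← Complex.exp_add, ← Complex.exp_zero]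
  congr 1; push_cast; ring

/-- The `n`-th Fourier coefficient of `F`, computed on the line `Im z = y`. -/
def lineCoeff (p : ℝ) (F : ℂ → ℂ) (n : ℤ) (y : ℝ) : ℂ :=
  1 / p * ∫ x in (0 : ℝ)..p, F (x + y * Complex.I) * fexp p (-n) (x + y * Complex.I)

/-- Cauchy's theorem on a rectangle one period wide; its vertical sides cancel by periodicity. -/
lemma lineCoeff_congr_line {p a b : ℝ} (hp : 0 < p) {F : ℂ → ℂ}
    (hd : DifferentiableOn ℂ F (hstrip a b)) (hper : ∀ z ∈ hstrip a b, F (z + p) = F z) (n : ℤ)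
    {y₁ y₂ : ℝ} (h₁ : y₁ ∈ Set.Ioo a b) (h₂ : y₂ ∈ Set.Ioo a b) :
    lineCoeff p F n y₁ = lineCoeff p F n y₂ := by
  set G : ℂ → ℂ := fun z => F z * fexp p (-n) z with hG
  have hsub : ∀ y ∈ Set.uIcc y₁ y₂, y ∈ Set.Ioo a b := fun y hy =>
    Set.OrdConnected.uIcc_subset Set.ordConnected_Ioo h₁ h₂ hy
  have := Complex.integral_boundary_rect_eq_zero_of_differentiableOn G (⟨0, y₁⟩ : ℂ) ⟨p, y₂⟩ (by
    refine (hd.mul (differentiable_fexp p _).differentiableOn).mono fun z hz => ?_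
    exact hsub _ hz.2)
  have hv : (∫ y in y₁..y₂, G ((p : ℝ) + y * Complex.I)) =
      ∫ y in y₁..y₂, G ((0 : ℝ) + y * Complex.I) := by
    refine intervalIntegral.integral_congr fun y hy => ?_
    have hz : ((0 : ℝ) + y * Complex.I : ℂ) ∈ hstrip a b := by
      have := hsub y hy
      simpa [hstrip] using this
    simp only [hG]
    rw [show ((p : ℂ) + y * Complex.I) = ((0 : ℝ) + y * Complex.I : ℂ) + p by push_cast; ring,
      hper _ hz, fexp_add_period hp]
  simp only at this
  rw [hv, add_sub_cancel_right, sub_eq_zero] at this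
  rw [lineCoeff, lineCoeff, this]

lemma exists_continuousMap_line {p a b : ℝ} {F : ℂ → ℂ}
    (hd : DifferentiableOn ℂ F (hstrip a b)) (hper : ∀ z ∈ hstrip a b, F (z + p) = F z) {y : ℝ}
    (hy : y ∈ Set.Ioo a b) : ∃ f : C(AddCircle p, ℂ), ∀ x : ℝ, f x = F (x + y * Complex.I) := by
  have hmem : ∀ x : ℝ, (x + y * Complex.I : ℂ) ∈ hstrip a b := fun x => by simpa [hstrip] using hy
  have hP : Function.Periodic (fun x : ℝ => F (x + y * Complex.I)) p := fun x => by
    simp only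
    rw [← hper _ (hmem x)]
    congr 1; push_cast; ring
  have hc : Continuous fun x : ℝ => F (x + y * Complex.I) :=
    hd.continuousOn.comp_continuous (by fun_prop) hmem
  exact ⟨⟨hP.lift, continuous_quot_lift _ hc⟩, fun x => rfl⟩

lemma fourierCoeff_line {p : ℝ} [Fact (0 < p)] {F : ℂ → ℂ} {y : ℝ} {f : C(AddCircle p, ℂ)}
    (hf : ∀ x : ℝ, f x = F (x + y * Complex.I)) (n : ℤ) :
    fourierCoeff f n = lineCoeff p F n y * fexp p n (y * Complex.I) := by
  rw [fourierCoeff_eq_intervalIntegral _ _ 0, lineCoeff, mul_assoc,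
    ← intervalIntegral.integral_mul_const, zero_add]
  simp only [Complex.real_smul, smul_eq_mul]
  push_cast
  congr 1
  refine intervalIntegral.integral_congr fun x _ => ?_
  have h0 : fourier (-n) (x : AddCircle p) = fexp p (-n) x := by rw [fourier_coe_apply, fexp]
  simp only [h0, hf]
  rw [fexp_add]
  linear_combination (-F (x + y * Complex.I) * fexp p (-n) x) * fexp_neg_mul p n (y * Complex.I)

/-- Expansion of a periodic holomorphic function on a strip into a Fourier series. -/
theorem exists_fourier_expansion {p a b : ℝ} (hp : 0 < p) (hab : a < b) {F : ℂ → ℂ}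
    (hd : DifferentiableOn ℂ F (hstrip a b)) (hper : ∀ z ∈ hstrip a b, F (z + p) = F z) :
    ∃ A : ℤ → ℂ, (∀ n, ∀ y ∈ Set.Ioo a b, A n = lineCoeff p F n y) ∧
      ∀ z ∈ hstrip a b, HasSum (fun n => A n * fexp p n z) (F z) := by
  have : Fact (0 < p) := ⟨hp⟩
  have hmid : (a + b) / 2 ∈ Set.Ioo a b := ⟨by linarith, by linarith⟩
  set A : ℤ → ℂ := fun n => lineCoeff p F n ((a + b) / 2)
  have hA : ∀ n, ∀ y ∈ Set.Ioo a b, A n = lineCoeff p F n y := fun n y hy =>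
    lineCoeff_congr_line hp hd hper n hmid hy
  refine ⟨A, hA, ?_⟩
  -- The same coefficients are bounded on every line. Comparing with one line below `z` for `n ≥ 0`
  -- and one above for `n ≤ 0` gives exponential decay in both directions.
  have hbound : ∀ y ∈ Set.Ioo a b, ∃ C, ∀ n, ‖A n‖ ≤ C * Real.exp (2 * Real.pi / p * n * y) := by
    intro y hy
    obtain ⟨f, hf⟩ := exists_continuousMap_line hd hper hy
    refine ⟨‖f‖, fun n => ?_⟩
    have h1 := fourierCoeff_line hf n
    rw [← hA n y hy] at h1
    have h2 : ‖fourierCoeff f n‖ ≤ ‖f‖ := by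
      rw [fourierCoeff]
      refine (norm_integral_le_of_norm_le_const (C := ‖f‖)
        (Eventually.of_forall fun x => ?_)).trans ?_
      · rw [norm_smul, fourier_apply, Circle.norm_coe, one_mul]
        exact f.norm_coe_le_norm x
      · simp
    rw [h1, norm_mul, norm_fexp, Real.exp_neg] at h2
    have h3 : ((y : ℂ) * Complex.I).im = y := by simp
    rw [h3, ← div_eq_mul_inv, div_le_iff₀ (Real.exp_pos _)] at h2
    exact h2
  intro z hz
  obtain ⟨f, hf⟩ := exists_continuousMap_line hd hper hz
  have hcoef : ∀ n, fourierCoeff f n = A n * fexp p n (z.im * Complex.I) := fun n => by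
    rw [fourierCoeff_line hf n, ← hA n _ hz]
  have hsum : Summable (fourierCoeff f) := by
    set δ := min (z.im - a) (b - z.im) / 2 with hδ
    have hz1 := hz.1
    have hz2 := hz.2
    have hδ0 : 0 < δ := by
      rw [hδ]; exact half_pos (lt_min (by linarith) (by linarith))
    have hδ1 : δ < z.im - a := by
      have := min_le_left (z.im - a) (b - z.im); linarith
    have hδ2 : δ < b - z.im := by
      have := min_le_right (z.im - a) (b - z.im); linarith
    obtain ⟨C₁, hC₁⟩ := hbound (z.im - δ) ⟨by linarith, by linarith⟩
    obtain ⟨C₂, hC₂⟩ := hbound (z.im + δ) ⟨by linarith, by linarith⟩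
    have hκ : 0 < 2 * Real.pi / p * δ := by have := Real.pi_pos; positivity
    refine Summable.of_norm_bounded ((summable_exp_neg_mul_abs hκ).mul_left (max C₁ C₂)) fun n => ?_
    rw [hcoef, norm_mul, norm_fexp]
    have him : ((z.im : ℂ) * Complex.I).im = z.im := by simp
    rw [him]
    rcases le_total 0 (n : ℝ) with hn | hn
    · refine (mul_le_mul_of_nonneg_right (hC₁ n) (Real.exp_pos _).le).trans ?_
      rw [mul_assoc, ← Real.exp_add, abs_of_nonneg hn, show 2 * Real.pi / p * n * (z.im - δ) +
        -(2 * Real.pi / p * n * z.im) = -(2 * Real.pi / p * δ * n) by ring]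
      exact mul_le_mul_of_nonneg_right (le_max_left _ _) (Real.exp_pos _).le
    · refine (mul_le_mul_of_nonneg_right (hC₂ n) (Real.exp_pos _).le).trans ?_
      rw [mul_assoc, ← Real.exp_add, abs_of_nonpos hn, show 2 * Real.pi / p * n * (z.im + δ) +
        -(2 * Real.pi / p * n * z.im) = -(2 * Real.pi / p * δ * -n) by ring]
      exact mul_le_mul_of_nonneg_right (le_max_right _ _) (Real.exp_pos _).le
  have := has_pointwise_sum_fourier_series_of_summable hsum (z.re : AddCircle p)
  rw [hf, Complex.re_add_im] at this
  convert this using 2 with n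
  rw [hcoef, smul_eq_mul, mul_assoc, fourier_coe_apply]
  congr 1
  nth_rw 1 [← Complex.re_add_im z]
  rw [fexp_add, mul_comm]
  rfl

/-- The sum of the Fourier series with coefficients `A`. -/
def fsum (p : ℝ) (A : ℤ → ℂ) (z : ℂ) : ℂ := ∑' n, A n * fexp p n z

/-- The Fourier series with coefficients `A` converges absolutely on the line `Im z = y`. -/
def FSummable (p : ℝ) (A : ℤ → ℂ) (y : ℝ) : Prop :=
  Summable fun n : ℤ => ‖A n‖ * Real.exp (-(2 * Real.pi / p * n * y))

lemma fsummable_im_iff {p : ℝ} {A : ℤ → ℂ} {z : ℂ} :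
    FSummable p A z.im ↔ Summable fun n => A n * fexp p n z := by
  rw [← summable_norm_iff, FSummable]
  simp only [norm_mul, norm_fexp]

/-- For fixed `n` the exponential is monotone in `y`, so each term is dominated by its value at one
of the end lines. -/
lemma FSummable.of_mem_Icc {p : ℝ} {A : ℤ → ℂ} {y₁ y₂ y : ℝ} (h₁ : FSummable p A y₁)
    (h₂ : FSummable p A y₂) (hy : y ∈ Set.Icc y₁ y₂) :
    FSummable p A y ∧ ∀ n : ℤ, ‖A n‖ * Real.exp (-(2 * Real.pi / p * n * y)) ≤
      ‖A n‖ * Real.exp (-(2 * Real.pi / p * n * y₁)) +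
        ‖A n‖ * Real.exp (-(2 * Real.pi / p * n * y₂)) := by
  have hle : ∀ n : ℤ, ‖A n‖ * Real.exp (-(2 * Real.pi / p * n * y)) ≤
      ‖A n‖ * Real.exp (-(2 * Real.pi / p * n * y₁)) +
        ‖A n‖ * Real.exp (-(2 * Real.pi / p * n * y₂)) := by
    intro n
    rw [← mul_add]
    refine mul_le_mul_of_nonneg_left ?_ (norm_nonneg _)
    have hx1 := Real.exp_pos (-(2 * Real.pi / p * n * y₁))
    have hx2 := Real.exp_pos (-(2 * Real.pi / p * n * y₂))
    rcases le_total 0 (2 * Real.pi / p * n) with hn | hn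
    · have : Real.exp (-(2 * Real.pi / p * n * y)) ≤ Real.exp (-(2 * Real.pi / p * n * y₁)) :=
        Real.exp_le_exp.2 (by nlinarith [hy.1])
      linarith
    · have : Real.exp (-(2 * Real.pi / p * n * y)) ≤ Real.exp (-(2 * Real.pi / p * n * y₂)) :=
        Real.exp_le_exp.2 (by nlinarith [hy.2])
      linarith
  exact ⟨Summable.of_nonneg_of_le (fun n => by positivity) hle (Summable.add h₁ h₂), hle⟩

lemma differentiableOn_fsum {p a b : ℝ} {A : ℤ → ℂ} (hA : ∀ y ∈ Set.Ioo a b, FSummable p A y) :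
    DifferentiableOn ℂ (fsum p A) (hstrip a b) := by
  intro z hz
  obtain ⟨y₁, h1, h1'⟩ := exists_between hz.1
  obtain ⟨y₂, h2, h2'⟩ := exists_between hz.2
  have hy₁ := hA y₁ ⟨h1, h1'.trans hz.2⟩
  have hy₂ := hA y₂ ⟨hz.1.trans h2, h2'⟩
  refine DifferentiableAt.differentiableWithinAt ?_
  refine (Complex.differentiableOn_tsum_of_summable_norm (Summable.add hy₁ hy₂)
    (fun n => ?_) (isOpen_hstrip y₁ y₂) fun n w hw => ?_).differentiableAt
      ((isOpen_hstrip y₁ y₂).mem_nhds ⟨h1', h2⟩)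
  · exact ((differentiable_fexp p n).const_mul _).differentiableOn
  · rw [norm_mul, norm_fexp]
    exact (hy₁.of_mem_Icc hy₂ ⟨hw.1.le, hw.2.le⟩).2 n

lemma fsum_add_period {p : ℝ} (hp : 0 < p) (A : ℤ → ℂ) (z : ℂ) : fsum p A (z + p) = fsum p A z := by
  simp only [fsum, fexp_add_period hp]

lemma conj_fsum_conj (p : ℝ) (A : ℤ → ℂ) (z : ℂ) :
    conj (fsum p A (conj z)) = fsum p (fun n => conj (A (-n))) z := by
  rw [fsum, fsum, Complex.conj_tsum, ← (Equiv.neg ℤ).tsum_eq]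
  simp [conj_fexp]

lemma FSummable.neg {p : ℝ} {A B : ℤ → ℂ} (hAB : ∀ n, ‖A (-n)‖ = ‖B n‖) {y : ℝ}
    (h : FSummable p A y) : FSummable p B (-y) := by
  rw [FSummable, ← (Equiv.neg ℤ).summable_iff] at h
  refine h.congr fun n => ?_
  simp [hAB]

/-- A Fourier series with symmetric coefficients converging for `0 < Im z < b` converges
for `-b < Im z < b`. -/
lemma FSummable.of_symm {p b : ℝ} {A : ℤ → ℂ} (hA : ∀ n, ‖A (-n)‖ = ‖A n‖)
    (h : ∀ y ∈ Set.Ioo 0 b, FSummable p A y) : ∀ y ∈ Set.Ioo (-b) b, FSummable p A y := by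
  intro y hy
  obtain ⟨t, ht, htb⟩ := exists_between (abs_lt.2 hy)
  have h1 := h t ⟨(abs_nonneg y).trans_lt ht, htb⟩
  exact ((h1.neg hA).of_mem_Icc h1 (abs_le.1 ht.le)).1

/-! ### Reflection of periodic functions across the real line. -/

lemma fexp_ofReal_mul_I (p : ℝ) (n : ℤ) (y : ℝ) :
    fexp p n (y * Complex.I) = Real.exp (-(2 * Real.pi / p * n * y)) := by
  rw [fexp, Complex.ofReal_exp]
  congr 1
  push_cast
  linear_combination (2 * Real.pi * n * y / p : ℂ) * Complex.I_mul_I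

/-- The left side is the Fourier coefficient of `2 Re F` on the line, so smallness of the real part
controls it. -/
lemma lineCoeff_add_conj {p : ℝ} {F : ℂ → ℂ} {y : ℝ}
    (hc : Continuous fun x : ℝ => F (x + y * Complex.I)) (n : ℤ) :
    lineCoeff p F n y * Real.exp (-(2 * Real.pi / p * n * y)) +
      conj (lineCoeff p F (-n) y) * Real.exp (2 * Real.pi / p * n * y) =
    1 / p * ∫ x in (0 : ℝ)..p, 2 * ((F (x + y * Complex.I)).re : ℂ) * fexp p (-n) x := by
  have hce : ∀ m : ℤ, Continuous fun x : ℝ => fexp p m (x + y * Complex.I) := fun m =>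
    (differentiable_fexp p m).continuous.comp (by fun_prop)
  have hconj : conj (lineCoeff p F (-n) y) = 1 / p * ∫ x in (0 : ℝ)..p,
      conj (F (x + y * Complex.I) * fexp p (-(-n)) (x + y * Complex.I)) := by
    have := Complex.conjCLE.toContinuousLinearMap.intervalIntegral_comp_comm
      ((hc.mul (hce (-(-n)))).intervalIntegrable (μ := volume) 0 p)
    simp only [ContinuousLinearEquiv.coe_coe, Complex.conjCLE_apply, Pi.mul_apply] at this
    rw [this, lineCoeff]
    simp
  rw [hconj, lineCoeff, mul_assoc (1 / (p : ℂ)), mul_assoc (1 / (p : ℂ)), ← mul_add,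
    ← intervalIntegral.integral_mul_const, ← intervalIntegral.integral_mul_const,
    ← intervalIntegral.integral_add]
  · congr 1
    refine intervalIntegral.integral_congr fun x _ => ?_
    have e1 : Complex.ofReal (Real.exp (-(2 * Real.pi / p * n * y))) = fexp p n (y * Complex.I) :=
      (fexp_ofReal_mul_I p n y).symm
    have e2 : Complex.ofReal (Real.exp (2 * Real.pi / p * n * y)) =
        fexp p (-n) (y * Complex.I) := by
      rw [fexp_ofReal_mul_I]; congr 2; push_cast; ring
    have e3 : conj (fexp p n (x + y * Complex.I)) = fexp p (-n) x * fexp p n (y * Complex.I) := by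
      rw [conj_fexp, map_add, fexp_add, map_mul, Complex.conj_I, Complex.conj_ofReal,
        Complex.conj_ofReal]
      congr 1
      rw [fexp, fexp]
      congr 1; push_cast; ring
    simp only [neg_neg, map_mul, e1, e2, e3]
    rw [fexp_add]
    have e4 := fexp_neg_mul p n (y * Complex.I)
    have e5 := Complex.add_conj (F (x + y * Complex.I))
    push_cast at e5
    linear_combination fexp p (-n) x * (F (x + y * Complex.I) + conj (F (x + y * Complex.I))) * e4 +
      fexp p (-n) x * e5
  · exact ((hc.mul (hce _)).mul continuous_const).intervalIntegrable _ _
  · exact ((Complex.continuous_conj.comp (hc.mul (hce _))).mul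
      continuous_const).intervalIntegrable _ _

/-- As the line descends to the boundary, the coefficients of `F` stay fixed, the exponential
weights tend to `1` and the coefficients of `2 Re F` tend to `0`. -/
lemma coeff_eq_neg_conj {p b : ℝ} (hp : 0 < p) (hb : 0 < b) {F : ℂ → ℂ}
    (hd : DifferentiableOn ℂ F (hstrip 0 b))
    (hre : ∀ ε > 0, ∃ δ > 0, ∀ z ∈ hstrip 0 b, z.im < δ → |(F z).re| ≤ ε) {A : ℤ → ℂ}
    (hA : ∀ n, ∀ y ∈ Set.Ioo 0 b, A n = lineCoeff p F n y) (n : ℤ) : A n = -conj (A (-n)) := by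
  rw [← sub_eq_zero, sub_neg_eq_add, ← norm_le_zero_iff]
  refine le_of_forall_pos_le_add fun ε hε => ?_
  obtain ⟨δ, hδ, hδε⟩ := hre (ε / 2) (by positivity)
  have hlim : Tendsto (fun y : ℝ => A n * Real.exp (-(2 * Real.pi / p * n * y)) +
      conj (A (-n)) * Real.exp (2 * Real.pi / p * n * y)) (𝓝[>] 0) (𝓝 (A n + conj (A (-n)))) := by
    have : Continuous fun y : ℝ => A n * (Real.exp (-(2 * Real.pi / p * n * y)) : ℂ) +
      conj (A (-n)) * (Real.exp (2 * Real.pi / p * n * y) : ℂ) := by fun_prop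
    simpa using (this.tendsto 0).mono_left (nhdsWithin_le_nhds (s := Set.Ioi 0))
  refine le_of_tendsto hlim.norm ?_
  filter_upwards [Ioo_mem_nhdsGT (lt_min hδ hb)] with y hy
  have hyb : y ∈ Set.Ioo 0 b := ⟨hy.1, hy.2.trans_le (min_le_right _ _)⟩
  have hmem : ∀ x : ℝ, (x + y * Complex.I : ℂ) ∈ hstrip 0 b := fun x => by simpa [hstrip] using hyb
  have hc : Continuous fun x : ℝ => F (x + y * Complex.I) :=
    hd.continuousOn.comp_continuous (by fun_prop) hmem
  rw [hA n y hyb, hA (-n) y hyb, lineCoeff_add_conj hc, zero_add, norm_mul]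
  have h1 := intervalIntegral.norm_integral_le_of_norm_le_const (a := 0) (b := p) (C := ε)
    (f := fun x : ℝ => 2 * ((F (x + y * Complex.I)).re : ℂ) * fexp p (-n) x) fun x _ => by
      have := hδε _ (hmem x) (by simpa using hy.2.trans_le (min_le_left _ _))
      rw [norm_mul, norm_fexp, norm_mul, Complex.norm_real, Real.norm_eq_abs]
      simp
      linarith
  rw [sub_zero, abs_of_pos hp] at h1
  have h2 : ‖(1 / p : ℂ)‖ = 1 / p := by simp [abs_of_pos hp]
  rw [h2]
  calc 1 / p * _ ≤ 1 / p * (ε * p) := mul_le_mul_of_nonneg_left h1 (by positivity)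
    _ = ε := by field_simp

/-- The Schwarz reflection principle for periodic functions. -/
theorem schwarz_reflection {p b : ℝ} (hp : 0 < p) (hb : 0 < b) {F : ℂ → ℂ}
    (hd : DifferentiableOn ℂ F (hstrip 0 b)) (hper : ∀ z ∈ hstrip 0 b, F (z + p) = F z)
    (hre : ∀ ε > 0, ∃ δ > 0, ∀ z ∈ hstrip 0 b, z.im < δ → |(F z).re| ≤ ε) :
    ∃ G : ℂ → ℂ, DifferentiableOn ℂ G (hstrip (-b) b) ∧ Set.EqOn G F (hstrip 0 b) ∧
      (∀ z, G (z + p) = G z) ∧ ∀ z, G (conj z) = -conj (G z) := by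
  obtain ⟨A, hA, hsum⟩ := exists_fourier_expansion hp hb hd hper
  -- The boundary condition becomes a symmetry of the coefficients, which makes the series converge
  -- on the mirrored lines as well; its sum is the extension. No continuity of `F` up to the
  -- boundary is required.
  have hsymm := coeff_eq_neg_conj hp hb hd hre hA
  refine ⟨fsum p A, ?_, fun z hz => (hsum z hz).tsum_eq, fsum_add_period hp A, fun z => ?_⟩
  · refine differentiableOn_fsum (FSummable.of_symm (fun n => ?_) fun y hy => ?_)
    · rw [hsymm n]; simp
    · have := (hsum (y * Complex.I) (by simpa [hstrip] using hy)).summable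
      simpa using fsummable_im_iff.2 this
  · have h1 := conj_fsum_conj p A z
    have h2 : (fun n => conj (A (-n))) = fun n => -A n := by
      funext n; rw [hsymm n]; simp
    have h3 : fsum p (fun n => -A n) z = -fsum p A z := by
      simp [fsum, tsum_neg]
    rw [h2, h3] at h1
    have := congrArg conj h1
    simpa using this

/-! ### The gauge function -/

/-- The Fourier coefficients of the gauge function of a function with Fourier coefficients `A`. -/
def gaugeCoeff (ℓ : ℝ) (A : ℤ → ℂ) (n : ℤ) : ℂ :=
  if n = 0 then ((A 0).re : ℂ) else
    (A n * Real.exp (-(2 * Real.pi / ℓ * n * (2 * Real.pi))) - conj (A (-n))) /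
      (Real.exp (-(2 * Real.pi / ℓ * n * (2 * Real.pi))) - 1)

/-- The Fourier coefficients, with respect to the top boundary, of the difference of the gauge
function and the given function, up to the constant term. -/
def gaugeTopCoeff (ℓ : ℝ) (A : ℤ → ℂ) (n : ℤ) : ℂ :=
  if n = 0 then 0 else
    (gaugeCoeff ℓ A n - A n) * Real.exp (-(2 * Real.pi / ℓ * n * Real.pi))

section

variable {ℓ : ℝ} {A : ℤ → ℂ}

lemma exp_sub_one_ne_zero (hℓ : 0 < ℓ) {n : ℤ} (hn : n ≠ 0) :
    (Real.exp (-(2 * Real.pi / ℓ * n * (2 * Real.pi))) : ℂ) - 1 ≠ 0 := by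
  rw [sub_ne_zero]
  have hpi := Real.pi_pos
  have : Real.exp (-(2 * Real.pi / ℓ * n * (2 * Real.pi))) ≠ 1 := by
    rw [Ne, Real.exp_eq_one_iff, neg_eq_zero]
    have : (n : ℝ) ≠ 0 := by exact_mod_cast hn
    positivity
  exact_mod_cast this

lemma conj_gaugeCoeff_neg (hℓ : 0 < ℓ) (n : ℤ) :
    conj (gaugeCoeff ℓ A (-n)) = gaugeCoeff ℓ A n := by
  by_cases hn : n = 0
  · simp [gaugeCoeff, hn]
  have h1 := exp_sub_one_ne_zero hℓ hn
  have h2 := exp_sub_one_ne_zero hℓ (neg_ne_zero.2 hn)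
  simp only [gaugeCoeff, hn, neg_eq_zero, if_false, map_div₀, map_sub, map_mul, Complex.conj_ofReal,
    neg_neg, Complex.conj_conj, map_one]
  rw [div_eq_div_iff h2 h1]
  have h3 : (Real.exp (-(2 * Real.pi / ℓ * n * (2 * Real.pi))) : ℂ) *
      (Real.exp (-(2 * Real.pi / ℓ * (-n : ℤ) * (2 * Real.pi))) : ℂ) = 1 := by
    rw [← Complex.ofReal_mul, ← Real.exp_add, ← Complex.ofReal_one, ← Real.exp_zero]
    congr 2; push_cast; ring
  linear_combination (conj (A (-n)) - A n) * h3

/-- This symmetry and `conj_gaugeCoeff_neg` are what dictate the formula for `gaugeCoeff`: reality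
at the bottom and at the top are linear conditions with a unique solution for `n ≠ 0`, because the
exponential there is not `1`. For `n = 0` they would require `Im (A 0) = 0`; this obstruction is set
aside here and reappears as `α`. -/
lemma conj_gaugeTopCoeff_neg (hℓ : 0 < ℓ) (n : ℤ) :
    conj (gaugeTopCoeff ℓ A (-n)) = gaugeTopCoeff ℓ A n := by
  by_cases hn : n = 0
  · simp [gaugeTopCoeff, hn]
  simp only [gaugeTopCoeff, hn, neg_eq_zero, if_false, map_sub, map_mul, Complex.conj_ofReal,
    conj_gaugeCoeff_neg hℓ]
  simp only [gaugeCoeff, hn, if_false]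
  have h1 := exp_sub_one_ne_zero hℓ hn
  have h3 : (Real.exp (-(2 * Real.pi / ℓ * n * Real.pi)) : ℂ) *
      (Real.exp (-(2 * Real.pi / ℓ * (-n : ℤ) * Real.pi)) : ℂ) = 1 := by
    rw [← Complex.ofReal_mul, ← Real.exp_add, ← Complex.ofReal_one, ← Real.exp_zero]
    congr 2; push_cast; ring
  have h4 : (Real.exp (-(2 * Real.pi / ℓ * n * (2 * Real.pi))) : ℂ) =
      (Real.exp (-(2 * Real.pi / ℓ * n * Real.pi)) : ℂ) ^ 2 := by
    rw [← Complex.ofReal_pow, ← Real.exp_nat_mul]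
    congr 2; push_cast; ring
  rw [h4] at h1 ⊢
  set e : ℂ := (Real.exp (-(2 * Real.pi / ℓ * n * Real.pi)) : ℂ)
  set e' : ℂ := (Real.exp (-(2 * Real.pi / ℓ * (-n : ℤ) * Real.pi)) : ℂ)
  field_simp
  linear_combination (A n - conj (A (-n))) * e * h3

/-- For `n > 0` the denominator is bounded below. For `n < 0` it is comparable to the large
exponential `E` multiplying `A n`, and `y < π` ensures that division by `E` turns the weight of
index `n` into at most the weight of index `-n`. -/
lemma norm_gaugeCoeff_le (hℓ : 0 < ℓ) {y : ℝ} (hy : y ∈ Set.Ioo 0 Real.pi) (n : ℤ) :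
    ‖gaugeCoeff ℓ A n‖ * Real.exp (-(2 * Real.pi / ℓ * n * y)) ≤
      1 / (1 - Real.exp (-(2 * Real.pi / ℓ * (2 * Real.pi)))) *
        (‖A n‖ * Real.exp (-(2 * Real.pi / ℓ * n * y)) +
          ‖A (-n)‖ * Real.exp (-(2 * Real.pi / ℓ * (-n : ℤ) * y))) := by
  have hpi := Real.pi_pos
  obtain ⟨hy0, hy1⟩ := hy
  set κ := 2 * Real.pi / ℓ with hκ
  have hκ0 : 0 < κ := by positivity
  have hC0 : 0 < 1 - Real.exp (-(κ * (2 * Real.pi))) := by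
    have : Real.exp (-(κ * (2 * Real.pi))) < 1 := Real.exp_lt_one_iff.2 (by
      have : 0 < κ * (2 * Real.pi) := by positivity
      linarith)
    linarith
  have hC1 : 1 - Real.exp (-(κ * (2 * Real.pi))) ≤ 1 := by
    have := Real.exp_pos (-(κ * (2 * Real.pi))); linarith
  rw [one_div, inv_mul_eq_div, le_div_iff₀ hC0]
  have hnorm : n ≠ 0 → ‖gaugeCoeff ℓ A n‖ * |Real.exp (-(κ * n * (2 * Real.pi))) - 1| ≤
      ‖A n‖ * Real.exp (-(κ * n * (2 * Real.pi))) + ‖A (-n)‖ := by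
    intro hn
    have h1 := exp_sub_one_ne_zero hℓ hn
    rw [← hκ] at h1
    have h2 : ‖(Real.exp (-(κ * n * (2 * Real.pi))) : ℂ) - 1‖ =
        |Real.exp (-(κ * n * (2 * Real.pi))) - 1| := by
      rw [← Real.norm_eq_abs, ← Complex.norm_real]; push_cast; rfl
    simp only [gaugeCoeff, hn, if_false, ← hκ]
    rw [norm_div, ← h2, div_mul_cancel₀ _ (norm_ne_zero_iff.2 h1)]
    refine (norm_sub_le _ _).trans_eq ?_
    rw [norm_mul, Complex.norm_real, Real.norm_of_nonneg (Real.exp_pos _).le, Complex.norm_conj]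
  have hx := Real.exp_pos (-(κ * n * y))
  have hE := Real.exp_pos (-(κ * n * (2 * Real.pi)))
  rcases lt_trichotomy n 0 with hn | hn | hn
  · have hn1 : (n : ℝ) ≤ -1 := by exact_mod_cast (by omega : n ≤ -1)
    have h0 := hnorm hn.ne
    have h1 : 1 ≤ Real.exp (-(κ * (2 * Real.pi))) * Real.exp (-(κ * n * (2 * Real.pi))) := by
      rw [← Real.exp_add]
      apply Real.one_le_exp
      have : 0 ≤ κ * (2 * Real.pi) * (-1 - n) := mul_nonneg (by positivity) (by linarith)
      linarith
    have h2 : Real.exp (-(κ * n * y)) ≤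
        Real.exp (-(κ * (-n : ℤ) * y)) * Real.exp (-(κ * n * (2 * Real.pi))) := by
      rw [← Real.exp_add]
      apply Real.exp_le_exp.2
      push_cast
      have : 0 ≤ κ * -n * (2 * Real.pi - 2 * y) :=
        mul_nonneg (mul_nonneg hκ0.le (by linarith)) (by linarith)
      linarith
    set E := Real.exp (-(κ * n * (2 * Real.pi)))
    set E₁ := Real.exp (-(κ * (2 * Real.pi)))
    set x := Real.exp (-(κ * n * y))
    have h3 : (1 - E₁) * E ≤ |E - 1| := by
      refine le_trans ?_ (le_abs_self _)
      linarith
    have h4 : ‖gaugeCoeff ℓ A n‖ * x * (1 - E₁) * E ≤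
        (‖A n‖ * x + ‖A (-n)‖ * Real.exp (-(κ * (-n : ℤ) * y))) * E := by
      calc ‖gaugeCoeff ℓ A n‖ * x * (1 - E₁) * E =
            ‖gaugeCoeff ℓ A n‖ * ((1 - E₁) * E) * x := by ring
        _ ≤ ‖gaugeCoeff ℓ A n‖ * |E - 1| * x := by gcongr
        _ ≤ (‖A n‖ * E + ‖A (-n)‖) * x := by gcongr
        _ = ‖A n‖ * x * E + ‖A (-n)‖ * x := by ring
        _ ≤ ‖A n‖ * x * E + ‖A (-n)‖ * (Real.exp (-(κ * (-n : ℤ) * y)) * E) := by gcongr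
        _ = _ := by ring
    exact le_of_mul_le_mul_right h4 hE
  · subst hn
    have h1 : ‖gaugeCoeff ℓ A 0‖ ≤ ‖A 0‖ := by
      simp only [gaugeCoeff, if_true, Complex.norm_real]
      exact Complex.abs_re_le_norm _
    simp
    nlinarith [norm_nonneg (gaugeCoeff ℓ A 0), norm_nonneg (A 0)]
  · have hn1 : (1 : ℝ) ≤ n := by exact_mod_cast (by omega : 1 ≤ n)
    have h0 := hnorm hn.ne'
    have h1 : Real.exp (-(κ * n * (2 * Real.pi))) ≤ Real.exp (-(κ * (2 * Real.pi))) := by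
      apply Real.exp_le_exp.2
      have : 0 ≤ κ * (2 * Real.pi) * (n - 1) := mul_nonneg (by positivity) (by linarith)
      linarith
    have h2 : Real.exp (-(κ * n * y)) ≤ Real.exp (-(κ * (-n : ℤ) * y)) := by
      apply Real.exp_le_exp.2
      push_cast
      have : 0 ≤ κ * n * y := by positivity
      linarith
    set E := Real.exp (-(κ * n * (2 * Real.pi)))
    set E₁ := Real.exp (-(κ * (2 * Real.pi)))
    set x := Real.exp (-(κ * n * y))
    have h3 : 1 - E₁ ≤ |E - 1| := by
      rw [abs_sub_comm]
      refine le_trans ?_ (le_abs_self _)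
      linarith
    have h5 : E ≤ 1 := by linarith
    calc ‖gaugeCoeff ℓ A n‖ * x * (1 - E₁) = ‖gaugeCoeff ℓ A n‖ * (1 - E₁) * x := by ring
      _ ≤ ‖gaugeCoeff ℓ A n‖ * |E - 1| * x := by gcongr
      _ ≤ (‖A n‖ * E + ‖A (-n)‖) * x := by gcongr
      _ = ‖A n‖ * x * E + ‖A (-n)‖ * x := by ring
      _ ≤ ‖A n‖ * x * 1 + ‖A (-n)‖ * Real.exp (-(κ * (-n : ℤ) * y)) := by gcongr
      _ = _ := by ring

lemma fsummable_gaugeCoeff (hℓ : 0 < ℓ) {y : ℝ} (hy : y ∈ Set.Ioo 0 Real.pi)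
    (hA : FSummable ℓ A y) : FSummable ℓ (gaugeCoeff ℓ A) y := by
  have hA' := hA
  rw [FSummable, ← (Equiv.neg ℤ).summable_iff] at hA'
  exact Summable.of_nonneg_of_le (fun n => by positivity) (norm_gaugeCoeff_le hℓ hy)
    ((Summable.add hA hA').mul_left _)

/-- Heights are measured from the top line. Below it convergence is inherited from the series of `W`
and `L`; above it, from the symmetry of the coefficients. -/
lemma fsummable_gaugeTopCoeff (hℓ : 0 < ℓ) (hA : ∀ y ∈ Set.Ioo 0 Real.pi, FSummable ℓ A y) :
    ∀ y ∈ Set.Ioo (-Real.pi) Real.pi, FSummable ℓ (gaugeTopCoeff ℓ A) y := by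
  have hsymm : ∀ n, ‖gaugeTopCoeff ℓ A (-n)‖ = ‖gaugeTopCoeff ℓ A n‖ := fun n => by
    rw [← conj_gaugeTopCoeff_neg hℓ n, Complex.norm_conj]
  refine FSummable.of_symm hsymm fun y hy => ?_
  have hy' : Real.pi - y ∈ Set.Ioo 0 Real.pi := ⟨by linarith [hy.2], by linarith [hy.1]⟩
  have h1 : FSummable ℓ (gaugeTopCoeff ℓ A) (-y) := by
    refine Summable.of_nonneg_of_le (fun n => by positivity) (fun n => ?_)
      (Summable.add (fsummable_gaugeCoeff hℓ hy' (hA _ hy')) (hA _ hy'))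
    rw [← add_mul]
    by_cases hn : n = 0
    · simp [gaugeTopCoeff, hn]; positivity
    · simp only [gaugeTopCoeff, hn, if_false]
      rw [norm_mul, Complex.norm_real, Real.norm_of_nonneg (Real.exp_pos _).le, mul_assoc,
        ← Real.exp_add]
      refine mul_le_mul (norm_sub_le _ _) (le_of_eq ?_) (Real.exp_pos _).le (by positivity)
      congr 1; ring
  simpa using h1.neg hsymm

end

/-- `W` is a gauge function for the periodic holomorphic function `L` on the strip: it extends
across the bottom boundary, where it is real, and `V = W - L` extends across the top boundary,
where it has the constant imaginary part `-α`. -/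
structure IsGauge (ℓ : ℝ) (L W V : ℂ → ℂ) (α : ℝ) : Prop where
  differentiableOn_bot : DifferentiableOn ℂ W (hstrip (-Real.pi) Real.pi)
  differentiableOn_top : DifferentiableOn ℂ V (hstrip 0 (2 * Real.pi))
  add_period_bot : ∀ z, W (z + ℓ) = W z
  add_period_top : ∀ z, V (z + ℓ) = V z
  symm_bot : ∀ z, W (conj z) = conj (W z)
  symm_top : ∀ z, conj (V (conj z + 2 * Real.pi * Complex.I)) = V z + 2 * α * Complex.I
  top_eq : ∀ z ∈ strip, V z = W z - L z

/-- Every periodic holomorphic function on the strip has a gauge function. -/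
theorem exists_isGauge {ℓ : ℝ} (hℓ : 0 < ℓ) {L : ℂ → ℂ} (hd : DifferentiableOn ℂ L strip)
    (hper : ∀ z ∈ strip, L (z + ℓ) = L z) : ∃ W V α, IsGauge ℓ L W V α := by
  obtain ⟨A, -, hsum⟩ := exists_fourier_expansion (a := 0) (b := Real.pi) hℓ Real.pi_pos hd hper
  have hA : ∀ y ∈ Set.Ioo 0 Real.pi, FSummable ℓ A y := fun y hy => by
    have := (hsum (y * Complex.I) (by simpa [hstrip] using hy)).summable
    simpa using fsummable_im_iff.2 this
  have hW : ∀ y ∈ Set.Ioo (-Real.pi) Real.pi, FSummable ℓ (gaugeCoeff ℓ A) y :=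
    FSummable.of_symm (fun n => by rw [← conj_gaugeCoeff_neg hℓ n, Complex.norm_conj])
      fun y hy => fsummable_gaugeCoeff hℓ hy (hA y hy)
  have hV := fsummable_gaugeTopCoeff hℓ hA
  -- The imaginary part of the mean of `L` cannot be removed by any function real on the bottom
  -- line; it is the value of `α`.
  refine ⟨fsum ℓ (gaugeCoeff ℓ A),
    fun z => fsum ℓ (gaugeTopCoeff ℓ A) (z - Real.pi * Complex.I) - (A 0).im * Complex.I, (A 0).im,
    differentiableOn_fsum hW, ?_, fsum_add_period hℓ _, fun z => ?_, fun z => ?_, fun z => ?_,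
    fun z hz => ?_⟩
  · refine DifferentiableOn.sub_const ?_ _
    refine (differentiableOn_fsum hV).comp (by fun_prop) fun z hz => ?_
    simp only [hstrip, Set.mem_ofPred_eq] at hz ⊢
    simp
    constructor <;> linarith [hz.1, hz.2]
  · rw [add_sub_right_comm, fsum_add_period hℓ]
  · have := conj_fsum_conj ℓ (gaugeCoeff ℓ A) z
    simp only [conj_gaugeCoeff_neg hℓ] at this
    rw [← this, Complex.conj_conj]
  · have := conj_fsum_conj ℓ (gaugeTopCoeff ℓ A) (z - Real.pi * Complex.I)
    simp only [conj_gaugeTopCoeff_neg hℓ, map_sub, map_mul, Complex.conj_I,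
      Complex.conj_ofReal] at this
    simp only [map_sub, map_mul, Complex.conj_I, Complex.conj_ofReal]
    rw [show conj z + 2 * Real.pi * Complex.I - Real.pi * Complex.I =
      conj z - Real.pi * -Complex.I by ring, this]
    ring
  · have h1 : HasSum (fun n => gaugeCoeff ℓ A n * fexp ℓ n z) (fsum ℓ (gaugeCoeff ℓ A) z) :=
      (fsummable_im_iff.1 (hW z.im ⟨by linarith [hz.1, Real.pi_pos], hz.2⟩)).hasSum
    have h2 := (h1.sub (hsum z hz)).add (hasSum_ite_eq (0 : ℤ) ((A 0).im * Complex.I))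
    have h3 : fsum ℓ (gaugeTopCoeff ℓ A) (z - Real.pi * Complex.I) =
        fsum ℓ (gaugeCoeff ℓ A) z - L z + (A 0).im * Complex.I := by
      rw [← h2.tsum_eq, fsum]
      refine tsum_congr fun n => ?_
      by_cases hn : n = 0
      · subst hn
        have := Complex.re_add_im (A 0)
        simp only [gaugeTopCoeff, gaugeCoeff, if_true]
        simp [fexp]
        linear_combination -this
      · simp only [gaugeTopCoeff, hn, if_false, add_zero]
        have e1 : (Real.exp (-(2 * Real.pi / ℓ * n * Real.pi)) : ℂ) =
            fexp ℓ n (Real.pi * Complex.I) :=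
          (fexp_ofReal_mul_I ℓ n Real.pi).symm
        have e2 : fexp ℓ n z =
            fexp ℓ n (Real.pi * Complex.I) * fexp ℓ n (z - Real.pi * Complex.I) := by
          rw [← fexp_add]; congr 1; ring
        rw [e1, e2]; ring
    simp only [h3]; ring

/-! ### A maximum principle for functions with reflections across both boundaries -/

lemma hstrip_add_period {a b : ℝ} {z : ℂ} (hz : z ∈ hstrip a b) (ℓ : ℝ) : z + ℓ ∈ hstrip a b := by
  simpa [hstrip] using hz

lemma isPreconnected_hstrip (a b : ℝ) : IsPreconnected (hstrip a b) :=
  ((convex_halfSpace_im_gt a).inter (convex_halfSpace_im_lt b)).isPreconnected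

/-- An interior maximum makes `Ψ` constant, and a constant that is antiperiodic on a substrip is
zero. -/
lemma eq_zero_of_isMaxOn_hstrip {ℓ a b a' b' : ℝ} (hab' : a' < b') {Δ Ψ : ℂ → ℂ}
    (hΨ : DifferentiableOn ℂ Ψ (hstrip a b)) (hsub : hstrip a' b' ⊆ hstrip a b)
    (heq : Set.EqOn Ψ Δ (hstrip a' b')) (hanti : ∀ z ∈ hstrip a' b', Δ (z + ℓ) = -Δ z) {p : ℂ}
    (hp : p ∈ hstrip a b) (hmax : IsMaxOn (norm ∘ Ψ) (hstrip a b) p) : Ψ p = 0 := by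
  have hconst := Complex.eqOn_of_isPreconnected_of_isMaxOn_norm (isPreconnected_hstrip a b)
    (isOpen_hstrip a b) hΨ hp hmax
  obtain ⟨y, hy⟩ := exists_between hab'
  have hz : (y * Complex.I : ℂ) ∈ hstrip a' b' := by simpa [hstrip] using hy
  have h1 := hconst (hsub hz)
  have h2 := hconst (hsub (hstrip_add_period hz ℓ))
  simp only [Function.const_apply] at h1 h2
  rw [heq hz] at h1
  rw [heq (hstrip_add_period hz ℓ), hanti _ hz, h1] at h2
  exact self_eq_neg.1 h2.symm

/-- An antiperiodic holomorphic function on the strip that extends across both boundaries to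
functions whose norms are symmetric with respect to reflection is zero. -/
theorem eq_zero_of_reflections {ℓ T b t : ℝ} (hT : 0 < T) (hb : 0 < b) (hbπ : b ≤ Real.pi)
    (ht : 0 < t) (htπ : t ≤ Real.pi) {Δ Δb Δt : ℂ → ℂ}
    (hd : DifferentiableOn ℂ Δ (hstrip 0 Real.pi))
    (hanti : ∀ z ∈ hstrip 0 Real.pi, Δ (z + ℓ) = -Δ z)
    (hdb : DifferentiableOn ℂ Δb (hstrip (-b) b)) (heb : Set.EqOn Δb Δ (hstrip 0 b))
    (hsb : ∀ z, ‖Δb (conj z)‖ = ‖Δb z‖)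
    (hdt : DifferentiableOn ℂ Δt (hstrip (Real.pi - t) (Real.pi + t)))
    (het : Set.EqOn Δt Δ (hstrip (Real.pi - t) Real.pi))
    (hst : ∀ z, ‖Δt (conj z + 2 * Real.pi * Complex.I)‖ = ‖Δt z‖)
    (hp : ∀ z ∈ hstrip 0 Real.pi, Δ (z + T) = Δ z) (hpb : ∀ z, Δb (z + T) = Δb z)
    (hpt : ∀ z, Δt (z + T) = Δt z) : ∀ z ∈ hstrip 0 Real.pi, Δ z = 0 := by
  have hpi := Real.pi_pos
  -- The three functions are glued on the closed strip, where periodicity makes `‖Θ‖` attain its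
  -- maximum. If this happens on a boundary line, the symmetry of the norms makes it an interior
  -- maximum of the extension across that line.
  set Θ : ℂ → ℂ := fun z => if z.im ≤ 0 then Δb z else if z.im < Real.pi then Δ z else Δt z with hΘ
  set C : Set ℂ := {z | 0 ≤ z.im ∧ z.im ≤ Real.pi} with hC
  have hΘb : ∀ z ∈ C, z.im < b → Θ z = Δb z := by
    intro z hz hzb
    by_cases h : z.im ≤ 0
    · simp [hΘ, h]
    · rw [not_le] at h
      simp only [hΘ, h.not_ge, if_false, hzb.trans_le hbπ, if_true]
      exact (heb ⟨h, hzb⟩).symm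
  have hΘt : ∀ z ∈ C, Real.pi - t < z.im → Θ z = Δt z := by
    intro z hz hzt
    have h0 : ¬ z.im ≤ 0 := by rw [not_le]; linarith
    by_cases h : z.im < Real.pi
    · simp only [hΘ, h0, if_false, h, if_true]
      exact (het ⟨hzt, h⟩).symm
    · simp [hΘ, h0, h]
  have hΘm : ∀ z, 0 < z.im → z.im < Real.pi → Θ z = Δ z := by
    intro z h1 h2
    simp [hΘ, h1.not_ge, h2]
  have hcont : ContinuousOn Θ C := by
    intro z hz
    by_cases h0 : z.im = 0
    · have hzb : z ∈ hstrip (-b) b := by simp [hstrip, h0, hb]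
      have hn := (isOpen_hstrip (-b) b).mem_nhds hzb
      refine ((hdb.differentiableAt hn).continuousAt.continuousWithinAt).congr_of_eventuallyEq ?_
        (hΘb z hz (by rw [h0]; exact hb))
      filter_upwards [self_mem_nhdsWithin, nhdsWithin_le_nhds hn] with w hw hw2
      exact hΘb w hw hw2.2
    by_cases h1 : z.im = Real.pi
    · have hzt : z ∈ hstrip (Real.pi - t) (Real.pi + t) := by simp [hstrip, h1, ht]
      have hn := (isOpen_hstrip (Real.pi - t) (Real.pi + t)).mem_nhds hzt
      refine ((hdt.differentiableAt hn).continuousAt.continuousWithinAt).congr_of_eventuallyEq ?_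
        (hΘt z hz (by rw [h1]; linarith))
      filter_upwards [self_mem_nhdsWithin, nhdsWithin_le_nhds hn] with w hw hw2
      exact hΘt w hw hw2.1
    · have hzm : z ∈ hstrip 0 Real.pi :=
        ⟨lt_of_le_of_ne hz.1 (Ne.symm h0), lt_of_le_of_ne hz.2 h1⟩
      have hn := (isOpen_hstrip 0 Real.pi).mem_nhds hzm
      refine ((hd.differentiableAt hn).continuousAt.continuousWithinAt).congr_of_eventuallyEq ?_
        (hΘm z hzm.1 hzm.2)
      filter_upwards [nhdsWithin_le_nhds hn] with w hw using hΘm w hw.1 hw.2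
  have hper : ∀ z ∈ C, Θ (z + T) = Θ z := by
    intro z hz
    have him : (z + T).im = z.im := by simp
    simp only [hΘ, him]
    split_ifs with h0 h1
    · exact hpb z
    · exact hp z ⟨not_le.1 h0, h1⟩
    · exact hpt z
  have hperZ : ∀ (n : ℤ), ∀ z ∈ C, Θ (z + n * T) = Θ z := by
    have hmem : ∀ (n : ℤ), ∀ z ∈ C, z + n * T ∈ C := fun n z hz => by simpa [hC] using hz
    intro n z hz
    induction n using Int.induction_on with
    | zero => simp
    | succ k ih =>
      rw [← ih, ← hper _ (hmem k z hz)]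
      congr 1; push_cast; ring
    | pred k ih =>
      rw [← ih, ← hper _ (hmem (-k - 1) z hz)]
      congr 1; push_cast; ring
  have hK : IsCompact (Set.Icc 0 T ×ℂ Set.Icc 0 Real.pi) := isCompact_Icc.reProdIm isCompact_Icc
  have hKC : Set.Icc 0 T ×ℂ Set.Icc 0 Real.pi ⊆ C := fun z hz => (Complex.mem_reProdIm.1 hz).2
  obtain ⟨p, hpK, hpmax⟩ := hK.exists_isMaxOn
    ⟨0, by rw [Complex.mem_reProdIm]; simp [hT.le, hpi.le]⟩ (hcont.mono hKC).norm
  have hmaxC : ∀ z ∈ C, ‖Θ z‖ ≤ ‖Θ p‖ := by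
    intro z hz
    have h1 := Int.floor_le (z.re / T)
    have h2 := Int.lt_floor_add_one (z.re / T)
    rw [le_div_iff₀ hT] at h1
    rw [div_lt_iff₀ hT] at h2
    rw [← hperZ (-⌊z.re / T⌋) z hz]
    refine hpmax ?_
    rw [Complex.mem_reProdIm]
    simp
    exact ⟨⟨by linarith, by linarith⟩, hz⟩
  have hpC := hKC hpK
  have hzero : Θ p = 0 := by
    by_cases h0 : p.im = 0
    · have hpb : p ∈ hstrip (-b) b := by simp [hstrip, h0, hb]
      have e := hΘb p hpC (by rw [h0]; exact hb)
      rw [e]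
      refine eq_zero_of_isMaxOn_hstrip hb hdb (fun z hz => ⟨by linarith [hz.1], hz.2⟩) heb
        (fun z hz => hanti z ⟨hz.1, hz.2.trans_le hbπ⟩) hpb fun z hz => ?_
      simp only [Function.comp, Set.mem_ofPred_eq]
      rw [← e]
      rcases le_total 0 z.im with h | h
      · have hzC : z ∈ C := ⟨h, hz.2.le.trans hbπ⟩
        rw [← hΘb z hzC hz.2]
        exact hmaxC z hzC
      · have hzC : conj z ∈ C := by
          simp only [hC, Set.mem_ofPred_eq, Complex.conj_im]
          exact ⟨by linarith, by linarith [hz.1]⟩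
        rw [← hsb, ← hΘb _ hzC (by rw [Complex.conj_im]; linarith [hz.1])]
        exact hmaxC _ hzC
    by_cases h1 : p.im = Real.pi
    · have hpt : p ∈ hstrip (Real.pi - t) (Real.pi + t) := by simp [hstrip, h1, ht]
      have e := hΘt p hpC (by rw [h1]; linarith)
      rw [e]
      refine eq_zero_of_isMaxOn_hstrip (by linarith) hdt
        (fun z hz => ⟨hz.1, by linarith [hz.2]⟩) het
        (fun z hz => hanti z ⟨by linarith [hz.1], hz.2⟩) hpt fun z hz => ?_
      simp only [Function.comp, Set.mem_ofPred_eq]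
      rw [← e]
      rcases le_total z.im Real.pi with h | h
      · have hzC : z ∈ C := ⟨by linarith [hz.1], h⟩
        rw [← hΘt z hzC hz.1]
        exact hmaxC z hzC
      · have him : (conj z + 2 * Real.pi * Complex.I).im = 2 * Real.pi - z.im := by simp; ring
        have hzC : conj z + 2 * Real.pi * Complex.I ∈ C := by
          simp only [hC, Set.mem_ofPred_eq, him]
          exact ⟨by linarith [hz.2], by linarith⟩
        rw [← hst, ← hΘt _ hzC (by rw [him]; linarith [hz.2])]
        exact hmaxC _ hzC
    · have hpm : p ∈ hstrip 0 Real.pi :=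
        ⟨lt_of_le_of_ne hpC.1 (Ne.symm h0), lt_of_le_of_ne hpC.2 h1⟩
      have e := hΘm p hpm.1 hpm.2
      rw [e]
      refine eq_zero_of_isMaxOn_hstrip hpi hd subset_rfl (fun z _ => rfl) hanti hpm fun z hz => ?_
      simp only [Function.comp, Set.mem_ofPred_eq]
      rw [← e, ← hΘm z hz.1 hz.2]
      exact hmaxC z ⟨hz.1.le, hz.2.le⟩
  intro z hz
  have := hmaxC z ⟨hz.1.le, hz.2.le⟩
  rw [hzero, norm_zero, hΘm z hz.1 hz.2] at this
  exact norm_le_zero_iff.1 this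

/-! ### Uniform boundary behaviour -/

lemma continuous_toCyl : Continuous toCyl := by
  unfold toCyl
  exact (continuous_quotient_mk'.comp Complex.continuous_re).prodMk Complex.continuous_im

lemma isOpenMap_toCyl : IsOpenMap toCyl := by
  have h1 : IsOpenMap ((↑) : ℝ → AddCircle (1 : ℝ)) := QuotientAddGroup.isOpenMap_coe
  have h2 := (h1.prodMap (IsOpenMap.id (X := ℝ))).comp
    Complex.equivRealProdCLM.toHomeomorph.isOpenMap
  exact h2

lemma surjective_toCyl : Function.Surjective toCyl := by
  rintro ⟨x, y⟩
  obtain ⟨x, rfl⟩ := QuotientAddGroup.mk_surjective x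
  exact ⟨⟨x, y⟩, rfl⟩

lemma toCyl_eq_iff {z w : ℂ} : toCyl z = toCyl w ↔ ∃ k : ℤ, z = w + k := by
  have h : ((z.re : AddCircle (1 : ℝ)) = w.re) ↔ ∃ k : ℤ, z.re = w.re + k := by
    rw [← sub_eq_zero, ← AddCircle.coe_sub, AddCircle.coe_eq_zero_iff]
    refine exists_congr fun k => ?_
    simp only [zsmul_eq_mul, mul_one]
    constructor <;> intro h <;> linarith
  rw [toCyl, toCyl, Prod.mk.injEq, h]
  constructor
  · rintro ⟨⟨k, hk⟩, him⟩
    exact ⟨k, Complex.ext (by simpa using hk) (by simpa using him)⟩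
  · rintro ⟨k, rfl⟩
    exact ⟨⟨k, by simp⟩, by simp⟩

/-- Near `B` the function `|h|` descends to the cylinder even though `h` does not. Pointwise limits
then give one neighbourhood of all of `B`, the form in which the uniformization meets the boundary.
-/
lemma eventually_abs_lt_of_tendsto_nhdsSet {D : CylindricalDomain} {B V : Set Cyl} (hV : IsOpen V)
    (hBV : B ⊆ V) {h : ℂ → ℝ} (hinv : ∀ z ∈ D.lift, toCyl z ∈ V → |h (z + 1)| = |h z|)
    (hlim : ∀ ζ : ℂ, toCyl ζ ∈ B → Tendsto h (𝓝[D.lift] ζ) (𝓝 0)) {ε : ℝ} (hε : 0 < ε) :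
    ∀ᶠ p in 𝓝ˢ B, p ∈ V ∧ ∀ z ∈ D.lift, toCyl z = p → |h z| < ε := by
  rw [eventually_nhdsSet_iff_forall]
  intro p hp
  obtain ⟨ζ, rfl⟩ := surjective_toCyl p
  have h1 : ∀ᶠ z in 𝓝 ζ, z ∈ D.lift → |h z| < ε := by
    rw [← eventually_nhdsWithin_iff]
    filter_upwards [(hlim ζ hp).eventually (Metric.ball_mem_nhds 0 hε)] with z hz
    simpa using hz
  have h2 : ∀ᶠ z in 𝓝 ζ, toCyl z ∈ V :=
    continuous_toCyl.continuousAt.eventually (hV.mem_nhds (hBV hp))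
  have h3 := isOpenMap_toCyl.image_mem_nhds (h1.and h2)
  filter_upwards [h3] with q hq
  obtain ⟨w, ⟨hw1, hw2⟩, rfl⟩ := hq
  refine ⟨hw2, fun z hz hzw => ?_⟩
  obtain ⟨k, rfl⟩ := toCyl_eq_iff.1 hzw
  have hwl : w ∈ D.lift := by
    have : toCyl (w + k) ∈ D.carrier := hz
    rwa [hzw] at this
  have hall : ∀ m : ℤ, |h (w + m)| = |h w| := by
    have hmem : ∀ m : ℤ, toCyl (w + m) = toCyl w := fun m => toCyl_eq_iff.2 ⟨m, rfl⟩
    have hstep : ∀ m : ℤ, |h (w + m + 1)| = |h (w + m)| := fun m =>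
      hinv _ (by rw [CylindricalDomain.lift, Set.mem_preimage, hmem m]; exact hwl)
        (by rw [hmem m]; exact hw2)
    intro m
    induction m using Int.induction_on with
    | zero => simp
    | succ k ih => rw [← ih, ← hstep k]; congr 2; push_cast; ring
    | pred k ih => rw [← ih, ← hstep (-k - 1)]; congr 2; push_cast; ring
  rw [hall]
  exact hw1 hwl

/-! ### Solutions of the boundary value problem in the coordinate of the straight cylinder -/

lemma isOpen_strip : IsOpen strip := isOpen_hstrip 0 Real.pi

lemma strip_add_int {z : ℂ} (hz : z ∈ strip) (m : ℤ) (ℓ : ℝ) : z + m * ℓ ∈ strip := by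
  simpa [strip] using hz

lemma strip_add_period {z : ℂ} (hz : z ∈ strip) (ℓ : ℝ) : z + ℓ ∈ strip := by
  simpa [strip] using hz

lemma notMem_lattice_of_im {ℓ : ℝ} {z : ℂ} (h0 : 0 < z.im) (h1 : z.im < 2 * Real.pi) :
    z ∉ lattice ℓ := by
  rintro ⟨m, n, rfl⟩
  have hpi := Real.pi_pos
  simp at h0 h1
  have h2 : (0 : ℝ) < n := by
    by_contra h
    nlinarith
  have h3 : (n : ℝ) < 1 := by nlinarith
  have h4 : (0 : ℤ) < n := by exact_mod_cast h2
  have h5 : n < (1 : ℤ) := by exact_mod_cast h3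
  omega

namespace CylindricalDomain

variable (D : CylindricalDomain)

lemma isOpen_lift : IsOpen D.lift := D.isOpen_carrier.preimage continuous_toCyl

variable {D}

lemma mem_puncturedLift_iff {z w : ℂ} :
    z ∈ D.puncturedLift w ↔ z ∈ D.lift ∧ toCyl z ≠ toCyl w := by
  rw [Ne, toCyl_eq_iff, not_exists]
  rfl

lemma isOpen_puncturedLift (w : ℂ) : IsOpen (D.puncturedLift w) := by
  have : D.puncturedLift w = D.lift ∩ toCyl ⁻¹' {toCyl w}ᶜ := by
    ext z; simp [mem_puncturedLift_iff]
  rw [this]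
  exact D.isOpen_lift.inter (isOpen_compl_singleton.preimage continuous_toCyl)

lemma notMem_bdryBot {p : Cyl} (hp : p ∈ D.carrier) : p ∉ D.bdryBot := fun h => by
  have h1 : p ∈ D.carrierᶜ := by
    rw [D.compl_carrier]; exact Or.inl (D.isClosed_lower.frontier_subset h)
  exact h1 hp

end CylindricalDomain

namespace Uniformization

variable {ℓ : ℝ} {D : CylindricalDomain} (Φ : Uniformization ℓ D)

lemma toFun_mem_lift {z : ℂ} (hz : z ∈ strip) : Φ.toFun z ∈ D.lift := by
  have : toCyl (Φ.toFun z) ∈ D.carrier := by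
    rw [← Φ.image_eq]; exact ⟨z, hz, rfl⟩
  exact this

lemma differentiableAt_toFun {z : ℂ} (hz : z ∈ strip) : DifferentiableAt ℂ Φ.toFun z :=
  Φ.holomorphic.differentiableAt (isOpen_strip.mem_nhds hz)

lemma hasDerivAt_toFun {z : ℂ} (hz : z ∈ strip) :
    HasDerivAt Φ.toFun (Complex.exp (Φ.logDeriv z)) z := by
  rw [Φ.exp_logDeriv z hz]
  exact (Φ.differentiableAt_toFun hz).hasDerivAt

lemma toFun_mem_puncturedLift {z z₁ : ℂ} (hz : z ∈ strip) (hz₁ : z₁ ∈ strip)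
    (h : z - z₁ ∉ lattice ℓ) : Φ.toFun z ∈ D.puncturedLift (Φ.toFun z₁) := by
  rw [CylindricalDomain.mem_puncturedLift_iff]
  refine ⟨Φ.toFun_mem_lift hz, fun heq => ?_⟩
  obtain ⟨m, hm⟩ := Φ.injective z hz z₁ hz₁ heq
  exact h ⟨m, 0, by rw [hm]; simp⟩

variable {Φ} {η w : ℂ} {f : ℂ → ℂ}

lemma bot_uniform (hf : IsSolution D η w f) (hw : w ∈ D.lift) {ε : ℝ} (hε : 0 < ε) :
    ∃ δ > 0, ∀ z ∈ strip, z.im < δ → |(f (Φ.toFun z)).re| ≤ ε := by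
  -- Antiperiodicity is available only off the pole, so the open set is the complement of that
  -- point.
  have h := eventually_abs_lt_of_tendsto_nhdsSet (D := D) (B := D.bdryBot) (V := {toCyl w}ᶜ)
    isOpen_compl_singleton (fun p hp hpw => CylindricalDomain.notMem_bdryBot (D := D)
      (show toCyl w ∈ D.carrier from hw) (by rwa [Set.mem_singleton_iff.1 hpw] at hp))
    (h := fun z => (f z).re) (fun z hz hzw => by
      rw [hf.antiperiodic z (CylindricalDomain.mem_puncturedLift_iff.2 ⟨hz, hzw⟩), Complex.neg_re,
        abs_neg]) hf.bot hε
  have h2 := Φ.tendsto_bot.eventually h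
  obtain ⟨δ, hδ, h3⟩ := ((nhdsGT_basis (0 : ℝ)).comap Complex.im).eventually_iff.1 h2
  exact ⟨δ, hδ, fun z hz hzδ => ((h3 ⟨hz.1, hzδ⟩).2 _ (Φ.toFun_mem_lift hz) rfl).le⟩

lemma top_uniform (hf : IsSolution D η w f) : ∃ b > 0, ∃ g : ℂ → ℂ,
    (∀ z ∈ strip, Real.pi - b < z.im →
      HasDerivAt g (f (Φ.toFun z)) (Φ.toFun z) ∧ g (Φ.toFun z + 1) = -g (Φ.toFun z)) ∧
    ∀ ε > 0, ∃ δ > 0, ∀ z ∈ strip, Real.pi - δ < z.im → |(g (Φ.toFun z)).im| ≤ ε := by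
  obtain ⟨V, hV, hBV, g, hg, hlim⟩ := hf.top
  have h := fun (ε : ℝ) (hε : 0 < ε) => eventually_abs_lt_of_tendsto_nhdsSet (D := D) hV hBV
    (h := fun z => (g z).im) (fun z hz hzV => by
      rw [(hg z hz hzV).2, Complex.neg_im, abs_neg]) hlim hε
  have h2 : ∀ ε > 0, ∃ δ > 0, ∀ z ∈ strip, Real.pi - δ < z.im →
      toCyl (Φ.toFun z) ∈ V ∧ |(g (Φ.toFun z)).im| ≤ ε := by
    intro ε hε
    obtain ⟨δ, hδ, h3⟩ := ((nhdsLT_basis Real.pi).comap Complex.im).eventually_iff.1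
      (Φ.tendsto_top.eventually (h ε hε))
    refine ⟨Real.pi - δ, sub_pos.2 hδ, fun z hz hzδ => ?_⟩
    have h4 := h3 (show z ∈ Complex.im ⁻¹' Set.Ioo δ Real.pi from ⟨by linarith, hz.2⟩)
    exact ⟨h4.1, (h4.2 _ (Φ.toFun_mem_lift hz) rfl).le⟩
  obtain ⟨b, hb, hb2⟩ := h2 1 one_pos
  refine ⟨b, hb, g, fun z hz hzb => hg _ (Φ.toFun_mem_lift hz) (hb2 z hz hzb).1, fun ε hε => ?_⟩
  obtain ⟨δ, hδ, h3⟩ := h2 ε hε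
  exact ⟨δ, hδ, fun z hz hzδ => (h3 z hz hzδ).2⟩

/-- Near the bottom boundary, a solution extends by reflection. -/
lemma exists_bot_extension (hℓ : 0 < ℓ) {z₁ : ℂ} (hz₁ : z₁ ∈ strip)
    (hf : IsSolution D η (Φ.toFun z₁) f) :
    ∃ G : ℂ → ℂ, DifferentiableOn ℂ G (hstrip (-z₁.im) z₁.im) ∧
      Set.EqOn G (fun z => f (Φ.toFun z)) (hstrip 0 z₁.im) ∧
      (∀ z, G (z + (2 * ℓ : ℝ)) = G z) ∧ ∀ z, G (conj z) = -conj (G z) := by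
  have hmem : ∀ z ∈ hstrip 0 z₁.im, z ∈ strip ∧ z - z₁ ∉ lattice ℓ := by
    intro z hz
    refine ⟨⟨hz.1, hz.2.trans hz₁.2⟩, fun h => ?_⟩
    refine notMem_lattice_of_im ?_ ?_ (neg_mem h)
    · simpa using hz.2
    · simp
      linarith [hz.1, hz₁.2, Real.pi_pos]
  -- Below height `Im z₁` there is no pole; antiperiodicity gives the period `2 * ℓ`.
  refine schwarz_reflection (by positivity) hz₁.1 ?_ ?_ ?_
  · intro z hz
    obtain ⟨hzs, hzl⟩ := hmem z hz
    have hd := hf.holomorphic.differentiableAt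
      ((CylindricalDomain.isOpen_puncturedLift _).mem_nhds
        (Φ.toFun_mem_puncturedLift hzs hz₁ hzl))
    exact (DifferentiableAt.comp z hd (Φ.differentiableAt_toFun hzs)).differentiableWithinAt
  · intro z hz
    have hanti : ∀ z ∈ hstrip 0 z₁.im, f (Φ.toFun (z + ℓ)) = -f (Φ.toFun z) := fun z hz => by
      obtain ⟨hzs, hzl⟩ := hmem z hz
      rw [Φ.map_add_period z hzs, hf.antiperiodic _ (Φ.toFun_mem_puncturedLift hzs hz₁ hzl)]
    rw [show z + (2 * ℓ : ℝ) = z + ℓ + ℓ by push_cast; ring, hanti _ (hstrip_add_period hz ℓ),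
      hanti z hz, neg_neg]
  · intro ε hε
    obtain ⟨δ, hδ, h⟩ := bot_uniform (Φ := Φ) hf (Φ.toFun_mem_lift hz₁) hε
    exact ⟨δ, hδ, fun z hz hzδ => h z (hmem z hz).1 hzδ⟩

/-- Near the top boundary, a solution, as a differential, extends by reflection. -/
lemma exists_top_extension (hℓ : 0 < ℓ) (hf : IsSolution D η w f) {b₀ : ℝ} (hb₀ : 0 < b₀)
    (hb₀π : b₀ ≤ Real.pi) :
    ∃ b > 0, b ≤ b₀ ∧ ∃ G : ℂ → ℂ, DifferentiableOn ℂ G (hstrip (Real.pi - b) (Real.pi + b)) ∧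
      Set.EqOn G (fun z => f (Φ.toFun z) * Complex.exp (Φ.logDeriv z))
        (hstrip (Real.pi - b) Real.pi) ∧
      (∀ z, G (z + (2 * ℓ : ℝ)) = G z) ∧
      ∀ z, G (conj z + 2 * Real.pi * Complex.I) = conj (G z) := by
  obtain ⟨b₁, hb₁, g, hg, hlim⟩ := top_uniform (Φ := Φ) hf
  have hpi := Real.pi_pos
  set b := min b₁ b₀ with hb
  have hb0 : 0 < b := lt_min hb₁ hb₀
  have hbb₁ : b ≤ b₁ := min_le_left _ _
  have hbb₀ : b ≤ b₀ := min_le_right _ _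
  have him : ∀ u : ℂ, (Real.pi * Complex.I - u).im = Real.pi - u.im := fun u => by simp
  have hmem : ∀ u ∈ hstrip 0 b, Real.pi * Complex.I - u ∈ strip := fun u hu => by
    rw [strip, Set.mem_ofPred_eq, him]
    exact ⟨by linarith [hu.2], by linarith [hu.1]⟩
  have hlt : ∀ u ∈ hstrip 0 b, Real.pi - b₁ < (Real.pi * Complex.I - u).im := fun u hu => by
    rw [him]; linarith [hu.2]
  have hderiv : ∀ z ∈ strip, Real.pi - b₁ < z.im → HasDerivAt (fun z => g (Φ.toFun z))
      (f (Φ.toFun z) * Complex.exp (Φ.logDeriv z)) z := fun z hz hzb =>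
    (hg z hz hzb).1.comp z (Φ.hasDerivAt_toFun hz)
  -- The substitution `u = πi - z` moves the top line to the bottom, and the factor `i` turns the
  -- imaginary part of the primitive into a real part up to sign. The primitive is reflected first
  -- and differentiated afterwards.
  obtain ⟨G, hGd, hGe, hGp, hGs⟩ := schwarz_reflection (p := 2 * ℓ) (b := b)
    (F := fun u => Complex.I * g (Φ.toFun (Real.pi * Complex.I - u))) (by positivity) hb0 (by
      intro u hu
      refine DifferentiableAt.differentiableWithinAt (DifferentiableAt.const_mul ?_ _)
      exact DifferentiableAt.comp (f := fun u => Real.pi * Complex.I - u) u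
        (hderiv _ (hmem u hu) (hlt u hu)).differentiableAt (by fun_prop)) (by
      have hanti : ∀ z ∈ strip, Real.pi - b₁ < z.im → g (Φ.toFun (z - ℓ)) = -g (Φ.toFun z) := by
        intro z hz hzb
        have hz' : z - ℓ ∈ strip := by
          simpa [sub_eq_add_neg] using strip_add_period hz (-ℓ)
        have h1 := Φ.map_add_period _ hz'
        have h2 := (hg _ hz' (by simpa using hzb)).2
        rw [← h1, sub_add_cancel] at h2
        rw [h2, neg_neg]
      intro u hu
      have h1 := hanti _ (hmem u hu) (hlt u hu)
      have h2 := hanti _ (hmem _ (hstrip_add_period hu ℓ)) (hlt _ (hstrip_add_period hu ℓ))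
      rw [show Real.pi * Complex.I - (u + (2 * ℓ : ℝ)) = Real.pi * Complex.I - (u + ℓ) - ℓ by
        push_cast; ring, h2, show Real.pi * Complex.I - (u + ℓ) = Real.pi * Complex.I - u - ℓ by
        ring, h1, neg_neg]) (by
      intro ε hε
      obtain ⟨δ, hδ, h⟩ := hlim ε hε
      refine ⟨δ, hδ, fun u hu huδ => ?_⟩
      have := h _ (hmem u hu) (by rw [him]; linarith)
      simpa using this)
  set H : ℂ → ℂ := fun z => -Complex.I * G (Real.pi * Complex.I - z) with hH
  have hHd : DifferentiableOn ℂ H (hstrip (Real.pi - b) (Real.pi + b)) := by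
    refine DifferentiableOn.const_mul ?_ _
    refine hGd.comp (by fun_prop) fun z hz => ?_
    rw [hstrip, Set.mem_ofPred_eq, him]
    exact ⟨by linarith [hz.2], by linarith [hz.1]⟩
  have hHs : ∀ z, H z = conj (H (conj z + 2 * Real.pi * Complex.I)) := fun z => by
    simp only [hH]
    rw [show Real.pi * Complex.I - (conj z + 2 * Real.pi * Complex.I) =
      conj (Real.pi * Complex.I - z) by simp; ring, hGs]
    simp
  refine ⟨b, hb0, hbb₀, deriv H, hHd.deriv (isOpen_hstrip _ _), ?_, fun z => ?_, fun z => ?_⟩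
  · intro z hz
    have hzs : z ∈ strip := ⟨by linarith [hz.1], hz.2⟩
    have hd := hderiv z hzs (by linarith [hz.1])
    refine (hd.congr_of_eventuallyEq ?_).deriv
    filter_upwards [(isOpen_hstrip _ _).mem_nhds hz] with v hv
    simp only [hH]
    rw [hGe (show Real.pi * Complex.I - v ∈ hstrip 0 b by
      rw [hstrip, Set.mem_ofPred_eq, him]
      exact ⟨by linarith [hv.2], by linarith [hv.1]⟩)]
    simp only [sub_sub_cancel]
    linear_combination (-g (Φ.toFun v)) * Complex.I_mul_I
  · rw [← deriv_comp_add_const]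
    congr 1
    funext v
    simp only [hH]
    rw [← hGp (Real.pi * Complex.I - (v + (2 * ℓ : ℝ)))]
    congr 2; ring
  · have h1 : H = conj ∘ (fun z => H (z + 2 * Real.pi * Complex.I)) ∘ conj := funext hHs
    have h2 := congrFun (deriv_conj_conj (𝕜 := ℂ) (f := fun z => H (z + 2 * Real.pi * Complex.I))) z
    rw [← h1, Function.comp_apply, Function.comp_apply, deriv_comp_add_const] at h2
    rw [h2, Complex.conj_conj]

end Uniformization

/-! ### The explicit form of the solutions -/

lemma RemovableAt.tendsto {h : ℂ → ℂ} {p : ℂ} (hp : RemovableAt h p) :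
    Tendsto h (𝓝[≠] p) (𝓝 (removed h p)) := by
  refine (hp.differentiableAt_removed.continuousAt.tendsto.mono_left nhdsWithin_le_nhds).congr' ?_
  filter_upwards [hp.1] with z hz using removed_eq hz.continuousAt

/-- The combination of two Szegő kernels with poles at `z₁` and `z̄₁` that is imaginary on the
real line. -/
def reflectedKernel (S : ℂ → ℂ) (A z₁ z : ℂ) : ℂ := A * S (z - z₁) - conj A * S (z - conj z₁)

section reflectedKernel

variable {ℓ : ℝ} {c : ℂ} {S : ℂ → ℂ}

lemma reflectedKernel_conj (hS : IsSzego ℓ c S) (A z₁ z : ℂ) :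
    reflectedKernel S A z₁ (conj z) = -conj (reflectedKernel S A z₁ z) := by
  simp only [reflectedKernel, map_sub, map_mul, hS.conj_apply, Complex.conj_conj]
  ring

/-- Reflection in the top line sends the pole `z₁` to `z̄₁ + 2πi`; the quasi-period brings it back
to `z̄₁` at the cost of a factor `c`. -/
lemma reflectedKernel_conj_add (hS : IsSzego ℓ c S) (A z₁ z : ℂ) :
    c * conj (reflectedKernel S A z₁ (conj z + 2 * Real.pi * Complex.I)) =
      -reflectedKernel S A z₁ z := by
  simp only [reflectedKernel, map_sub, map_mul, hS.conj_apply, Complex.conj_conj, map_add,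
    Complex.conj_I, Complex.conj_ofReal, map_ofNat]
  have h1 := hS.add_two_pi_I (z + 2 * Real.pi * -Complex.I - z₁)
  have h2 := hS.add_two_pi_I (z + 2 * Real.pi * -Complex.I - conj z₁)
  rw [show z + 2 * Real.pi * -Complex.I - z₁ + 2 * Real.pi * Complex.I = z - z₁ by ring] at h1
  rw [show z + 2 * Real.pi * -Complex.I - conj z₁ + 2 * Real.pi * Complex.I = z - conj z₁ by
    ring] at h2
  rw [h1, h2]; ring

lemma reflectedKernel_add_period (hS : IsSzego ℓ c S) (A z₁ z : ℂ) :
    reflectedKernel S A z₁ (z + ℓ) = -reflectedKernel S A z₁ z := by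
  simp only [reflectedKernel, add_sub_right_comm, hS.add_period]
  ring

lemma reflectedKernel_add_two_mul_period (hS : IsSzego ℓ c S) (A z₁ z : ℂ) :
    reflectedKernel S A z₁ (z + (2 * ℓ : ℝ)) = reflectedKernel S A z₁ z := by
  rw [show z + (2 * ℓ : ℝ) = z + ℓ + ℓ by push_cast; ring, reflectedKernel_add_period hS,
    reflectedKernel_add_period hS, neg_neg]

lemma differentiableAt_reflectedKernel (hS : IsSzego ℓ c S) {A z₁ z : ℂ} (h1 : z - z₁ ∉ lattice ℓ)
    (h2 : z - conj z₁ ∉ lattice ℓ) : DifferentiableAt ℂ (reflectedKernel S A z₁) z :=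
  ((DifferentiableAt.comp z (hS.differentiableAt _ h1) (by fun_prop)).const_mul A).sub
    ((DifferentiableAt.comp z (hS.differentiableAt _ h2) (by fun_prop)).const_mul (conj A))

end reflectedKernel

lemma exists_eq_add_of_sub_mem_lattice {ℓ : ℝ} {z w : ℂ} (hz : z ∈ strip) (hw : w ∈ strip)
    (h : z - w ∈ lattice ℓ) : ∃ m : ℤ, z = w + m * ℓ := by
  obtain ⟨m, n, hmn⟩ := h
  have hn : n = 0 := by
    by_contra hn
    have him := congrArg Complex.im hmn
    simp at him
    have h1 : |(n : ℝ) * (2 * Real.pi)| < Real.pi := by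
      rw [← him, abs_lt]
      constructor <;> linarith [hz.1, hz.2, hw.1, hw.2]
    have h2 : (1 : ℝ) ≤ |(n : ℝ)| := by exact_mod_cast Int.one_le_abs hn
    rw [abs_mul, abs_of_pos (by positivity : 0 < 2 * Real.pi)] at h1
    nlinarith [Real.pi_pos]
  refine ⟨m, ?_⟩
  rw [hn] at hmn
  simp at hmn
  linear_combination hmn

lemma sub_conj_notMem_lattice {ℓ : ℝ} {z z₁ : ℂ} (hz : z ∈ strip) (hz₁ : z₁ ∈ strip) :
    z - conj z₁ ∉ lattice ℓ := by
  refine notMem_lattice_of_im ?_ ?_ <;> simp <;> linarith [hz.1, hz.2, hz₁.1, hz₁.2]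

namespace Uniformization

variable {ℓ : ℝ} {D : CylindricalDomain} {Φ : Uniformization ℓ D} {η : ℂ} {f : ℂ → ℂ}

/-- The difference of a solution, in the gauge `W`, and a candidate for its explicit form. -/
def discrepancy (Φ : Uniformization ℓ D) (f W S : ℂ → ℂ) (A z₁ z : ℂ) : ℂ :=
  f (Φ.toFun z) * Complex.exp (W z) - reflectedKernel S A z₁ z

variable {W V : ℂ → ℂ} {α : ℝ} {c : ℂ} {S : ℂ → ℂ} {z₁ : ℂ}

lemma differentiableAt_comp_toFun (hz₁ : z₁ ∈ strip) (hf : IsSolution D η (Φ.toFun z₁) f) {z : ℂ}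
    (hz : z ∈ strip) (h : z - z₁ ∉ lattice ℓ) :
    DifferentiableAt ℂ (fun z => f (Φ.toFun z)) z :=
  DifferentiableAt.comp z (hf.holomorphic.differentiableAt
    ((CylindricalDomain.isOpen_puncturedLift _).mem_nhds (Φ.toFun_mem_puncturedLift hz hz₁ h)))
    (Φ.differentiableAt_toFun hz)

lemma differentiableAt_gauge (hW : IsGauge ℓ Φ.logDeriv W V α) {z : ℂ} (hz : z ∈ strip) :
    DifferentiableAt ℂ W z :=
  hW.differentiableOn_bot.differentiableAt ((isOpen_hstrip _ _).mem_nhds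
    ⟨by linarith [hz.1, Real.pi_pos], hz.2⟩)

lemma differentiableAt_discrepancy (hW : IsGauge ℓ Φ.logDeriv W V α) (hS : IsSzego ℓ c S) (A : ℂ)
    (hz₁ : z₁ ∈ strip) (hf : IsSolution D η (Φ.toFun z₁) f) {z : ℂ} (hz : z ∈ strip)
    (h : z - z₁ ∉ lattice ℓ) : DifferentiableAt ℂ (discrepancy Φ f W S A z₁) z :=
  ((differentiableAt_comp_toFun hz₁ hf hz h).mul (differentiableAt_gauge hW hz).cexp).sub
    (differentiableAt_reflectedKernel hS h (sub_conj_notMem_lattice hz hz₁))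

lemma discrepancy_add_period (hW : IsGauge ℓ Φ.logDeriv W V α) (hS : IsSzego ℓ c S) (A : ℂ)
    (hz₁ : z₁ ∈ strip) (hf : IsSolution D η (Φ.toFun z₁) f) {z : ℂ} (hz : z ∈ strip)
    (h : z - z₁ ∉ lattice ℓ) :
    discrepancy Φ f W S A z₁ (z + ℓ) = -discrepancy Φ f W S A z₁ z := by
  rw [discrepancy, discrepancy, Φ.map_add_period z hz,
    hf.antiperiodic _ (Φ.toFun_mem_puncturedLift hz hz₁ h), hW.add_period_bot,
    reflectedKernel_add_period hS]
  ring

lemma eventually_strip_and_notMem (hℓ : 0 < ℓ) {p : ℂ} (hp : p ∈ strip) (z₁ : ℂ) :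
    ∀ᶠ z in 𝓝[≠] p, z ∈ strip ∧ z - z₁ ∉ lattice ℓ := by
  have ht : Tendsto (fun z => z - z₁) (𝓝[≠] p) (𝓝[≠] (p - z₁)) := by
    simpa [sub_eq_add_neg] using tendsto_affine_punctured one_ne_zero (-z₁) p
  filter_upwards [nhdsWithin_le_nhds (isOpen_strip.mem_nhds hp),
    ht.eventually (eventually_notMem_lattice hℓ _)] with z h1 h2 using ⟨h1, h2⟩

/-- In the coordinate of the strip the residue `(πi)⁻¹ η̄` is divided by `φ'(z₁)` and multiplied by
`exp (W z₁)`, which explains the coefficient. The difference quotient `dslope` makes this exact up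
to a bounded term. -/
lemma removableAt_discrepancy_self (hℓ : 0 < ℓ) (hW : IsGauge ℓ Φ.logDeriv W V α)
    (hS : IsSzego ℓ c S) (hz₁ : z₁ ∈ strip) (hf : IsSolution D η (Φ.toFun z₁) f) :
    RemovableAt (discrepancy Φ f W S
      (1 / (Real.pi * Complex.I) * conj η * Complex.exp (W z₁ - Φ.logDeriv z₁)) z₁) z₁ := by
  set κ : ℂ := 1 / (Real.pi * Complex.I) * conj η with hκ
  set A := κ * Complex.exp (W z₁ - Φ.logDeriv z₁) with hA
  have hstr := isOpen_strip.mem_nhds hz₁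
  have hev := eventually_strip_and_notMem hℓ hz₁ z₁
  have hWd : ∀ᶠ z in 𝓝 z₁, DifferentiableAt ℂ (fun z => Complex.exp (W z)) z := by
    filter_upwards [hstr] with z hz using (differentiableAt_gauge hW hz).cexp
  have hne : ∀ᶠ z in 𝓝[≠] z₁, Φ.toFun z ≠ Φ.toFun z₁ := by
    filter_upwards [hev] with z hz heq
    have := (CylindricalDomain.mem_puncturedLift_iff.1
      (Φ.toFun_mem_puncturedLift hz.1 hz₁ hz.2)).2
    exact this (by rw [heq])
  have hφ : Tendsto Φ.toFun (𝓝[≠] z₁) (𝓝[≠] (Φ.toFun z₁)) :=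
    tendsto_nhdsWithin_iff.2 ⟨(Φ.differentiableAt_toFun hz₁).continuousAt.tendsto.mono_left
      nhdsWithin_le_nhds, hne⟩
  have e1 : RemovableAt (fun z => f (Φ.toFun z) - κ / (Φ.toFun z - Φ.toFun z₁)) z₁ := by
    refine ⟨?_, (hf.singularity.comp_tendsto hφ).congr_left fun z => ?_⟩
    · filter_upwards [hev, hne] with z hz hz2
      exact (differentiableAt_comp_toFun hz₁ hf hz.1 hz.2).sub
        ((differentiableAt_const _).div ((Φ.differentiableAt_toFun hz.1).sub_const _)
          (sub_ne_zero.2 hz2))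
    · simp only [Function.comp, hκ]; ring
  have e2 : RemovableAt (fun z => (κ * Complex.exp (W z) / dslope Φ.toFun z₁ z - A) / (z - z₁))
      z₁ := by
    have hds : DifferentiableOn ℂ (dslope Φ.toFun z₁) strip :=
      (Complex.differentiableOn_dslope hstr).2 Φ.holomorphic
    have hds0 : dslope Φ.toFun z₁ z₁ = Complex.exp (Φ.logDeriv z₁) := by
      rw [dslope_same, Φ.exp_logDeriv z₁ hz₁]
    have hdne : ∀ᶠ z in 𝓝 z₁, dslope Φ.toFun z₁ z ≠ 0 :=
      (hds.differentiableAt hstr).continuousAt.eventually_ne (by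
        rw [hds0]; exact Complex.exp_ne_zero _)
    apply RemovableAt.div_sub
    · filter_upwards [hstr, hdne, hWd] with z h1 h2 h3
      exact ((h3.const_mul κ).div (hds.differentiableAt (isOpen_strip.mem_nhds h1)) h2).sub_const A
    · rw [hds0, hA, Complex.exp_sub]; ring
  have e3 : RemovableAt (fun z => S (1 * z + -z₁) - 1 / (1 * z + -z₁)) z₁ :=
    RemovableAt.comp_affine (h := fun z => S z - 1 / z) one_ne_zero
      (by simpa using hS.removableAt_sub_inv hℓ)
  have e4 : RemovableAt (fun z => S (z - conj z₁)) z₁ := by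
    apply RemovableAt.of_differentiableAt
    filter_upwards [hstr] with z hz
    exact DifferentiableAt.comp z (hS.differentiableAt _ (sub_conj_notMem_lattice hz hz₁))
      (by fun_prop)
  have hc : ∀ a : ℂ, RemovableAt (fun _ => a) z₁ := fun a =>
    RemovableAt.of_differentiableAt (Eventually.of_forall fun _ => differentiableAt_const a)
  refine ((((e1.mul (RemovableAt.of_differentiableAt hWd)).add e2).sub ((hc A).mul e3)).add
    ((hc (conj A)).mul e4)).congr ?_
  filter_upwards [hne, self_mem_nhdsWithin] with z hz hz2
  have hz2' : z - z₁ ≠ 0 := sub_ne_zero.2 hz2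
  have hz' : Φ.toFun z - Φ.toFun z₁ ≠ 0 := sub_ne_zero.2 hz
  rw [discrepancy, reflectedKernel, dslope_of_ne _ hz2, slope_def_field,
    show 1 * z + -z₁ = z - z₁ by ring]
  field_simp
  ring

/-- Antiperiodicity carries removability from `z₁` to every translate `z₁ + mℓ`; the reflected pole
lies outside the strip. -/
lemma removableAt_discrepancy (hℓ : 0 < ℓ) (hW : IsGauge ℓ Φ.logDeriv W V α)
    (hS : IsSzego ℓ c S) (hz₁ : z₁ ∈ strip) (hf : IsSolution D η (Φ.toFun z₁) f) {p : ℂ}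
    (hp : p ∈ strip) :
    RemovableAt (discrepancy Φ f W S
      (1 / (Real.pi * Complex.I) * conj η * Complex.exp (W z₁ - Φ.logDeriv z₁)) z₁) p := by
  set A := 1 / (Real.pi * Complex.I) * conj η * Complex.exp (W z₁ - Φ.logDeriv z₁)
  set h := discrepancy Φ f W S A z₁ with hh
  by_cases hpl : p - z₁ ∈ lattice ℓ
  · have hiff : ∀ q ∈ strip, RemovableAt h q ↔ RemovableAt h (q + ℓ) := by
      intro q hq
      constructor
      · intro hr
        have h1 := RemovableAt.comp_affine (h := h) one_ne_zero (b := -ℓ) (p := q + ℓ)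
          (by simpa using hr)
        have h2 := ((RemovableAt.of_differentiableAt (p := q + ℓ) (Eventually.of_forall fun _ =>
          differentiableAt_const (0 : ℂ)))).sub h1
        refine h2.congr ?_
        filter_upwards [eventually_strip_and_notMem hℓ (strip_add_period hq ℓ) z₁] with z hz
        have hz' : z - ℓ ∈ strip := by simpa [sub_eq_add_neg] using strip_add_period hz.1 (-ℓ)
        have := discrepancy_add_period hW hS A hz₁ hf hz' (fun hl => hz.2 (by
          have := add_mem hl (period_mem_lattice ℓ)
          rwa [show z - ℓ - z₁ + ℓ = z - z₁ by ring] at this))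
        rw [sub_add_cancel, ← hh] at this
        rw [this, zero_sub, one_mul, sub_eq_add_neg]
      · intro hr
        have h1 := RemovableAt.comp_affine (h := h) one_ne_zero (b := ℓ) (p := q)
          (by simpa using hr)
        have h2 := ((RemovableAt.of_differentiableAt (p := q) (Eventually.of_forall fun _ =>
          differentiableAt_const (0 : ℂ)))).sub h1
        refine h2.congr ?_
        filter_upwards [eventually_strip_and_notMem hℓ hq z₁] with z hz
        have := discrepancy_add_period hW hS A hz₁ hf hz.1 hz.2
        rw [← hh] at this
        rw [zero_sub, one_mul, this, neg_neg]
    have hall : ∀ m : ℤ, RemovableAt h (z₁ + m * ℓ) := by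
      intro m
      induction m using Int.induction_on with
      | zero =>
        have := removableAt_discrepancy_self hℓ hW hS hz₁ hf
        rwa [Int.cast_zero, zero_mul, add_zero]
      | succ k ih =>
        have := (hiff _ (strip_add_int hz₁ k ℓ)).1 ih
        convert this using 1
        push_cast; ring
      | pred k ih =>
        refine (hiff _ (strip_add_int hz₁ (-k - 1) ℓ)).2 ?_
        convert ih using 1
        push_cast; ring
    obtain ⟨m, rfl⟩ := exists_eq_add_of_sub_mem_lattice hp hz₁ hpl
    exact hall m
  · refine RemovableAt.of_differentiableAt ?_
    have hcont : ContinuousAt (fun z => z - z₁) p := by fun_prop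
    filter_upwards [isOpen_strip.mem_nhds hp,
      hcont.eventually ((isClosed_lattice hℓ).isOpen_compl.mem_nhds hpl)] with z h1 h2
    exact differentiableAt_discrepancy hW hS A hz₁ hf h1 h2

/-- The explicit form of the solutions of the boundary value problem. -/
theorem solution_eq (hℓ : 0 < ℓ) (hW : IsGauge ℓ Φ.logDeriv W V α)
    (hS : IsSzego ℓ (-Complex.exp (-(2 * α * Complex.I))) S) (hz₁ : z₁ ∈ strip)
    (hf : IsSolution D η (Φ.toFun z₁) f) {z : ℂ} (hz : z ∈ strip) (hzl : z - z₁ ∉ lattice ℓ) :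
    f (Φ.toFun z) * Complex.exp (W z) = reflectedKernel S
      (1 / (Real.pi * Complex.I) * conj η * Complex.exp (W z₁ - Φ.logDeriv z₁)) z₁ z := by
  have hpi := Real.pi_pos
  obtain ⟨hz₁0, hz₁π⟩ := id hz₁
  have hrem := fun p (hp : p ∈ strip) => removableAt_discrepancy hℓ hW hS hz₁ hf hp
  have hanti0 := fun p (hp : p ∈ strip) hl => discrepancy_add_period (z := p) hW hS
    (1 / (Real.pi * Complex.I) * conj η * Complex.exp (W z₁ - Φ.logDeriv z₁)) hz₁ hf hp hl
  have hdiff := fun p (hp : p ∈ strip) hl => differentiableAt_discrepancy (z := p) hW hS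
    (1 / (Real.pi * Complex.I) * conj η * Complex.exp (W z₁ - Φ.logDeriv z₁)) hz₁ hf hp hl
  set A := 1 / (Real.pi * Complex.I) * conj η * Complex.exp (W z₁ - Φ.logDeriv z₁)
  set h := discrepancy Φ f W S A z₁ with hh
  have hreg : ∀ z ∈ strip, z - z₁ ∉ lattice ℓ → removed h z = h z := fun z hz hl =>
    removed_eq (hdiff z hz hl).continuousAt
  have hanti : ∀ z ∈ hstrip 0 Real.pi, removed h (z + ℓ) = -removed h z := by
    intro z hz
    refine removed_eq_of_tendsto ?_
    have ht : Tendsto (fun w : ℂ => w - ℓ) (𝓝[≠] (z + ℓ)) (𝓝[≠] z) := by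
      simpa [sub_eq_add_neg] using tendsto_affine_punctured one_ne_zero (-(ℓ : ℂ)) (z + ℓ)
    refine ((hrem z hz).tendsto.neg.comp ht).congr' ?_
    filter_upwards [ht.eventually (eventually_strip_and_notMem hℓ hz z₁)] with w hw
    have := hanti0 _ hw.1 hw.2
    rw [sub_add_cancel] at this
    simp [this]
  have hbl : ∀ w ∈ hstrip (-z₁.im) z₁.im, w - z₁ ∉ lattice ℓ ∧ w - conj z₁ ∉ lattice ℓ := by
    intro w hw
    refine ⟨fun hl => notMem_lattice_of_im ?_ ?_ (neg_mem hl), notMem_lattice_of_im ?_ ?_⟩ <;>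
      simp <;> linarith [hw.1, hw.2]
  obtain ⟨G, hGd, hGe, hGp, hGs⟩ := exists_bot_extension (Φ := Φ) hℓ hz₁ hf
  -- The bound `π - Im z₁` keeps the strip around the top line clear of both `z₁` and `z̄₁ + 2πi`.
  obtain ⟨b, hb, hb₀, H, hHd, hHe, hHp, hHs⟩ := exists_top_extension (Φ := Φ) hℓ hf
    (b₀ := Real.pi - z₁.im) (by linarith) (by linarith)
  have htl : ∀ w ∈ hstrip (Real.pi - b) (Real.pi + b),
      w - z₁ ∉ lattice ℓ ∧ w - conj z₁ ∉ lattice ℓ := by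
    intro w hw
    refine ⟨notMem_lattice_of_im ?_ ?_, notMem_lattice_of_im ?_ ?_⟩ <;>
      simp <;> linarith [hw.1, hw.2]
  have key := eq_zero_of_reflections (ℓ := ℓ) (T := 2 * ℓ) (b := z₁.im) (t := b)
    (Δ := removed h) (Δb := fun w => G w * Complex.exp (W w) - reflectedKernel S A z₁ w)
    (Δt := fun w => H w * Complex.exp (V w) - reflectedKernel S A z₁ w)
    (by positivity) hz₁0 hz₁π.le hb (by linarith)
    (fun w hw => ((hrem w hw).differentiableAt_removed).differentiableWithinAt) hanti
    (by
      intro w hw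
      have hw' : w ∈ hstrip (-Real.pi) Real.pi := ⟨by linarith [hw.1], by linarith [hw.2]⟩
      exact (((hGd.differentiableAt ((isOpen_hstrip _ _).mem_nhds hw)).mul
        (hW.differentiableOn_bot.differentiableAt
          ((isOpen_hstrip _ _).mem_nhds hw')).cexp).sub
        (differentiableAt_reflectedKernel hS (hbl w hw).1 (hbl w hw).2)).differentiableWithinAt)
    (by
      intro w hw
      have hws : w ∈ strip := ⟨hw.1, by linarith [hw.2]⟩
      rw [hreg w hws (hbl w ⟨by linarith [hw.1], hw.2⟩).1]
      simp only [hh, discrepancy, hGe hw])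
    (by
      intro w
      have : G (conj w) * Complex.exp (W (conj w)) - reflectedKernel S A z₁ (conj w) =
          -conj (G w * Complex.exp (W w) - reflectedKernel S A z₁ w) := by
        rw [hGs, hW.symm_bot, reflectedKernel_conj hS, Complex.exp_conj]
        simp; ring
      rw [this, norm_neg, Complex.norm_conj])
    (by
      intro w hw
      have hw' : w ∈ hstrip 0 (2 * Real.pi) := ⟨by linarith [hw.1], by linarith [hw.2]⟩
      exact (((hHd.differentiableAt ((isOpen_hstrip _ _).mem_nhds hw)).mul
        (hW.differentiableOn_top.differentiableAt
          ((isOpen_hstrip _ _).mem_nhds hw')).cexp).sub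
        (differentiableAt_reflectedKernel hS (htl w hw).1 (htl w hw).2)).differentiableWithinAt)
    (by
      intro w hw
      have hws : w ∈ strip := ⟨by linarith [hw.1], hw.2⟩
      rw [hreg w hws (htl w ⟨hw.1, by linarith [hw.2]⟩).1]
      simp only [hh, discrepancy, hHe hw]
      rw [hW.top_eq w hws, mul_assoc, ← Complex.exp_add]
      congr 3; ring)
    (by
      intro w
      -- The multiplier `-exp (-2iα)` is chosen so that the solution and the kernel acquire the same
      -- unimodular factor under the top reflection.
      have e1 := reflectedKernel_conj_add hS A z₁ w
      have e2 : conj (Complex.exp (V (conj w + 2 * Real.pi * Complex.I))) =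
          Complex.exp (V w) * Complex.exp (2 * α * Complex.I) := by
        rw [← Complex.exp_conj, hW.symm_top, Complex.exp_add]
      have e3 : Complex.exp (-(2 * α * Complex.I)) * Complex.exp (2 * α * Complex.I) = 1 := by
        rw [← Complex.exp_add]; simp
      have e4 : ‖Complex.exp (2 * α * Complex.I)‖ = 1 := by
        rw [show (2 * α * Complex.I : ℂ) = ((2 * α : ℝ) : ℂ) * Complex.I by push_cast; ring]
        exact Complex.norm_exp_ofReal_mul_I _
      rw [← Complex.norm_conj]
      have : conj (H (conj w + 2 * Real.pi * Complex.I) *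
          Complex.exp (V (conj w + 2 * Real.pi * Complex.I)) -
          reflectedKernel S A z₁ (conj w + 2 * Real.pi * Complex.I)) =
          Complex.exp (2 * α * Complex.I) *
            (H w * Complex.exp (V w) - reflectedKernel S A z₁ w) := by
        rw [map_sub, map_mul, hHs, Complex.conj_conj, e2]
        linear_combination Complex.exp (2 * α * Complex.I) * e1 +
          conj (reflectedKernel S A z₁ (conj w + 2 * Real.pi * Complex.I)) * e3
      rw [this, norm_mul, e4, one_mul])
    (by
      intro w hw
      rw [show w + (2 * ℓ : ℝ) = w + ℓ + ℓ by push_cast; ring,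
        hanti _ (hstrip_add_period hw ℓ), hanti w hw, neg_neg])
    (by
      intro w
      have : W (w + (2 * ℓ : ℝ)) = W w := by
        rw [show w + (2 * ℓ : ℝ) = w + ℓ + ℓ by push_cast; ring, hW.add_period_bot,
          hW.add_period_bot]
      simp only [hGp, this, reflectedKernel_add_two_mul_period hS])
    (by
      intro w
      have : V (w + (2 * ℓ : ℝ)) = V w := by
        rw [show w + (2 * ℓ : ℝ) = w + ℓ + ℓ by push_cast; ring, hW.add_period_top,
          hW.add_period_top]
      simp only [hHp, this, reflectedKernel_add_two_mul_period hS])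
    z hz
  rw [hreg z hz hzl, hh, discrepancy, sub_eq_zero] at key
  exact key

end Uniformization

/-! ### The form of the kernels on the straight cylinder -/

/-- Up to a gauge transformation, `K` is given by the Szegő kernel `S`. -/
def HasKernelForm (ℓ : ℝ) (K : ℤˣ → ℤˣ → ℂ → ℂ → ℂ) (S g : ℂ → ℂ) : Prop :=
  ∀ s₁ s₂ : ℤˣ, ∀ z₁ ∈ strip, ∀ z₂ ∈ strip, z₂ - z₁ ∉ lattice ℓ →
    K s₁ s₂ z₁ z₂ = ((s₂ : ℤ) : ℂ) * (2 / (Real.pi * Complex.I)) *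
      (signed s₁ (g z₁) / signed s₂ (g z₂)) * S (signed s₂ z₂ - signed s₁ z₁)

lemma signed_ne_zero {s : ℤˣ} {w : ℂ} (hw : w ≠ 0) : signed s w ≠ 0 := by
  rw [signed]
  split_ifs
  · exact hw
  · simpa using hw

/-- The coefficient of `S (z - z₁)` is proportional to `η̄` and that of `S (z - z̄₁)` to `η`. Hence
`f^{[1]} + i f^{[i]}` keeps only the first pole and `f^{[1]} - i f^{[i]}` only the second.
Conjugation gives the cases `s₂ = -1`, with the sign coming from `2 / (πi)`. The gauge `exp (W - L /
2)` absorbs the square roots of `φ'`. -/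
theorem exists_hasKernelForm {ℓ : ℝ} (hℓ : 0 < ℓ) {D : CylindricalDomain} (Φ : Uniformization ℓ D)
    {f : ℂ → ℂ → ℂ → ℂ} (hf : IsCouplingFamily D f) :
    ∃ (c : ℂ) (S g : ℂ → ℂ), IsSzego ℓ c S ∧ (∀ z, g z ≠ 0) ∧
      HasKernelForm ℓ (cylPM Φ f) S g := by
  obtain ⟨W, V, α, hW⟩ := exists_isGauge hℓ Φ.logDeriv_holomorphic Φ.logDeriv_periodic
  have hnorm : ‖-Complex.exp (-(2 * α * Complex.I))‖ = 1 := by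
    rw [norm_neg, show -(2 * α * Complex.I : ℂ) = ((-(2 * α) : ℝ) : ℂ) * Complex.I by
      push_cast; ring]
    exact Complex.norm_exp_ofReal_mul_I _
  have hS := isSzego_szegoKernel hℓ hnorm
  set S := szegoKernel ℓ (-Complex.exp (-(2 * α * Complex.I)))
  refine ⟨_, S, fun z => Complex.exp (W z - Φ.logDeriv z / 2), hS, fun z => Complex.exp_ne_zero _,
    ?_⟩
  intro s₁ s₂ z₁ hz₁ z₂ hz₂ hl
  have hpi : (Real.pi : ℂ) ≠ 0 := by exact_mod_cast Real.pi_ne_zero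
  have hE : ∀ z, Complex.exp (Φ.logDeriv z) = Complex.exp (Φ.logDeriv z / 2) ^ 2 := fun z => by
    rw [← Complex.exp_nat_mul]; congr 1; push_cast; ring
  have h1 := Uniformization.solution_eq hℓ hW hS hz₁ (hf 1 _ (Φ.toFun_mem_lift hz₁)) hz₂ hl
  have h2 := Uniformization.solution_eq hℓ hW hS hz₁ (hf Complex.I _ (Φ.toFun_mem_lift hz₁)) hz₂ hl
  simp only [reflectedKernel, map_mul, map_div₀, map_one, Complex.conj_ofReal, Complex.conj_I,
    Complex.exp_sub, hE, map_pow, map_neg, neg_neg] at h1 h2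
  set e₁ := Complex.exp (Φ.logDeriv z₁ / 2)
  set e₂ := Complex.exp (Φ.logDeriv z₂ / 2)
  set w₁ := Complex.exp (W z₁)
  set w₂ := Complex.exp (W z₂)
  have he₁ : e₁ ≠ 0 := Complex.exp_ne_zero _
  have he₂ : e₂ ≠ 0 := Complex.exp_ne_zero _
  have hw₂ : w₂ ≠ 0 := Complex.exp_ne_zero _
  have hw₁ : w₁ ≠ 0 := Complex.exp_ne_zero _
  have hce₁ : conj e₁ ≠ 0 := by simpa using he₁
  have hI := Complex.I_ne_zero
  have hplus : (f 1 (Φ.toFun z₁) (Φ.toFun z₂) + Complex.I * f Complex.I (Φ.toFun z₁) (Φ.toFun z₂)) *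
      e₁ * e₂ = 2 / (Real.pi * Complex.I) * ((w₁ / e₁) / (w₂ / e₂)) * S (z₂ - z₁) := by
    have : (f 1 (Φ.toFun z₁) (Φ.toFun z₂) +
        Complex.I * f Complex.I (Φ.toFun z₁) (Φ.toFun z₂)) * w₂ =
        2 / (Real.pi * Complex.I) * (w₁ / e₁ ^ 2) * S (z₂ - z₁) := by
      linear_combination h1 + Complex.I * h2 -
        (1 / (Real.pi * Complex.I) * (w₁ / e₁ ^ 2) * S (z₂ - z₁) +
          1 / (Real.pi * -Complex.I) * (conj w₁ / conj e₁ ^ 2) * S (z₂ - conj z₁)) * Complex.I_mul_I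
    rw [← eq_div_iff hw₂] at this
    rw [this]; field_simp
  have hminus : (f 1 (Φ.toFun z₁) (Φ.toFun z₂) -
      Complex.I * f Complex.I (Φ.toFun z₁) (Φ.toFun z₂)) * conj e₁ * e₂ =
      2 / (Real.pi * Complex.I) * (conj (w₁ / e₁) / (w₂ / e₂)) * S (z₂ - conj z₁) := by
    have : (f 1 (Φ.toFun z₁) (Φ.toFun z₂) -
        Complex.I * f Complex.I (Φ.toFun z₁) (Φ.toFun z₂)) * w₂ =
        2 / (Real.pi * Complex.I) * (conj w₁ / conj e₁ ^ 2) * S (z₂ - conj z₁) := by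
      have e3 : 1 / (Real.pi * -Complex.I : ℂ) = -(1 / (Real.pi * Complex.I)) := by
        rw [mul_neg, div_neg]
      rw [e3] at h1 h2
      linear_combination h1 - Complex.I * h2 +
        (1 / (Real.pi * Complex.I) * (w₁ / e₁ ^ 2) * S (z₂ - z₁) -
          1 / (Real.pi * Complex.I) * (conj w₁ / conj e₁ ^ 2) * S (z₂ - conj z₁)) * Complex.I_mul_I
    rw [← eq_div_iff hw₂] at this
    rw [this, map_div₀]; field_simp
  have hgz₁ : Complex.exp (W z₁ - Φ.logDeriv z₁ / 2) = w₁ / e₁ := Complex.exp_sub _ _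
  have hgz₂ : Complex.exp (W z₂ - Φ.logDeriv z₂ / 2) = w₂ / e₂ := Complex.exp_sub _ _
  have hneg : conj (2 / (Real.pi * Complex.I) : ℂ) = -(2 / (Real.pi * Complex.I)) := by
    simp [map_ofNat]
    ring
  have hu : ((-1 : ℤˣ) : ℤˣ) ≠ 1 := by decide
  rcases Int.units_eq_one_or s₁ with rfl | rfl <;> rcases Int.units_eq_one_or s₂ with rfl | rfl
  · simp only [cylPM, couplingPM, signed, if_true, hgz₁, hgz₂]
    push_cast
    linear_combination hplus
  · have := congrArg conj hminus
    simp only [map_mul, hneg, hS.conj_apply, map_sub, map_div₀, Complex.conj_conj] at this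
    simp only [cylPM, couplingPM, signed, if_true, hu, if_false, hgz₁, hgz₂, map_sub, map_mul,
      map_div₀]
    push_cast
    simp only [map_one]
    linear_combination this
  · simp only [cylPM, couplingPM, signed, if_true, hu, if_false, hgz₁, hgz₂]
    push_cast
    linear_combination hminus
  · have := congrArg conj hplus
    simp only [map_mul, hneg, hS.conj_apply, map_add, map_sub, map_div₀] at this
    simp only [cylPM, couplingPM, signed, hu, if_false, hgz₁, hgz₂, map_sub, map_mul,
      map_div₀]
    push_cast
    simp only [map_neg, map_one]
    linear_combination this

/-! ### Configurations -/

lemma sub_notMem_lattice {ℓ : ℝ} {z w : ℂ} (hz : z ∈ strip) (hw : w ∈ strip)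
    (h : ∀ m : ℤ, z ≠ w + m * ℓ) : z - w ∉ lattice ℓ := fun hl =>
  let ⟨m, hm⟩ := exists_eq_add_of_sub_mem_lattice hz hw hl
  h m hm

lemma signed_sub_notMem_lattice {ℓ : ℝ} {z w : ℂ} (hz : z ∈ strip) (hw : w ∈ strip)
    (h : z - w ∉ lattice ℓ) (s t : ℤˣ) : signed s z - signed t w ∉ lattice ℓ := by
  have hu : ((-1 : ℤˣ) : ℤˣ) ≠ 1 := by decide
  rcases Int.units_eq_one_or s with rfl | rfl <;> rcases Int.units_eq_one_or t with rfl | rfl <;>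
    simp only [signed, if_true, hu, if_false]
  · exact h
  · exact sub_conj_notMem_lattice hz hw
  · rw [← neg_mem_iff, neg_sub]
    exact sub_conj_notMem_lattice hw hz
  · rw [← map_sub, conj_mem_lattice]
    exact h

lemma IsConfiguration.sub_notMem {ℓ : ℝ} {n : ℕ} {z : Fin n → ℂ} (hz : IsConfiguration ℓ z)
    {j k : Fin n} (hjk : j ≠ k) : z j - z k ∉ lattice ℓ :=
  sub_notMem_lattice (hz.1 j) (hz.1 k) (hz.2 j k hjk)

lemma IsConfiguration.signed_sub_notMem {ℓ : ℝ} {n : ℕ} {z : Fin n → ℂ}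
    (hz : IsConfiguration ℓ z) {j k : Fin n} (hjk : j ≠ k) (s t : ℤˣ) :
    signed s (z j) - signed t (z k) ∉ lattice ℓ :=
  signed_sub_notMem_lattice (hz.1 j) (hz.1 k) (hz.sub_notMem hjk) s t

lemma IsPathFamily.isConfiguration {ℓ : ℝ} {n : ℕ} {w : Fin n → ℂ} {γ : Fin n → ℝ → ℂ}
    (hγ : IsPathFamily ℓ w γ) {t : Fin n → ℝ} (ht : t ∈ Set.univ.pi fun _ => Set.Ioo (0 : ℝ) 1) :
    IsConfiguration ℓ fun k => γ k (t k) :=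
  ⟨fun k => hγ.mem_strip k _ (ht k trivial), fun j k hjk m => hγ.disjoint j k hjk _
    (Set.Ioo_subset_Icc_self (ht j trivial)) _ (Set.Ioo_subset_Icc_self (ht k trivial)) m⟩

/-- Equidistant vertical segments in the straight cylinder. -/
def verticalPath (ℓ : ℝ) (n : ℕ) (k : Fin n) (t : ℝ) : ℂ :=
  ((k : ℝ) / n * ℓ : ℝ) + t * (Real.pi * Complex.I)

lemma hasDerivAt_verticalPath (ℓ : ℝ) (n : ℕ) (k : Fin n) (t : ℝ) :
    HasDerivAt (verticalPath ℓ n k) (Real.pi * Complex.I) t := by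
  have := ((Complex.ofRealCLM.hasDerivAt (x := t)).mul_const (Real.pi * Complex.I)).const_add
    (((k : ℝ) / n * ℓ : ℝ) : ℂ)
  exact this.congr_deriv (by simp)

lemma isPathFamily_verticalPath {ℓ : ℝ} (hℓ : 0 < ℓ) (n : ℕ) :
    IsPathFamily ℓ (fun k => verticalPath ℓ n k 1) (verticalPath ℓ n) where
  contDiff k := by
    unfold verticalPath
    exact contDiff_const.add (Complex.ofRealCLM.contDiff.mul contDiff_const)
  start k := by simp [verticalPath]
  finish k := rfl
  mem_strip k t ht := by
    have hpi := Real.pi_pos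
    simp only [strip, verticalPath, Set.mem_ofPred_eq]
    simp
    exact ⟨mul_pos ht.1 hpi, by nlinarith [ht.2]⟩
  disjoint j k hjk t _ u _ m h := by
    have hre := congrArg Complex.re h
    simp [verticalPath] at hre
    have hn : (0 : ℝ) < n := by exact_mod_cast j.pos
    have h2 : ((j : ℕ) : ℝ) = (k : ℕ) + m * n := by
      have h3 : ((j : ℕ) : ℝ) / n = (k : ℕ) / n + m := by
        refine mul_right_cancel₀ hℓ.ne' ?_
        linarith
      field_simp at h3
      linarith
    have h3 : ((j : ℕ) : ℤ) = (k : ℕ) + m * n := by exact_mod_cast h2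
    have hj := j.isLt
    have hk := k.isLt
    apply hjk
    apply Fin.ext
    rcases lt_trichotomy m 0 with hm | hm | hm
    · have : m * n ≤ -1 * n := mul_le_mul_of_nonneg_right (by omega) (by omega)
      omega
    · subst hm; omega
    · have : 1 * (n : ℤ) ≤ m * n := mul_le_mul_of_nonneg_right (by omega) (by omega)
      omega

/-- The moment integrals only see the open cube, where the paths form configurations. -/
lemma formA_ext {ℓ : ℝ} {K K' : ℤˣ → ℤˣ → ℂ → ℂ → ℂ} {n : ℕ}
    (h : ∀ z : Fin n → ℂ, IsConfiguration ℓ z → ∀ v, formA K n z v = formA K' n z v) {M : ℝ}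
    (hK : HasMoment ℓ K n M) : HasMoment ℓ K' n M := by
  intro w hw γ hγ
  obtain ⟨h1, h2⟩ := hK w hw γ hγ
  have hms : MeasurableSet (Set.univ.pi fun _ : Fin n => Set.Ioo (0 : ℝ) 1) :=
    MeasurableSet.univ_pi fun _ => measurableSet_Ioo
  have heq : Set.EqOn
      (fun t : Fin n → ℝ => formA K n (fun k => γ k (t k)) (fun k => deriv (γ k) (t k)))
      (fun t : Fin n → ℝ => formA K' n (fun k => γ k (t k)) (fun k => deriv (γ k) (t k)))
      (Set.univ.pi fun _ : Fin n => Set.Ioo (0 : ℝ) 1) :=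
    fun t ht => h _ (hγ.isConfiguration ht) _
  exact ⟨h1.congr_fun heq hms, by rw [← h2, setIntegral_congr_fun hms heq]⟩

/-! ### Forms, moments and cyclic products in terms of the Szegő kernel. -/

namespace HasKernelForm

variable {ℓ : ℝ} {c : ℂ} {K K' : ℤˣ → ℤˣ → ℂ → ℂ → ℂ} {S S' g g' : ℂ → ℂ}

lemma two_div_pi_mul_I_pow_three :
    (2 / (Real.pi * Complex.I) : ℂ) ^ 3 = 8 * Complex.I / (Real.pi : ℂ) ^ 3 := by
  have hpi : (Real.pi : ℂ) ≠ 0 := by exact_mod_cast Real.pi_ne_zero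
  have hI := Complex.I_ne_zero
  field_simp
  linear_combination (-8 * (Complex.I ^ 2 - 1)) * Complex.I_sq

/-- Around a cycle every gauge factor occurs once in a numerator and once in a denominator; likewise
for `F₃_eq`. -/
lemma F₂_eq (hK : HasKernelForm ℓ K S g) (hg : ∀ z, g z ≠ 0) (s₁ s₂ : ℤˣ) {z₁ z₂ : ℂ}
    (hz₁ : z₁ ∈ strip) (hz₂ : z₂ ∈ strip) (h : z₂ - z₁ ∉ lattice ℓ) :
    F₂ K s₁ s₂ z₁ z₂ = ((s₁ : ℤ) : ℂ) * ((s₂ : ℤ) : ℂ) * (2 / (Real.pi * Complex.I)) ^ 2 *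
      (S (signed s₂ z₂ - signed s₁ z₁) * S (-(signed s₂ z₂ - signed s₁ z₁))) := by
  have h' : z₁ - z₂ ∉ lattice ℓ := by rwa [← neg_mem_iff, neg_sub]
  rw [F₂, hK s₁ s₂ z₁ hz₁ z₂ hz₂ h, hK s₂ s₁ z₂ hz₂ z₁ hz₁ h', neg_sub]
  have h1 := signed_ne_zero (s := s₁) (hg z₁)
  have h2 := signed_ne_zero (s := s₂) (hg z₂)
  generalize (2 / (Real.pi * Complex.I) : ℂ) = k
  field_simp

lemma F₃_eq (hK : HasKernelForm ℓ K S g) (hg : ∀ z, g z ≠ 0) (s₁ s₂ s₃ : ℤˣ) {z₁ z₂ z₃ : ℂ}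
    (hz₁ : z₁ ∈ strip) (hz₂ : z₂ ∈ strip) (hz₃ : z₃ ∈ strip) (h₁₂ : z₂ - z₁ ∉ lattice ℓ)
    (h₂₃ : z₃ - z₂ ∉ lattice ℓ) (h₃₁ : z₁ - z₃ ∉ lattice ℓ) :
    F₃ K s₁ s₂ s₃ z₁ z₂ z₃ = ((s₁ : ℤ) : ℂ) * ((s₂ : ℤ) : ℂ) * ((s₃ : ℤ) : ℂ) *
      (2 / (Real.pi * Complex.I)) ^ 3 * (S (signed s₂ z₂ - signed s₁ z₁) *
        S (signed s₃ z₃ - signed s₂ z₂) * S (signed s₁ z₁ - signed s₃ z₃)) := by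
  rw [F₃, hK s₁ s₂ z₁ hz₁ z₂ hz₂ h₁₂, hK s₂ s₃ z₂ hz₂ z₃ hz₃ h₂₃, hK s₃ s₁ z₃ hz₃ z₁ hz₁ h₃₁]
  have h1 := signed_ne_zero (s := s₁) (hg z₁)
  have h2 := signed_ne_zero (s := s₂) (hg z₂)
  have h3 := signed_ne_zero (s := s₃) (hg z₃)
  generalize (2 / (Real.pi * Complex.I) : ℂ) = k
  field_simp

/-- The forms do not depend on the gauge. -/
lemma formA_congr (hK : HasKernelForm ℓ K S g) (hK' : HasKernelForm ℓ K' S' g')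
    (hg : ∀ z, g z ≠ 0) (hg' : ∀ z, g' z ≠ 0) (hSS : ∀ z ∉ lattice ℓ, S z = S' z) {n : ℕ}
    {z : Fin n → ℂ} (hz : IsConfiguration ℓ z) (v : Fin n → ℂ) :
    formA K n z v = formA K' n z v := by
  unfold formA
  congr 1
  refine Finset.sum_congr rfl fun s _ => ?_
  congr 1
  -- The ratio of the two gauges: the matrices are conjugate by a diagonal matrix, so their
  -- determinants agree.
  set d : Fin n → ℂ := fun j => signed (s j) (g' (z j)) / signed (s j) (g (z j)) with hd
  have h1 : ∀ j, signed (s j) (g (z j)) ≠ 0 := fun j => signed_ne_zero (hg _)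
  have h2 : ∀ j, signed (s j) (g' (z j)) ≠ 0 := fun j => signed_ne_zero (hg' _)
  have hd0 : ∀ j, d j ≠ 0 := fun j => div_ne_zero (h2 j) (h1 j)
  have hM : (Matrix.of fun j k : Fin n => if j = k then 0 else K' (s j) (s k) (z j) (z k)) =
      Matrix.diagonal d *
        (Matrix.of fun j k : Fin n => if j = k then 0 else K (s j) (s k) (z j) (z k)) *
        Matrix.diagonal fun j => (d j)⁻¹ := by
    ext j k
    rw [Matrix.mul_diagonal, Matrix.diagonal_mul]
    simp only [Matrix.of_apply]
    split_ifs with hjk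
    · simp
    · have hl := hz.sub_notMem (Ne.symm hjk)
      rw [hK _ _ _ (hz.1 j) _ (hz.1 k) hl, hK' _ _ _ (hz.1 j) _ (hz.1 k) hl,
        hSS _ (hz.signed_sub_notMem (Ne.symm hjk) _ _)]
      have := h1 j
      have := h1 k
      have := h2 j
      have := h2 k
      simp only [hd]
      generalize (2 / (Real.pi * Complex.I) : ℂ) = k
      field_simp
  rw [hM, Matrix.det_mul, Matrix.det_mul, Matrix.det_diagonal, Matrix.det_diagonal,
    mul_right_comm, ← Finset.prod_mul_distrib]
  simp [hd0]

lemma intCast_units_sq (s : ℤˣ) : ((s : ℤ) : ℂ) ^ 2 = 1 := by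
  rcases Int.units_eq_one_or s with rfl | rfl <;> simp

lemma signed_pi_mul_I (s : ℤˣ) :
    signed s (Real.pi * Complex.I) = ((s : ℤ) : ℂ) * (Real.pi * Complex.I) := by
  rcases Int.units_eq_one_or s with rfl | rfl <;> simp [signed]

lemma two_div_mul_self : (2 / (Real.pi * Complex.I) : ℂ) * (Real.pi * Complex.I) = 2 :=
  div_mul_cancel₀ _ (mul_ne_zero (by exact_mod_cast Real.pi_ne_zero) Complex.I_ne_zero)

lemma F₃_add_reverse (hK : HasKernelForm ℓ K S g) (hg : ∀ z, g z ≠ 0) {Q : ℂ}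
    (hQ : ∀ a ∉ lattice ℓ, ∀ b ∉ lattice ℓ, a + b ∉ lattice ℓ →
      S a * S b * S (-(a + b)) + S (-a) * S (-b) * S (a + b) = Q) {z : Fin 3 → ℂ}
    (hz : IsConfiguration ℓ z) (s : Fin 3 → ℤˣ) :
    F₃ K (s 0) (s 1) (s 2) (z 0) (z 1) (z 2) + F₃ K (s 2) (s 1) (s 0) (z 2) (z 1) (z 0) =
      ((s 0 : ℤ) : ℂ) * ((s 1 : ℤ) : ℂ) * ((s 2 : ℤ) : ℂ) * (2 / (Real.pi * Complex.I)) ^ 3 *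
        Q := by
  have hl : ∀ j k : Fin 3, j ≠ k → z j - z k ∉ lattice ℓ := fun j k => hz.sub_notMem
  have hls : ∀ j k : Fin 3, j ≠ k → signed (s j) (z j) - signed (s k) (z k) ∉ lattice ℓ :=
    fun j k h => hz.signed_sub_notMem h _ _
  rw [hK.F₃_eq hg _ _ _ (hz.1 0) (hz.1 1) (hz.1 2) (hl 1 0 (by decide)) (hl 2 1 (by decide))
    (hl 0 2 (by decide)), hK.F₃_eq hg _ _ _ (hz.1 2) (hz.1 1) (hz.1 0) (hl 1 2 (by decide))
    (hl 0 1 (by decide)) (hl 2 0 (by decide))]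
  have := hQ _ (hls 1 0 (by decide)) _ (hls 2 1 (by decide))
    (by simpa using hls 2 0 (by decide))
  rw [← this, neg_sub, neg_sub,
    show signed (s 1) (z 1) - signed (s 0) (z 0) + (signed (s 2) (z 2) - signed (s 1) (z 1)) =
      signed (s 2) (z 2) - signed (s 0) (z 0) by ring, neg_sub]
  ring

lemma formA_two (hK : HasKernelForm ℓ K S g) (hg : ∀ z, g z ≠ 0) {z : Fin 2 → ℂ}
    (hz : IsConfiguration ℓ z) :
    formA K 2 z (fun _ => Real.pi * Complex.I) =
      -(1 / 4) * ∑ s : Fin 2 → ℤˣ, S (signed (s 1) (z 1) - signed (s 0) (z 0)) *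
        S (-(signed (s 1) (z 1) - signed (s 0) (z 0))) := by
  unfold formA
  rw [Finset.mul_sum, Finset.mul_sum]
  refine Finset.sum_congr rfl fun s _ => ?_
  have h := hK.F₂_eq hg (s 0) (s 1) (hz.1 0) (hz.1 1) (hz.sub_notMem (by decide))
  rw [F₂] at h
  rw [Matrix.det_fin_two, Fin.prod_univ_two]
  simp only [Matrix.of_apply, if_true, zero_ne_one, one_ne_zero, if_false, signed_pi_mul_I, h]
  have e : ((2 / (Real.pi * Complex.I) : ℂ) * (Real.pi * Complex.I)) ^ 2 = 4 := by
    rw [two_div_mul_self]; norm_num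
  generalize S (signed (s 1) (z 1) - signed (s 0) (z 0)) *
    S (-(signed (s 1) (z 1) - signed (s 0) (z 0))) = P
  rw [mul_pow] at e
  generalize (2 / (Real.pi * Complex.I) : ℂ) = k at *
  linear_combination (-1 / 16 * P) * e -
    (1 / 16 * P * k ^ 2 * (Real.pi * Complex.I) ^ 2) * ((s 0 : ℤ) : ℂ) ^ 2 * intCast_units_sq (s 1)
    - (1 / 16 * P * k ^ 2 * (Real.pi * Complex.I) ^ 2) * intCast_units_sq (s 0)

/-- A `3 × 3` determinant with zero diagonal is the sum of its two 3-cycles. The signs in `K` cancel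
those of the conjugated vertical vectors, so each of the eight sign choices contributes `8 * Q`,
against the normalization `4 ^ 3`. -/
lemma formA_three (hK : HasKernelForm ℓ K S g) (hg : ∀ z, g z ≠ 0) {Q : ℂ}
    (hQ : ∀ a ∉ lattice ℓ, ∀ b ∉ lattice ℓ, a + b ∉ lattice ℓ →
      S a * S b * S (-(a + b)) + S (-a) * S (-b) * S (a + b) = Q) {z : Fin 3 → ℂ}
    (hz : IsConfiguration ℓ z) :
    formA K 3 z (fun _ => Real.pi * Complex.I) = Q := by
  have key : ∀ s : Fin 3 → ℤˣ,
      (Matrix.of fun j k : Fin 3 => if j = k then 0 else K (s j) (s k) (z j) (z k)).det *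
        ∏ k, signed (s k) (Real.pi * Complex.I) = 8 * Q := by
    intro s
    have h := hK.F₃_add_reverse hg hQ hz s
    simp only [F₃] at h
    rw [Matrix.det_fin_three, Fin.prod_univ_three]
    simp only [Matrix.of_apply, signed_pi_mul_I, if_true, Fin.reduceEq, if_false]
    have e : ((2 / (Real.pi * Complex.I) : ℂ) * (Real.pi * Complex.I)) ^ 3 = 8 := by
      rw [two_div_mul_self]; norm_num
    rw [mul_pow] at e
    generalize (2 / (Real.pi * Complex.I) : ℂ) = k at *
    generalize (Real.pi * Complex.I : ℂ) = p at *
    have h0 := intCast_units_sq (s 0)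
    have h1 := intCast_units_sq (s 1)
    have h2 := intCast_units_sq (s 2)
    generalize ((s 0 : ℤ) : ℂ) = a at *
    generalize ((s 1 : ℤ) : ℂ) = b at *
    generalize ((s 2 : ℤ) : ℂ) = d at *
    linear_combination (a * b * d * p ^ 3) * h + Q * e + Q * k ^ 3 * p ^ 3 * (
      b ^ 2 * d ^ 2 * h0 + d ^ 2 * h1 + h2)
  unfold formA
  rw [Finset.sum_congr rfl fun s _ => key s]
  simp
  ring

lemma integral_formA {n : ℕ} {M : ℝ} (hℓ : 0 < ℓ) (hM : HasMoment ℓ K n M) :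
    IntegrableOn (fun t : Fin n → ℝ => formA K n (fun k => verticalPath ℓ n k (t k))
      fun _ => Real.pi * Complex.I) (Set.univ.pi fun _ => Set.Ioo (0 : ℝ) 1) ∧
    ∫ t in Set.univ.pi fun _ : Fin n => Set.Ioo (0 : ℝ) 1,
      formA K n (fun k => verticalPath ℓ n k (t k)) (fun _ => Real.pi * Complex.I) = (M : ℂ) := by
  have := hM _ (fun k => by simp [verticalPath]) _ (isPathFamily_verticalPath hℓ n)
  simpa only [(hasDerivAt_verticalPath ℓ n _ _).deriv] using this

lemma measureReal_cube (n : ℕ) :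
    (volume : Measure (Fin n → ℝ)).real (Set.univ.pi fun _ => Set.Ioo (0 : ℝ) 1) = 1 := by
  simp [measureReal_def, Real.volume_pi_Ioo]

/-- Along vertical segments the integrand is the constant `Q` on a cube of volume one. -/
lemma moment_three_eq (hℓ : 0 < ℓ) (hK : HasKernelForm ℓ K S g) (hg : ∀ z, g z ≠ 0) {Q : ℂ}
    (hQ : ∀ a ∉ lattice ℓ, ∀ b ∉ lattice ℓ, a + b ∉ lattice ℓ →
      S a * S b * S (-(a + b)) + S (-a) * S (-b) * S (a + b) = Q) {M : ℝ}
    (hM : HasMoment ℓ K 3 M) : Q = M := by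
  have hms : MeasurableSet (Set.univ.pi fun _ : Fin 3 => Set.Ioo (0 : ℝ) 1) :=
    MeasurableSet.univ_pi fun _ => measurableSet_Ioo
  have h := (integral_formA hℓ hM).2
  rw [setIntegral_congr_fun hms fun t ht => hK.formA_three hg hQ
    ((isPathFamily_verticalPath hℓ 3).isConfiguration ht), setIntegral_const,
    measureReal_cube] at h
  simpa using h

/-- Along vertical segments the two integrands differ by the constant `-δ`, and their integrals
coincide. -/
lemma prod_neg_eq_of_moment_two_eq (hℓ : 0 < ℓ) {c' : ℂ} (hS : IsSzego ℓ c S)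
    (hS' : IsSzego ℓ c' S') (hK : HasKernelForm ℓ K S g) (hK' : HasKernelForm ℓ K' S' g')
    (hg : ∀ z, g z ≠ 0) (hg' : ∀ z, g' z ≠ 0) {M : ℝ} (hM : HasMoment ℓ K 2 M)
    (hM' : HasMoment ℓ K' 2 M) : ∀ z ∉ lattice ℓ, S z * S (-z) = S' z * S' (-z) := by
  have hms : MeasurableSet (Set.univ.pi fun _ : Fin 2 => Set.Ioo (0 : ℝ) 1) :=
    MeasurableSet.univ_pi fun _ => measurableSet_Ioo
  obtain ⟨δ, hδ⟩ := hS.exists_prod_neg_sub_eq hℓ hS'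
  obtain ⟨hi, h⟩ := integral_formA hℓ hM
  obtain ⟨hi', h'⟩ := integral_formA hℓ hM'
  have hsub := integral_sub hi hi'
  rw [h, h', sub_self, setIntegral_congr_fun (g := fun _ => -δ) hms fun t ht => ?_,
    setIntegral_const, measureReal_cube] at hsub
  · have : δ = 0 := by simpa using hsub
    intro z hz
    rw [← sub_eq_zero, hδ z hz, this]
  · have hc := (isPathFamily_verticalPath hℓ 2).isConfiguration ht
    simp only
    rw [hK.formA_two hg hc, hK'.formA_two hg' hc, ← mul_sub, ← Finset.sum_sub_distrib,
      Finset.sum_congr rfl fun s _ => hδ _ (hc.signed_sub_notMem (j := 1) (k := 0) (by decide) _ _)]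
    simp

/-- Only `S (z₂ - z₁)` is singular at `z₁`. Freezing the other factors at `z₂ = z₁` leaves `F₂`, and
the error of freezing is divisible by `z₂ - z₁`. -/
lemma isBigO_F₃_sub (hK : HasKernelForm ℓ K S g) (hg : ∀ z, g z ≠ 0) (hS : IsSzego ℓ c S)
    (hℓ : 0 < ℓ) (s : ℤˣ) {z₁ z₃ : ℂ} (hz₁ : z₁ ∈ strip) (hz₃ : z₃ ∈ strip)
    (h : z₃ - z₁ ∉ lattice ℓ) :
    (fun z₂ : ℂ => F₃ K 1 1 s z₁ z₂ z₃ -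
        2 / (Real.pi * Complex.I) * (F₂ K 1 s z₁ z₃ / (z₂ - z₁)))
      =O[𝓝[≠] z₁] (fun _ : ℂ => (1 : ℝ)) := by
  set u := signed s z₃ with hu
  have h1 : signed 1 z₁ = z₁ := rfl
  have hl : u - z₁ ∉ lattice ℓ := signed_sub_notMem_lattice hz₃ hz₁ h s 1
  have hd : ∀ᶠ z in 𝓝 z₁, DifferentiableAt ℂ (fun z => S (u - z)) z := by
    filter_upwards [(isClosed_lattice hℓ).isOpen_compl.preimage (f := fun z => u - z)
      (by fun_prop) |>.mem_nhds hl] with z hz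
    exact DifferentiableAt.comp z (hS.differentiableAt _ hz) (by fun_prop)
  have e1 : RemovableAt (fun z => S (z - z₁) - 1 / (z - z₁)) z₁ := by
    have := RemovableAt.comp_affine (h := fun z => S z - 1 / z) one_ne_zero (b := -z₁) (p := z₁)
      (by simpa using hS.removableAt_sub_inv hℓ)
    simpa [← sub_eq_add_neg] using this
  have e2 : RemovableAt (fun z => (S (u - z) - S (u - z₁)) / (z - z₁)) z₁ :=
    RemovableAt.div_sub (hd.mono fun z hz => hz.sub_const _) (sub_self _)
  refine ((((e1.mul (.of_differentiableAt hd)).add e2).2.const_mul_left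
    (((s : ℤ) : ℂ) * (2 / (Real.pi * Complex.I)) ^ 3 * S (z₁ - u)))).congr' ?_ .rfl
  filter_upwards [Uniformization.eventually_strip_and_notMem hℓ hz₁ z₁,
    Uniformization.eventually_strip_and_notMem hℓ hz₁ z₃, self_mem_nhdsWithin]
    with z hz hz' hzz
  rw [hK.F₃_eq hg _ _ _ hz₁ hz.1 hz₃ hz.2 (by rw [← neg_mem_iff, neg_sub]; exact hz'.2)
    (by rwa [← neg_mem_iff, neg_sub]), hK.F₂_eq hg _ _ hz₁ hz₃ h, neg_sub, ← hu, h1,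
    show signed 1 z = z from rfl]
  have : z - z₁ ≠ 0 := sub_ne_zero.2 hzz
  generalize (2 / (Real.pi * Complex.I) : ℂ) = k
  push_cast
  field_simp
  ring

/-- In the reversed cycle the singular factor is `S (z₁ - z₂)`, whence the opposite sign. -/
lemma isBigO_F₃_add (hK : HasKernelForm ℓ K S g) (hg : ∀ z, g z ≠ 0) (hS : IsSzego ℓ c S)
    (hℓ : 0 < ℓ) (s : ℤˣ) {z₁ z₃ : ℂ} (hz₁ : z₁ ∈ strip) (hz₃ : z₃ ∈ strip)
    (h : z₃ - z₁ ∉ lattice ℓ) :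
    (fun z₂ : ℂ => F₃ K s 1 1 z₃ z₂ z₁ +
        2 / (Real.pi * Complex.I) * (F₂ K 1 s z₁ z₃ / (z₂ - z₁)))
      =O[𝓝[≠] z₁] (fun _ : ℂ => (1 : ℝ)) := by
  set u := signed s z₃ with hu
  have h1 : signed 1 z₁ = z₁ := rfl
  have hl : z₁ - u ∉ lattice ℓ := by
    rw [← neg_mem_iff, neg_sub]
    exact signed_sub_notMem_lattice hz₃ hz₁ h s 1
  have hd : ∀ᶠ z in 𝓝 z₁, DifferentiableAt ℂ (fun z => S (z - u)) z := by
    filter_upwards [(isClosed_lattice hℓ).isOpen_compl.preimage (f := fun z => z - u)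
      (by fun_prop) |>.mem_nhds hl] with z hz
    exact DifferentiableAt.comp z (hS.differentiableAt _ hz) (by fun_prop)
  have e1 : RemovableAt (fun z => S (z₁ - z) - 1 / (z₁ - z)) z₁ := by
    have := RemovableAt.comp_affine (h := fun z => S z - 1 / z) (neg_ne_zero.2 one_ne_zero)
      (b := z₁) (p := z₁) (by simpa using hS.removableAt_sub_inv hℓ)
    simpa [neg_add_eq_sub] using this
  have e2 : RemovableAt (fun z => (S (z - u) - S (z₁ - u)) / (z - z₁)) z₁ :=
    RemovableAt.div_sub (hd.mono fun z hz => hz.sub_const _) (sub_self _)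
  refine ((((e1.mul (.of_differentiableAt hd)).sub e2).2.const_mul_left
    (((s : ℤ) : ℂ) * (2 / (Real.pi * Complex.I)) ^ 3 * S (u - z₁)))).congr' ?_ .rfl
  filter_upwards [Uniformization.eventually_strip_and_notMem hℓ hz₁ z₁,
    Uniformization.eventually_strip_and_notMem hℓ hz₁ z₃, self_mem_nhdsWithin]
    with z hz hz' hzz
  rw [hK.F₃_eq hg _ _ _ hz₃ hz.1 hz₁ hz'.2 (by rw [← neg_mem_iff, neg_sub]; exact hz.2) h,
    hK.F₂_eq hg _ _ hz₁ hz₃ h, neg_sub, ← hu, h1, show signed 1 z = z from rfl]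
  have h2 : z - z₁ ≠ 0 := sub_ne_zero.2 hzz
  have h3 : z₁ - z = -(z - z₁) := by ring
  generalize (2 / (Real.pi * Complex.I) : ℂ) = k
  rw [show 1 / (z₁ - z) = -(1 / (z - z₁)) by rw [h3, one_div_neg_eq_neg_one_div]]
  push_cast
  field_simp
  ring

end HasKernelForm

end DimerCylinder

end

theorem proposition3p4 (ℓ : ℝ) (hℓ : 0 < ℓ)
    (D D' : DimerCylinder.CylindricalDomain)
    (Φ : DimerCylinder.Uniformization ℓ D) (Φ' : DimerCylinder.Uniformization ℓ D')
    (f f' : ℂ → ℂ → ℂ → ℂ)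
    (hf : DimerCylinder.IsCouplingFamily D f) (hf' : DimerCylinder.IsCouplingFamily D' f')
    (M₂ M₃ : ℝ)
    (h₂ : DimerCylinder.HasMoment ℓ (DimerCylinder.cylPM Φ f) 2 M₂)
    (h₂' : DimerCylinder.HasMoment ℓ (DimerCylinder.cylPM Φ' f') 2 M₂)
    (h₃ : DimerCylinder.HasMoment ℓ (DimerCylinder.cylPM Φ f) 3 M₃)
    (h₃' : DimerCylinder.HasMoment ℓ (DimerCylinder.cylPM Φ' f') 3 M₃) :
    -- `M₂` and `M₃` determine the forms `𝒜ₙ`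
    (∀ n : ℕ, 2 ≤ n → ∀ z : Fin n → ℂ, DimerCylinder.IsConfiguration ℓ z → ∀ v : Fin n → ℂ,
      DimerCylinder.formA (DimerCylinder.cylPM Φ f) n z v =
        DimerCylinder.formA (DimerCylinder.cylPM Φ' f') n z v) ∧
    -- `M₂` and `M₃` determine the moments `Mₙ`
    (∀ n : ℕ, 4 ≤ n → ∀ M : ℝ,
      DimerCylinder.HasMoment ℓ (DimerCylinder.cylPM Φ f) n M ↔
        DimerCylinder.HasMoment ℓ (DimerCylinder.cylPM Φ' f') n M) ∧
    -- `M₂` and `M₃` determine the functions `F₂` and `F₃`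
    (∀ (s : Fin 2 → ℤˣ) (z : Fin 2 → ℂ), DimerCylinder.IsConfiguration ℓ z →
      DimerCylinder.F₂ (DimerCylinder.cylPM Φ f) (s 0) (s 1) (z 0) (z 1) =
        DimerCylinder.F₂ (DimerCylinder.cylPM Φ' f') (s 0) (s 1) (z 0) (z 1)) ∧
    (∀ (s : Fin 3 → ℤˣ) (z : Fin 3 → ℂ), DimerCylinder.IsConfiguration ℓ z →
      DimerCylinder.F₃ (DimerCylinder.cylPM Φ f) (s 0) (s 1) (s 2) (z 0) (z 1) (z 2) =
        DimerCylinder.F₃ (DimerCylinder.cylPM Φ' f') (s 0) (s 1) (s 2) (z 0) (z 1) (z 2)) ∧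
    -- the quadratic equation with roots `F₃(z₁, z₂, z₃)` and `F₃(z₃, z₂, z₁)`
    (∀ (s : Fin 3 → ℤˣ) (z : Fin 3 → ℂ), DimerCylinder.IsConfiguration ℓ z → ∀ X : ℂ,
      X ^ 2 - 8 * Complex.I / (Real.pi : ℂ) ^ 3 * (((s 0 * s 1 * s 2 : ℤˣ) : ℤ) : ℂ) * M₃ * X +
          DimerCylinder.F₂ (DimerCylinder.cylPM Φ f) (s 0) (s 1) (z 0) (z 1) *
          DimerCylinder.F₂ (DimerCylinder.cylPM Φ f) (s 1) (s 2) (z 1) (z 2) *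
          DimerCylinder.F₂ (DimerCylinder.cylPM Φ f) (s 2) (s 0) (z 2) (z 0) =
        (X - DimerCylinder.F₃ (DimerCylinder.cylPM Φ f) (s 0) (s 1) (s 2) (z 0) (z 1) (z 2)) *
        (X - DimerCylinder.F₃ (DimerCylinder.cylPM Φ f) (s 2) (s 1) (s 0) (z 2) (z 1) (z 0))) ∧
    -- the singularities that tell the two roots apart
    (∀ (s : ℤˣ) (z₁ z₃ : ℂ), DimerCylinder.IsConfiguration ℓ ![z₁, z₃] →
      (fun z₂ : ℂ => DimerCylinder.F₃ (DimerCylinder.cylPM Φ f) 1 1 s z₁ z₂ z₃ -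
          2 / (Real.pi * Complex.I) *
            (DimerCylinder.F₂ (DimerCylinder.cylPM Φ f) 1 s z₁ z₃ / (z₂ - z₁)))
        =O[𝓝[≠] z₁] (fun _ : ℂ => (1 : ℝ)) ∧
      (fun z₂ : ℂ => DimerCylinder.F₃ (DimerCylinder.cylPM Φ f) s 1 1 z₃ z₂ z₁ +
          2 / (Real.pi * Complex.I) *
            (DimerCylinder.F₂ (DimerCylinder.cylPM Φ f) 1 s z₁ z₃ / (z₂ - z₁)))
        =O[𝓝[≠] z₁] (fun _ : ℂ => (1 : ℝ))) := by
  obtain ⟨c, S, g, hS, hg, hK⟩ := DimerCylinder.exists_hasKernelForm hℓ Φ hf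
  obtain ⟨c', S', g', hS', hg', hK'⟩ := DimerCylinder.exists_hasKernelForm hℓ Φ' hf'
  -- The only place where the moments of the two domains are compared; the conclusions comparing the
  -- domains follow from equality of the kernels.
  have hSS : ∀ z ∉ DimerCylinder.lattice ℓ, S z = S' z := by
    obtain ⟨Q, hQ⟩ := hS.exists_cyclic_sum_eq hℓ
    obtain ⟨Q', hQ'⟩ := hS'.exists_cyclic_sum_eq hℓ
    have hQQ : Q' = Q :=
      (hK'.moment_three_eq hℓ hg' hQ' h₃').trans (hK.moment_three_eq hℓ hg hQ h₃).symm
    subst hQQ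
    exact fun z => hS.eq_of_invariants_eq hℓ hS'
      (hK.prod_neg_eq_of_moment_two_eq hℓ hS hS' hK' hg hg' h₂ h₂') hQ hQ'
  have hA : ∀ n : ℕ, ∀ z : Fin n → ℂ, DimerCylinder.IsConfiguration ℓ z → ∀ v : Fin n → ℂ,
      DimerCylinder.formA (DimerCylinder.cylPM Φ f) n z v =
        DimerCylinder.formA (DimerCylinder.cylPM Φ' f') n z v :=
    fun n z hz v => hK.formA_congr hK' hg hg' hSS hz v
  refine ⟨fun n _ => hA n, fun n _ M => ⟨DimerCylinder.formA_ext (hA n),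
    DimerCylinder.formA_ext fun z hz v => (hA n z hz v).symm⟩, fun s z hz => ?_,
    fun s z hz => ?_, fun s z hz X => ?_, fun s z₁ z₃ hz => ⟨?_, ?_⟩⟩
  · have hl := hz.sub_notMem (j := 1) (k := 0) (by decide)
    rw [hK.F₂_eq hg _ _ (hz.1 0) (hz.1 1) hl, hK'.F₂_eq hg' _ _ (hz.1 0) (hz.1 1) hl,
      hSS _ (hz.signed_sub_notMem (by decide) _ _), neg_sub,
      hSS _ (hz.signed_sub_notMem (by decide) _ _)]
  · have h10 := hz.sub_notMem (j := 1) (k := 0) (by decide)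
    have h21 := hz.sub_notMem (j := 2) (k := 1) (by decide)
    have h02 := hz.sub_notMem (j := 0) (k := 2) (by decide)
    rw [hK.F₃_eq hg _ _ _ (hz.1 0) (hz.1 1) (hz.1 2) h10 h21 h02,
      hK'.F₃_eq hg' _ _ _ (hz.1 0) (hz.1 1) (hz.1 2) h10 h21 h02,
      hSS _ (hz.signed_sub_notMem (j := 1) (k := 0) (by decide) _ _),
      hSS _ (hz.signed_sub_notMem (j := 2) (k := 1) (by decide) _ _),
      hSS _ (hz.signed_sub_notMem (j := 0) (k := 2) (by decide) _ _)]
  · obtain ⟨Q, hQ⟩ := hS.exists_cyclic_sum_eq hℓ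
    have h := hK.F₃_add_reverse hg hQ hz s
    rw [hK.moment_three_eq hℓ hg hQ h₃,
      DimerCylinder.HasKernelForm.two_div_pi_mul_I_pow_three] at h
    -- After unfolding, the product of the roots matches by commutativity, so only the sum in `h` is
    -- needed.
    simp only [DimerCylinder.F₂, DimerCylinder.F₃] at h ⊢
    push_cast
    linear_combination X * h
  · exact hK.isBigO_F₃_sub hg hS hℓ s (hz.1 0) (hz.1 1)
      (hz.sub_notMem (j := 1) (k := 0) (by decide))
  · exact hK.isBigO_F₃_add hg hS hℓ s (hz.1 0) (hz.1 1)
      (hz.sub_notMem (j := 1) (k := 0) (by decide))
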